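/- Let $n>1$ and let $G=G_1\times\dots\times G_n$ be a locally compact (Hausdorff), compactly generated topological group, where the $G_i$ are topological groups. Let $\Gamma$ be a uniform lattice in $G$ (a discrete subgroup with $G/\Gamma$ compact) which is irreducible, i.e. $\Gamma\cdot\prod_{j\neq i}G_j$ is dense in $G$ for each $1\le i\le n$. Let $X$ be a non-empty complete geodesic metric space such that: (a) $X$ is Busemann non-positively curved, i.e. for any two constant speed geodesics $c,c':[0,1]\to X$ the function $t\mapsto d(c(t),c'(t))$ is convex (in particular $X$ is uniquely geodesic; write $\frac{y_1+y_2}{2}$ for the midpoint of $y_1,y_2\in X$); (b) $X$ is uniformly convex, i.e. for every $\epsilon>0$ there is $\delta(\epsilon)>0$ such that for all $r>0$ and $x\in X$ $$\inf\Big\{r-d\big(x,\tfrac{y_1+y_2}{2}\big)\;:\;y_1,y_2\in X,\ d(x,y_1)\le r,\ d(x,y_2)\le r,\ d(y_1,y_2)\ge\epsilon r\Big\}\ \ge\ \delta(\epsilon)\,r ,$$ where $\inf\emptyset=\infty$; (c) $X$ is proper, i.e. its closed balls are compact. Let $\partial X$ be the visual boundary of $X$: the set of geodesic rays $[0,\infty)\to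 X$ modulo the relation of staying at bounded distance, with the topology of uniform convergence on compact sets of the rays issuing from a base point (it does not depend on the base point). Every isometric action on $X$ induces an action on $\partial X$. Assume that $\Gamma$ acts on $X$ by isometries without a global fixed point. Then there is a non-empty closed $\Gamma$-invariant subset $\mathcal{L}\subseteq\partial X$ on which the $\Gamma$-action extends to a continuous $G$-action $G\times\mathcal{L}\to\mathcal{L}$ which factors through the projection $G\to G_i$ for some $i$. -/

import Mathlib

open Set Filter Topology
open scoped NNReal

/-! ### Lattices in products -/

/-- A topological group is compactly generated if some compact subset generates it. -/
def IsCompactlyGeneratedGroup (G : Type*) [Group G] [TopologicalSpace G] : Prop :=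
  ∃ K : Set G, IsCompact K ∧ Subgroup.closure K = ⊤

/-- A uniform lattice: a discrete subgroup with compact quotient. -/
structure IsUniformLattice {G : Type*} [Group G] [TopologicalSpace G] (Γ : Subgroup G) :
    Prop where
  discrete : DiscreteTopology Γ
  cocompact : CompactSpace (G ⧸ Γ)

/-- A subgroup `Γ` of `∏ i, G i` is irreducible if, for every `i`, the set
`Γ · ∏_{j ≠ i} G j` is dense. Here `∏_{j ≠ i} G j` is the subgroup of elements whose
`i`-th coordinate is trivial. -/
def IsIrreducibleInProduct {ι : Type*} {G : ι → Type*} [∀ i, Group (G i)]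
    [∀ i, TopologicalSpace (G i)] (Γ : Subgroup (∀ i, G i)) : Prop :=
  ∀ i, Dense {g : ∀ j, G j | ∃ γ ∈ Γ, ∃ h : ∀ j, G j, h i = 1 ∧ g = γ * h}

/-! ### Busemann non-positive curvature and uniform convexity -/

section Spaces

variable {X : Type*} [MetricSpace X]

/-- `c` restricted to `[0, 1]` is a constant speed (minimizing) geodesic. -/
def IsConstSpeedGeodesic (c : ℝ → X) : Prop :=
  ∀ s ∈ Icc (0 : ℝ) 1, ∀ t ∈ Icc (0 : ℝ) 1, dist (c s) (c t) = |s - t| * dist (c 0) (c 1)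

/-- `m` is a midpoint of `x` and `y`. -/
def IsMetricMidpoint (x y m : X) : Prop :=
  dist x m = dist x y / 2 ∧ dist m y = dist x y / 2

/-- The modulus of convexity
`δ_x(ε, r) = inf {r - d(x, (y₁ + y₂) / 2) : d(x, yᵢ) ≤ r, d(y₁, y₂) ≥ ε r}`,
with the convention `inf ∅ = ∞`. -/
noncomputable def convexityModulus (x : X) (ε r : ℝ) : EReal :=
  sInf {s : EReal | ∃ y₁ y₂ m : X, dist x y₁ ≤ r ∧ dist x y₂ ≤ r ∧ ε * r ≤ dist y₁ y₂ ∧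
    IsMetricMidpoint y₁ y₂ m ∧ s = ((r - dist x m : ℝ) : EReal)}

variable (X)

/-- A complete geodesic metric space is Busemann non-positively curved if the distance between
any two constant speed geodesics is a convex function. -/
structure IsBusemannNPC : Prop where
  complete : CompleteSpace X
  geodesic : ∀ x y : X, ∃ c : ℝ → X, IsConstSpeedGeodesic c ∧ c 0 = x ∧ c 1 = y
  convex : ∀ c c' : ℝ → X, IsConstSpeedGeodesic c → IsConstSpeedGeodesic c' →
    ConvexOn ℝ (Icc (0 : ℝ) 1) (fun t => dist (c t) (c' t))

/-- Uniform convexity (of a uniquely geodesic space): `δ_x(ε, r) ≥ δ(ε) r` for all `r > 0`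
and all `x`, with `δ(ε) > 0`. -/
def IsUniformlyConvexMetric : Prop :=
  ∀ ε : ℝ, 0 < ε → ∃ δ : ℝ, 0 < δ ∧ ∀ r : ℝ, 0 < r → ∀ x : X,
    ((δ * r : ℝ) : EReal) ≤ convexityModulus x ε r

/-! ### The visual boundary -/

/-- Geodesic rays, with the topology of uniform convergence on compact sets. -/
abbrev GeodesicRay : Type _ := {r : C(ℝ≥0, X) // Isometry r}

/-- Two rays are asymptotic if they stay at bounded distance. -/
instance asymptoticSetoid : Setoid (GeodesicRay X) where
  r r₁ r₂ := ∃ C : ℝ, ∀ t : ℝ≥0, dist (r₁.1 t) (r₂.1 t) ≤ C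
  iseqv :=
    { refl := fun r => ⟨0, fun t => by simp⟩
      symm := fun ⟨C, h⟩ => ⟨C, fun t => by rw [dist_comm]; exact h t⟩
      trans := fun ⟨C, h⟩ ⟨D, k⟩ =>
        ⟨C + D, fun t => (dist_triangle _ _ _).trans (add_le_add (h t) (k t))⟩ }

/-- The visual boundary `∂X`: the set of asymptoty classes of geodesic rays. -/
def VisualBoundary : Type _ := Quotient (asymptoticSetoid X)

/-- The quotient topology. For a proper Busemann space every class contains exactly one ray
issuing from a given point `o`, and the topology is that of uniform convergence on compact sets
of the rays issuing from `o`, for each `o`: see `VisualBoundary.isHomeomorph_mk`. -/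
instance : TopologicalSpace (VisualBoundary X) :=
  inferInstanceAs (TopologicalSpace (Quotient (asymptoticSetoid X)))

end Spaces

/-- The endpoint at infinity of a ray. -/
def VisualBoundary.mk {X : Type*} [MetricSpace X] (r : GeodesicRay X) : VisualBoundary X :=
  Quotient.mk (asymptoticSetoid X) r

section Action

variable {Γ X : Type*} [Group Γ] [MetricSpace X] [MulAction Γ X] [IsIsometricSMul Γ X]

/-- The image of a ray under an isometry of a group acting on the space. -/
def GeodesicRay.translate (γ : Γ) (r : GeodesicRay X) : GeodesicRay X :=
  ⟨⟨fun t => γ • r.1 t, (isometry_smul X γ).continuous.comp r.1.continuous⟩,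
    (isometry_smul X γ).comp r.2⟩

/-- The action on the visual boundary induced by an isometric action: `γ • [r] = [γ ∘ r]`. -/
instance VisualBoundary.mulAction : MulAction Γ (VisualBoundary X) where
  smul γ := Quotient.map (GeodesicRay.translate γ)
    (fun _ _ ⟨C, h⟩ => ⟨C, fun t => by simpa [GeodesicRay.translate] using h t⟩)
  one_smul ξ := by
    induction ξ using Quotient.inductionOn with
    | h r =>
      refine congrArg (Quotient.mk _) (Subtype.ext (ContinuousMap.ext fun t => ?_))
      exact one_smul Γ (r.1 t)
  mul_smul γ γ' ξ := by
    induction ξ using Quotient.inductionOn with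
    | h r =>
      refine congrArg (Quotient.mk _) (Subtype.ext (ContinuousMap.ext fun t => ?_))
      exact mul_smul γ γ' (r.1 t)

end Action

section BoundaryTopology

variable {X : Type*} [MetricSpace X]

theorem GeodesicRay.isConstSpeedGeodesic (r : GeodesicRay X) (T : ℝ≥0) :
    IsConstSpeedGeodesic (fun s : ℝ => r.1 (s.toNNReal * T)) := by
  intro s hs t ht
  simp only [r.2.dist_eq, NNReal.dist_eq, NNReal.coe_mul, Real.coe_toNNReal _ hs.1,
    Real.coe_toNNReal _ ht.1, Real.toNNReal_zero, Real.toNNReal_one, NNReal.coe_zero,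
    zero_mul, one_mul, zero_sub, abs_neg, ← sub_mul, abs_mul]

theorem IsBusemannNPC.dist_le_of_asymptotic (hX : IsBusemannNPC X) {r r' : GeodesicRay X}
    (h : asymptoticSetoid X r r') (t : ℝ≥0) :
    dist (r.1 t) (r'.1 t) ≤ dist (r.1 0) (r'.1 0) := by
  obtain ⟨C, hC⟩ := h
  have key : ∀ T : ℝ≥0, 0 < T → t ≤ T → dist (r.1 t) (r'.1 t) ≤
      (1 - (t : ℝ) / T) * dist (r.1 0) (r'.1 0) + (t : ℝ) / T * C := by
    intro T hT htT
    have hT' : (0 : ℝ) < T := hT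
    have h0 : 0 ≤ (t : ℝ) / T := by positivity
    have h1 : (t : ℝ) / T ≤ 1 := (div_le_one hT').2 htT
    have := (hX.convex _ _ (r.isConstSpeedGeodesic T) (r'.isConstSpeedGeodesic T)).2
      (left_mem_Icc.2 zero_le_one) (right_mem_Icc.2 zero_le_one)
      (sub_nonneg.2 h1) h0 (sub_add_cancel _ _)
    have e : ((t : ℝ) / T).toNNReal * T = t := by
      apply NNReal.coe_injective
      rw [NNReal.coe_mul, Real.coe_toNNReal _ h0, div_mul_cancel₀ _ hT'.ne']
    simp only [smul_eq_mul, mul_zero, mul_one, zero_add, Real.toNNReal_zero, zero_mul,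
      Real.toNNReal_one, one_mul, e] at this
    have h2 := mul_le_mul_of_nonneg_left (hC T) h0
    linarith
  have l0 : Tendsto (fun T : ℝ≥0 => (t : ℝ) / T) atTop (𝓝 0) :=
    tendsto_const_nhds.div_atTop (NNReal.tendsto_coe_atTop.2 tendsto_id)
  have l1 := ((tendsto_const_nhds (x := (1 : ℝ))).sub l0).mul_const (dist (r.1 0) (r'.1 0))
    |>.add (l0.mul_const C)
  rw [sub_zero, one_mul, zero_mul, add_zero] at l1
  refine ge_of_tendsto l1 ?_
  filter_upwards [eventually_ge_atTop t, eventually_gt_atTop 0] with T h1 h2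
  exact key T h2 h1

theorem GeodesicRay.exists_limit [ProperSpace X] {ι : Type*} (F : Ultrafilter ι) (o : X)
    (q : ι → ℝ≥0 → X) (h0 : ∀ i, q i 0 = o)
    (hq : ∀ s t, ∀ᶠ i in (F : Filter ι), dist (q i s) (q i t) = dist s t) :
    ∃ r : GeodesicRay X, r.1 0 = o ∧ ∀ t, Tendsto (fun i => q i t) F (𝓝 (r.1 t)) := by
  have : ∀ t : ℝ≥0, ∃ x, Tendsto (fun i => q i t) F (𝓝 x) := by
    intro t
    have hc := isCompact_iff_ultrafilter_le_nhds.1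
      (isCompact_closedBall o (dist t 0)) (F.map fun i => q i t) (by
        rw [le_principal_iff, Ultrafilter.mem_coe, Ultrafilter.mem_map]
        filter_upwards [hq t 0] with i hi
        simp only [mem_preimage, Metric.mem_closedBall]
        rw [← h0 i, hi])
    obtain ⟨x, -, hx⟩ := hc
    exact ⟨x, hx⟩
  choose f hf using this
  have hiso : Isometry f := Isometry.of_dist_eq fun s t =>
    tendsto_nhds_unique ((hf s).dist (hf t))
      (tendsto_const_nhds.congr' ((hq s t).mono fun _ h => h.symm))
  refine ⟨⟨⟨f, hiso.continuous⟩, hiso⟩, ?_, hf⟩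
  exact tendsto_nhds_unique (hf 0) (tendsto_const_nhds.congr fun i => (h0 i).symm)

theorem IsBusemannNPC.exists_asymptotic [ProperSpace X] (hX : IsBusemannNPC X) (o : X)
    (r : GeodesicRay X) : ∃ r' : GeodesicRay X, r'.1 0 = o ∧ asymptoticSetoid X r r' := by
  set D := dist o (r.1 0) with hD
  choose c hc hc0 hc1 using fun n : ℕ => hX.geodesic o (r.1 n)
  set l : ℕ → ℝ := fun n => dist o (r.1 n) with hl
  have hn : ∀ n : ℕ, dist (r.1 0) (r.1 n) = n := fun n => by
    rw [r.2.dist_eq, NNReal.dist_eq]; simp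
  have hln : ∀ n : ℕ, |(n : ℝ) - l n| ≤ D := fun n => by
    have h1 := dist_triangle o (r.1 0) (r.1 n)
    have h2 := dist_triangle (r.1 0) o (r.1 n)
    rw [dist_comm (r.1 0) o] at h2
    rw [hn] at h1 h2
    rw [abs_le]
    constructor <;> simp only [hl] <;> linarith
  have hlt : Tendsto l atTop atTop := by
    refine tendsto_atTop_mono (fun n => ?_)
      (tendsto_atTop_add_const_right _ (-D) tendsto_natCast_atTop_atTop)
    have := (abs_le.1 (hln n)).2
    linarith
  have hF : ∀ t : ℝ≥0, ∀ᶠ n in (hyperfilter ℕ : Filter ℕ), (t : ℝ) ≤ l n ∧ 0 < l n := fun t =>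
    (Nat.hyperfilter_le_atTop)
      ((hlt.eventually_ge_atTop (t : ℝ)).and (hlt.eventually_gt_atTop 0))
  obtain ⟨r', h0, hr'⟩ := GeodesicRay.exists_limit (hyperfilter ℕ) o
    (fun n t => c n ((t : ℝ) / l n)) (fun n => by simp [hc0]) (by
      intro s t
      filter_upwards [hF s, hF t] with n hs ht
      rw [hc n _ ⟨by have := hs.2; positivity, (div_le_one hs.2).2 hs.1⟩ _
        ⟨by have := hs.2; positivity, (div_le_one ht.2).2 ht.1⟩, hc0, hc1, ← sub_div, abs_div,
        abs_of_pos hs.2, NNReal.dist_eq]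
      exact div_mul_cancel₀ _ hs.2.ne')
  refine ⟨r', h0, 2 * D, fun t => ?_⟩
  refine le_of_tendsto (tendsto_const_nhds.dist (hr' t)) ?_
  filter_upwards [hF t] with n hn'
  have ht0 : 0 ≤ (t : ℝ) / l n := by have := hn'.2; positivity
  have ht1 : (t : ℝ) / l n ≤ 1 := (div_le_one hn'.2).2 hn'.1
  have hcv := (hX.convex _ _ (r.isConstSpeedGeodesic n) (hc n)).2
      (left_mem_Icc.2 zero_le_one) (right_mem_Icc.2 zero_le_one)
      (sub_nonneg.2 ht1) ht0 (sub_add_cancel _ _)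
  simp only [smul_eq_mul, mul_zero, mul_one, zero_add, Real.toNNReal_zero, zero_mul,
      Real.toNNReal_one, one_mul, hc0, hc1, dist_self, add_zero] at hcv
  have h3 : dist (r.1 t) (r.1 (((t : ℝ) / l n).toNNReal * n)) ≤ D := by
    rw [r.2.dist_eq, NNReal.dist_eq, NNReal.coe_mul, Real.coe_toNNReal _ ht0, NNReal.coe_natCast]
    have : (t : ℝ) - t / l n * n = t / l n * (l n - n) := by
      field_simp [hn'.2.ne']
    rw [this, abs_mul, abs_of_nonneg ht0, abs_sub_comm]
    exact (mul_le_of_le_one_left (abs_nonneg _) ht1).trans (hln n)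
  have h4 : (1 - (t : ℝ) / l n) * dist (r.1 0) o ≤ D := by
    rw [dist_comm, hD]
    exact mul_le_of_le_one_left dist_nonneg (by linarith)
  have h5 := dist_triangle (r.1 t) (r.1 (((t : ℝ) / l n).toNNReal * n)) (c n ((t : ℝ) / l n))
  linarith

/-- In a proper Busemann space the visual boundary is homeomorphic, for every base point `o`, to
the space of geodesic rays issuing from `o`, with the topology of uniform convergence on compact
sets. -/
theorem VisualBoundary.isHomeomorph_mk [ProperSpace X] (hX : IsBusemannNPC X) (o : X) :
    IsHomeomorph (fun r : {r : GeodesicRay X // r.1 0 = o} => VisualBoundary.mk r.1) := by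
  choose S hS0 hS using hX.exists_asymptotic o
  have huniq : ∀ r r' : GeodesicRay X, r.1 0 = o → r'.1 0 = o → asymptoticSetoid X r r' →
      r = r' := by
    intro r r' h h' ha
    refine Subtype.ext (ContinuousMap.ext fun t => dist_le_zero.1 ?_)
    simpa [h, h'] using hX.dist_le_of_asymptotic ha t
  have hpt : ∀ t : ℝ≥0, Continuous fun r : GeodesicRay X => (S r).1 t := by
    intro t
    rw [continuous_iff_ultrafilter]
    intro r F hF
    obtain ⟨q, hq0, hq⟩ := GeodesicRay.exists_limit F o (fun r t => (S r).1 t) hS0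
      (fun s t => Eventually.of_forall fun r => (S r).2.dist_eq s t)
    have he : ∀ u : ℝ≥0, Tendsto (fun r' : GeodesicRay X => r'.1 u) F (𝓝 (r.1 u)) := fun u =>
      (((continuous_eval_const u).comp continuous_subtype_val).tendsto r).mono_left
        hF
    have hb : ∀ u, dist (r.1 u) (q.1 u) ≤ dist (r.1 0) o := fun u =>
      le_of_tendsto_of_tendsto ((he u).dist (hq u)) ((he 0).dist tendsto_const_nhds)
        (Eventually.of_forall fun r' => by
          simpa [hS0] using hX.dist_le_of_asymptotic (hS r') u)
    have : S r = q := huniq _ _ (hS0 r) hq0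
      ((asymptoticSetoid X).trans ((asymptoticSetoid X).symm (hS r)) ⟨_, hb⟩)
    rw [this]
    exact hq t
  have hScont : Continuous S := by
    refine Continuous.subtype_mk (f := fun r => (S r).1)
      (ContinuousMap.continuous_of_continuous_uncurry _ ?_) _
    rw [continuous_iff_continuousAt]
    rintro ⟨r, t⟩
    rw [ContinuousAt, tendsto_iff_dist_tendsto_zero]
    have l : Tendsto (fun p : GeodesicRay X × ℝ≥0 =>
        dist p.2 t + dist ((S p.1).1 t) ((S r).1 t)) (𝓝 (r, t)) (𝓝 0) := by
      have : Continuous fun p : GeodesicRay X × ℝ≥0 =>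
        dist p.2 t + dist ((S p.1).1 t) ((S r).1 t) := by
        have := (hpt t).comp (continuous_fst (X := GeodesicRay X) (Y := ℝ≥0))
        exact (continuous_snd.dist continuous_const).add (this.dist continuous_const)
      simpa using this.tendsto (r, t)
    refine squeeze_zero (fun _ => dist_nonneg) (fun p => ?_) l
    refine (dist_triangle _ ((S p.1).1 t) _).trans (add_le_add ?_ le_rfl)
    exact ((S p.1).2.dist_eq p.2 t).le
  let g : VisualBoundary X → {r : GeodesicRay X // r.1 0 = o} :=
    Quotient.lift (fun r => ⟨S r, hS0 r⟩) fun r r' h => Subtype.ext (huniq _ _ (hS0 _) (hS0 _)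
      ((asymptoticSetoid X).trans ((asymptoticSetoid X).symm (hS r))
        ((asymptoticSetoid X).trans h (hS r'))))
  refine isHomeomorph_iff_exists_inverse.2 ⟨?_, g, ?_, ?_, ?_⟩
  · exact continuous_quotient_mk'.comp continuous_subtype_val
  · rintro ⟨r, hr⟩
    exact Subtype.ext (huniq _ _ (hS0 r) hr ((asymptoticSetoid X).symm (hS r)))
  · intro ξ
    induction ξ using Quotient.inductionOn with
    | h r => exact Quotient.sound ((asymptoticSetoid X).symm (hS r))
  · exact (hScont.subtype_mk _).quotient_lift _

end BoundaryTopology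

/-!
Let `φ : G → X` range over the measurable `Γ`-equivariant maps that are limits of continuous ones in
the `L²` distance over a fundamental domain of `Γ`. They form a complete uniformly convex space,
since the squared form of uniform convexity (`IsUCBusemann.exists_sq_dist_mid_le`) can be integrated,
and `G` acts on it isometrically by right translations. Constant equivariant maps are the fixed
points of `Γ` in `X`, so the idea is to make an equivariant map as constant as possible along one
factor `B = G i` after another, while controlling it along the complementary factor
`A = ∏ j ≠ i, G j`.

* If `Γ` fixes a point `ξ` at infinity, take `L = {ξ}`. Otherwise the displacement of the points of
  `X` under finitely many elements of `Γ` grows linearly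
  (`IsBusemannNPC.exists_dist_le_displacement`), and hence so does the displacement of equivariant
  maps under a compact subset of `G` (`L2Equivariant.exists_coercive`).
* Start from a continuous equivariant map, which is moved a bounded amount by each element of `A`,
  and consider the equivariant maps that are moved by `A` at most as much. Coercivity and uniform
  convexity give a minimal nonempty closed convex `B`-invariant set `Z` of such maps
  (`L2Equivariant.exists_minimal`): points of an invariant convex set that are almost as close as
  possible to the given map are almost fixed by compact subsets of `B`, hence stay in a bounded set.
* For `k ∈ A` the displacement `ψ ↦ d(ψ, k ψ)` is convex and `B`-invariant, so it is constant on `Z`.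
  By the parallelogram lemma (`IsUCBusemann.dist_eq_dist_of_parallel`) the function
  `g ↦ d(ψ g, ψ' g)` is right `A`-invariant for `ψ, ψ' ∈ Z`. It is left `Γ`-invariant and `Γ A` is
  dense, so it is constant (`ae_eq_const_of_invariant`). As a consequence the members of `Z` are
  continuous up to null sets.
* If `Z` is bounded it is a point, that is, a map invariant under `B` and under whatever factors left
  the initial map invariant. If this happens for all factors, the result is a constant equivariant
  map, so `Γ` has a fixed point in `X`.
* If `Z` is unbounded for some factor, then `K = {ψ 1 | ψ ∈ Z}` is an unbounded closed convex subset
  of `X` on which `B` acts by translating the maps, and `γ ∈ Γ` moves the points of `K` to within a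
  bounded distance of the points to which its `B`-component moves them. So the actions of `Γ` and of
  `B` on the set `L` of the endpoints of rays in `K` agree (`IsUCBusemann.exists_boundary_action`).

The group `G` is not assumed to be second countable. Fubini's theorem is therefore used for
continuous functions with compact support only, and statements about measurable functions are
reduced to this case by testing against such functions.
-/

set_option linter.unusedSectionVars false

/-! ### Midpoints in uniformly convex Busemann spaces -/

section Midpoints

variable {X : Type*} [MetricSpace X]

theorem IsMetricMidpoint.symm {x y m : X} (h : IsMetricMidpoint x y m) :
    IsMetricMidpoint y x m := by
  obtain ⟨h1, h2⟩ := h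
  exact ⟨by rw [dist_comm y m, dist_comm y x, h2], by rw [dist_comm m x, dist_comm y x, h1]⟩

theorem isMetricMidpoint_of_le {x y m : X} {a b : ℝ} (h1 : dist x m ≤ a) (h2 : dist m y ≤ b)
    (h3 : a = b) (h : a + b ≤ dist x y) : IsMetricMidpoint x y m := by
  have := dist_triangle x m y
  constructor <;> linarith

theorem IsConstSpeedGeodesic.isMetricMidpoint {c : ℝ → X} (hc : IsConstSpeedGeodesic c)
    {s t : ℝ} (hs : s ∈ Icc (0 : ℝ) 1) (ht : t ∈ Icc (0 : ℝ) 1) :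
    IsMetricMidpoint (c s) (c t) (c ((s + t) / 2)) := by
  have hm : (s + t) / 2 ∈ Icc (0 : ℝ) 1 := ⟨by linarith [hs.1, ht.1], by linarith [hs.2, ht.2]⟩
  have e1 : s - (s + t) / 2 = (s - t) / 2 := by ring
  have e2 : (s + t) / 2 - t = (s - t) / 2 := by ring
  refine ⟨?_, ?_⟩
  · rw [hc s hs _ hm, hc s hs t ht, e1, abs_div, abs_two]; ring
  · rw [hc _ hm t ht, hc s hs t ht, e2, abs_div, abs_two]; ring

/-- The definition of uniform convexity, unfolded. -/
theorem IsUniformlyConvexMetric.exists_dist_le (hUC : IsUniformlyConvexMetric X) {ε : ℝ}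
    (hε : 0 < ε) : ∃ δ : ℝ, 0 < δ ∧ ∀ r : ℝ, 0 < r → ∀ x y₁ y₂ m : X, dist x y₁ ≤ r →
      dist x y₂ ≤ r → ε * r ≤ dist y₁ y₂ → IsMetricMidpoint y₁ y₂ m →
      dist x m ≤ (1 - δ) * r := by
  obtain ⟨δ, hδ, h⟩ := hUC ε hε
  refine ⟨δ, hδ, fun r hr x y₁ y₂ m h1 h2 h3 h4 => ?_⟩
  have := (h r hr x).trans (sInf_le ⟨y₁, y₂, m, h1, h2, h3, h4, rfl⟩)
  have := EReal.coe_le_coe_iff.1 this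
  linarith

theorem IsMetricMidpoint.eq (hX : IsBusemannNPC X) (hUC : IsUniformlyConvexMetric X)
    {x y m m' : X} (h : IsMetricMidpoint x y m) (h' : IsMetricMidpoint x y m') : m = m' := by
  by_contra hne
  have hd : 0 < dist m m' := dist_pos.2 hne
  obtain ⟨c, hc, rfl, rfl⟩ := hX.geodesic m m'
  have hn := hc.isMetricMidpoint (left_mem_Icc.2 zero_le_one) (right_mem_Icc.2 zero_le_one)
  set n := c ((0 + 1) / 2)
  have hr : 0 < dist x y / 2 := by
    have := dist_triangle_left (c 0) (c 1) x
    rw [h.1, h'.1] at this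
    linarith
  obtain ⟨δ, hδ, H⟩ := hUC.exists_dist_le (div_pos hd hr)
  have h1 := H _ hr x _ _ n h.1.le h'.1.le (div_mul_cancel₀ _ hr.ne').le hn
  have h2 := H _ hr y _ _ n (dist_comm (c 0) y ▸ h.2.le) (dist_comm (c 1) y ▸ h'.2.le)
    (div_mul_cancel₀ _ hr.ne').le hn
  have := dist_triangle_right x y n
  nlinarith

variable (X) in
/-- The standing assumptions on the space: complete, Busemann non-positively curved, uniformly
convex. They are bundled so that the midpoint can be a function of two points. -/
structure IsUCBusemann : Prop where
  npc : IsBusemannNPC X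
  uc : IsUniformlyConvexMetric X

/-- The midpoint of two points of a Busemann space. -/
noncomputable def IsUCBusemann.mid (hX : IsUCBusemann X) (x y : X) : X :=
  (hX.npc.geodesic x y).choose (1 / 2)

namespace IsUCBusemann

variable (hX : IsUCBusemann X)

theorem isMetricMidpoint_mid (x y : X) : IsMetricMidpoint x y (hX.mid x y) := by
  obtain ⟨hc, h0, h1⟩ := (hX.npc.geodesic x y).choose_spec
  have := hc.isMetricMidpoint (left_mem_Icc.2 zero_le_one) (right_mem_Icc.2 zero_le_one)
  rw [h0, h1, zero_add] at this
  exact this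

theorem eq_mid {x y m : X} (h : IsMetricMidpoint x y m) : m = hX.mid x y :=
  h.eq hX.npc hX.uc (hX.isMetricMidpoint_mid x y)

theorem mid_comm (x y : X) : hX.mid x y = hX.mid y x :=
  hX.eq_mid (hX.isMetricMidpoint_mid x y).symm

theorem dist_left_mid (x y : X) : dist x (hX.mid x y) = dist x y / 2 :=
  (hX.isMetricMidpoint_mid x y).1

theorem dist_mid_right (x y : X) : dist (hX.mid x y) y = dist x y / 2 :=
  (hX.isMetricMidpoint_mid x y).2

theorem mid_self (x : X) : hX.mid x x = x := by
  have := hX.dist_left_mid x x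
  rw [dist_self, zero_div] at this
  exact (dist_eq_zero.1 this).symm

theorem dist_mid_mid_left_le (x y z : X) : dist (hX.mid x y) (hX.mid x z) ≤ dist y z / 2 := by
  obtain ⟨c, hc, hc0, hc1⟩ := hX.npc.geodesic x y
  obtain ⟨c', hc', hc0', hc1'⟩ := hX.npc.geodesic x z
  have e := hc.isMetricMidpoint (left_mem_Icc.2 zero_le_one) (right_mem_Icc.2 zero_le_one)
  have e' := hc'.isMetricMidpoint (left_mem_Icc.2 zero_le_one) (right_mem_Icc.2 zero_le_one)
  rw [hc0, hc1] at e
  rw [hc0', hc1'] at e'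
  rw [← hX.eq_mid e, ← hX.eq_mid e']
  have := (hX.npc.convex c c' hc hc').2 (left_mem_Icc.2 zero_le_one)
    (right_mem_Icc.2 zero_le_one) (show (0 : ℝ) ≤ 1 / 2 by norm_num)
    (show (0 : ℝ) ≤ 1 / 2 by norm_num) (by norm_num)
  simp only [smul_eq_mul, hc0, hc0', hc1, hc1', dist_self] at this
  norm_num at this ⊢
  linarith

theorem dist_mid_mid_le (x y x' y' : X) :
    dist (hX.mid x y) (hX.mid x' y') ≤ (dist x x' + dist y y') / 2 := by
  have h1 := hX.dist_mid_mid_left_le x y y'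
  have h2 := hX.dist_mid_mid_left_le y' x x'
  rw [hX.mid_comm y' x, hX.mid_comm y' x'] at h2
  linarith [dist_triangle (hX.mid x y) (hX.mid x y') (hX.mid x' y')]

theorem dist_mid_le (x y z : X) : dist x (hX.mid y z) ≤ (dist x y + dist x z) / 2 := by
  simpa only [hX.mid_self] using hX.dist_mid_mid_le x x y z

theorem continuous_mid : Continuous fun p : X × X => hX.mid p.1 p.2 := by
  rw [continuous_iff_continuousAt]
  rintro ⟨x, y⟩
  rw [ContinuousAt, tendsto_iff_dist_tendsto_zero]
  have l : Tendsto (fun p : X × X => (dist p.1 x + dist p.2 y) / 2) (𝓝 (x, y)) (𝓝 0) := by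
    have : Continuous fun p : X × X => (dist p.1 x + dist p.2 y) / 2 := by fun_prop
    simpa using this.tendsto (x, y)
  exact squeeze_zero (fun _ => dist_nonneg) (fun p => hX.dist_mid_mid_le _ _ _ _) l

theorem smul_mid {Γ : Type*} [Group Γ] [MulAction Γ X] [IsIsometricSMul Γ X] (γ : Γ) (x y : X) :
    γ • hX.mid x y = hX.mid (γ • x) (γ • y) := by
  apply hX.eq_mid
  constructor
  · rw [dist_smul, dist_smul, dist_left_mid]
  · rw [dist_smul, dist_smul, dist_mid_right]

/-- A quadratic form of uniform convexity. Unlike the modulus of convexity, this inequality can be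
integrated, so it passes to spaces of square integrable maps. -/
theorem exists_sq_dist_mid_le {ε : ℝ} (hε : 0 < ε) : ∃ c : ℝ, 0 < c ∧ ∀ x y z : X,
    dist x (hX.mid y z) ^ 2 ≤ (dist x y ^ 2 + dist x z ^ 2) / 2
      - c * (dist y z ^ 2 - ε ^ 2 * (dist x y ^ 2 + dist x z ^ 2)) := by
  obtain ⟨δ₀, hδ₀, H⟩ := hX.uc.exists_dist_le hε
  set δ := min δ₀ 1 with hδ
  have hδ0 : 0 < δ := lt_min hδ₀ one_pos
  have hδ1 : δ ≤ 1 := min_le_right _ _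
  refine ⟨δ ^ 2 / 64, by positivity, fun x y z => ?_⟩
  have key : ∀ a b : ℝ, 0 ≤ a → a ≤ b → dist x y ≤ b → dist x z ≤ b →
      dist x (hX.mid y z) ≤ (a + b) / 2 → dist y z ≤ 2 * b →
      dist x (hX.mid y z) ^ 2 ≤ (a ^ 2 + b ^ 2) / 2
      - δ ^ 2 / 64 * (dist y z ^ 2 - ε ^ 2 * (a ^ 2 + b ^ 2)) := by
    intro a b ha hab h1 h2 h3 h4
    have hd : 0 ≤ dist x (hX.mid y z) := dist_nonneg
    have hyz : 0 ≤ dist y z := dist_nonneg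
    rcases lt_or_ge (dist y z) (ε * b) with hlt | hge
    · have e1 : dist y z ^ 2 ≤ ε ^ 2 * (a ^ 2 + b ^ 2) := by
        have : dist y z ^ 2 ≤ (ε * b) ^ 2 := pow_le_pow_left₀ hyz hlt.le 2
        nlinarith [sq_nonneg (ε * a)]
      have e2 : dist x (hX.mid y z) ^ 2 ≤ ((a + b) / 2) ^ 2 := pow_le_pow_left₀ hd h3 2
      have : 0 ≤ δ ^ 2 / 64 * (ε ^ 2 * (a ^ 2 + b ^ 2) - dist y z ^ 2) :=
        mul_nonneg (by positivity) (by linarith)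
      nlinarith [sq_nonneg (a - b)]
    · rcases (ha.trans hab).eq_or_lt with hb | hb
      · have ha' : a = 0 := le_antisymm (hb ▸ hab) ha
        have e1 : dist y z = 0 := le_antisymm (by rw [← hb] at h4; linarith) hyz
        have e2 : dist x (hX.mid y z) = 0 := le_antisymm (by rw [← hb, ha'] at h3; linarith) hd
        rw [e1, e2, ← hb, ha']
        norm_num
      have h5 : dist x (hX.mid y z) ≤ (1 - δ) * b := by
        have := H b hb x y z _ h1 h2 hge (hX.isMetricMidpoint_mid y z)
        have hm : δ * b ≤ δ₀ * b := mul_le_mul_of_nonneg_right (min_le_left _ _) hb.le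
        linarith
      -- it suffices to gain `δ² / 16 * b²`
      suffices hs : dist x (hX.mid y z) ^ 2 ≤ (a ^ 2 + b ^ 2) / 2 - δ ^ 2 / 16 * b ^ 2 by
        have e1 : dist y z ^ 2 ≤ (2 * b) ^ 2 := pow_le_pow_left₀ hyz h4 2
        have e2 : δ ^ 2 / 64 * (dist y z ^ 2 - ε ^ 2 * (a ^ 2 + b ^ 2)) ≤
            δ ^ 2 / 64 * (2 * b) ^ 2 := by
          apply mul_le_mul_of_nonneg_left _ (by positivity)
          have : 0 ≤ ε ^ 2 * (a ^ 2 + b ^ 2) := by positivity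
          linarith
        linarith
      rcases le_or_gt (δ / 2 * b) (b - a) with hc | hc
      · have e2 : dist x (hX.mid y z) ^ 2 ≤ ((a + b) / 2) ^ 2 := pow_le_pow_left₀ hd h3 2
        have e3 : (δ / 2 * b) ^ 2 ≤ (b - a) ^ 2 := pow_le_pow_left₀ (by positivity) hc 2
        nlinarith
      · have e2 : dist x (hX.mid y z) ^ 2 ≤ ((1 - δ) * b) ^ 2 := pow_le_pow_left₀ hd h5 2
        have e3 : ((1 - δ / 2) * b) ^ 2 ≤ a ^ 2 :=
          pow_le_pow_left₀ (mul_nonneg (by linarith) hb.le) (by linarith) 2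
        have e4 : ((1 - δ) ^ 2 + δ ^ 2 / 16) * b ^ 2 ≤ ((1 - δ / 2) ^ 2 + 1) / 2 * b ^ 2 :=
          mul_le_mul_of_nonneg_right (by nlinarith) (sq_nonneg b)
        nlinarith
  have h4 : dist y z ≤ dist x y + dist x z := dist_triangle_left _ _ _
  have h3 := hX.dist_mid_le x y z
  rcases le_total (dist x y) (dist x z) with h | h
  · exact key _ _ dist_nonneg h h le_rfl h3 (by linarith)
  · have := key _ _ dist_nonneg h le_rfl h (by linarith) (by linarith)
    rwa [add_comm (dist x z ^ 2)] at this

/-- One half of the parallelogram lemma: see `dist_eq_dist_of_parallel`. -/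
theorem parallel_subdivide {x x' y y' : X} {a : ℝ} (h0 : dist x y = a) (h1 : dist x' y' = a)
    (hm : dist (hX.mid x x') (hX.mid y y') = a) :
    dist (hX.mid x y) (hX.mid x' y') ≤ dist x x' ∧
      dist (hX.mid x y) y = a / 2 ∧ dist (hX.mid x' y') y' = a / 2 ∧
      dist (hX.mid (hX.mid x y) (hX.mid x' y')) (hX.mid y y') = a / 2 := by
  set z := hX.mid x y'
  set p := hX.mid x y
  set q := hX.mid x' y'
  have hz : z = hX.mid (hX.mid x x') (hX.mid y y') := by
    apply hX.eq_mid
    refine isMetricMidpoint_of_le (a := a / 2) (b := a / 2) ?_ ?_ rfl (by linarith)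
    · have := hX.dist_mid_mid_left_le x x' y'
      rwa [h1] at this
    · have := hX.dist_mid_mid_left_le y' x y
      rwa [h0, hX.mid_comm y' x, hX.mid_comm y' y] at this
  have hz' : hX.mid x' y = z := by
    rw [hz]
    apply hX.eq_mid
    refine isMetricMidpoint_of_le (a := a / 2) (b := a / 2) ?_ ?_ rfl (by linarith)
    · have := hX.dist_mid_mid_left_le x' x y
      rwa [h0, hX.mid_comm x' x] at this
    · have := hX.dist_mid_mid_left_le y x' y'
      rwa [h1, hX.mid_comm y x'] at this
  have hpq : hX.mid p q = z := by
    rw [hz]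
    apply hX.eq_mid
    refine isMetricMidpoint_of_le (a := a / 2) (b := a / 2) ?_ ?_ rfl (by linarith)
    · have := hX.dist_mid_mid_le x x' p q
      rw [hX.dist_left_mid, hX.dist_left_mid, h0, h1] at this
      linarith
    · have := hX.dist_mid_mid_le p q y y'
      rw [hX.dist_mid_right, hX.dist_mid_right, h0, h1] at this
      linarith
  refine ⟨?_, by rw [hX.dist_mid_right, h0], by rw [hX.dist_mid_right, h1], ?_⟩
  · have e1 := hX.dist_left_mid p q
    have e2 := hX.dist_mid_mid_left_le y x x'
    rw [hX.mid_comm y x, hX.mid_comm y x', hz', ← hpq, e1] at e2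
    linarith
  · rw [hpq, hz, hX.dist_mid_right, hm]

theorem dist_le_dist_of_parallel {x x' y y' : X} {a : ℝ} (h0 : dist x y = a)
    (h1 : dist x' y' = a) (hm : dist (hX.mid x x') (hX.mid y y') = a) :
    dist y y' ≤ dist x x' := by
  -- bisect towards the side `[y, y']`
  have key : ∀ n : ℕ, ∃ p q : X, dist p q ≤ dist x x' ∧ dist p y = a / 2 ^ n ∧
      dist q y' = a / 2 ^ n ∧ dist (hX.mid p q) (hX.mid y y') = a / 2 ^ n := by
    intro n
    induction n with
    | zero => exact ⟨x, x', le_rfl, by simpa using h0, by simpa using h1, by simpa using hm⟩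
    | succ n ih =>
      obtain ⟨p, q, h, hp, hq, hpq⟩ := ih
      obtain ⟨i1, i2, i3, i4⟩ := hX.parallel_subdivide hp hq hpq
      have e : a / 2 ^ (n + 1) = a / 2 ^ n / 2 := by rw [pow_succ, div_div]
      exact ⟨_, _, i1.trans h, by rw [e, i2], by rw [e, i3], by rw [e, i4]⟩
  have hle : ∀ n : ℕ, dist y y' ≤ dist x x' + 2 * (a * (1 / 2) ^ n) := by
    intro n
    obtain ⟨p, q, h, hp, hq, -⟩ := key n
    have e : a / 2 ^ n = a * (1 / 2) ^ n := by rw [one_div, inv_pow, div_eq_mul_inv]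
    have := dist_triangle4 y p q y'
    rw [dist_comm y p, hp, hq, e] at this
    linarith
  have l : Tendsto (fun n : ℕ => dist x x' + 2 * (a * (1 / 2 : ℝ) ^ n)) atTop
      (𝓝 (dist x x' + 2 * (a * 0))) :=
    (((tendsto_pow_atTop_nhds_zero_of_lt_one (by norm_num) (by norm_num)).const_mul a).const_mul
      2).const_add _
  rw [mul_zero, mul_zero, add_zero] at l
  exact ge_of_tendsto' l hle

/-- The parallelogram lemma: if the segments `[x, x']` and `[y, y']` stay at constant distance, in
the weak sense that the endpoints and the midpoints have the same distance, then they have the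
same length. -/
theorem dist_eq_dist_of_parallel {x x' y y' : X} {a : ℝ} (h0 : dist x y = a)
    (h1 : dist x' y' = a) (hm : dist (hX.mid x x') (hX.mid y y') = a) :
    dist x x' = dist y y' :=
  le_antisymm
    (hX.dist_le_dist_of_parallel (by rw [dist_comm, h0]) (by rw [dist_comm, h1])
      (by rw [dist_comm, hm]))
    (hX.dist_le_dist_of_parallel h0 h1 hm)

end IsUCBusemann

end Midpoints

/-! ### Rays, limit points and convex subsets -/

section Rays

variable {X : Type*} [MetricSpace X]

theorem IsConstSpeedGeodesic.smul {Γ : Type*} [Group Γ] [MulAction Γ X] [IsIsometricSMul Γ X]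
    {c : ℝ → X} (hc : IsConstSpeedGeodesic c) (γ : Γ) :
    IsConstSpeedGeodesic fun t => γ • c t := fun s hs t ht => by
  simpa only [dist_smul] using hc s hs t ht

/-- Geodesics to a sequence of points that leaves every bounded set accumulate at a ray. -/
theorem IsBusemannNPC.exists_limit_ray [ProperSpace X] (hX : IsBusemannNPC X) (o : X) (x : ℕ → X)
    (hx : Tendsto (fun n => dist o (x n)) atTop atTop) :
    ∃ (r : GeodesicRay X) (c : ℕ → ℝ → X), r.1 0 = o ∧
      (∀ n, IsConstSpeedGeodesic (c n) ∧ c n 0 = o ∧ c n 1 = x n) ∧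
      ∀ t : ℝ≥0, Tendsto (fun n => c n ((t : ℝ) / dist o (x n))) (hyperfilter ℕ : Filter ℕ)
        (𝓝 (r.1 t)) := by
  choose c hc hc0 hc1 using fun n : ℕ => hX.geodesic o (x n)
  have hF : ∀ t : ℝ≥0, ∀ᶠ n in (hyperfilter ℕ : Filter ℕ),
      (t : ℝ) ≤ dist o (x n) ∧ 0 < dist o (x n) := fun t =>
    Nat.hyperfilter_le_atTop
      ((hx.eventually_ge_atTop (t : ℝ)).and (hx.eventually_gt_atTop 0))
  obtain ⟨r, h0, hr⟩ := GeodesicRay.exists_limit (hyperfilter ℕ) o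
    (fun n t => c n ((t : ℝ) / dist o (x n))) (fun n => by simp [hc0]) (by
      intro s t
      filter_upwards [hF s, hF t] with n hs ht
      rw [hc n _ ⟨by positivity, (div_le_one hs.2).2 hs.1⟩ _
        ⟨by positivity, (div_le_one ht.2).2 ht.1⟩, hc0, hc1, ← sub_div, abs_div,
        abs_of_pos hs.2, NNReal.dist_eq]
      exact div_mul_cancel₀ _ hs.2.ne')
  exact ⟨r, c, h0, fun n => ⟨hc n, hc0 n, hc1 n⟩, hr⟩

/-- If a sequence goes to infinity and is displaced sublinearly by every element of the group, then
the group fixes a point at infinity. -/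
theorem IsBusemannNPC.exists_fixed_of_sublinear [ProperSpace X] (hX : IsBusemannNPC X)
    {Γ : Type*} [Group Γ] [MulAction Γ X] [IsIsometricSMul Γ X] (o : X) (x : ℕ → X)
    (hx : Tendsto (fun n => dist o (x n)) atTop atTop)
    (hd : ∀ γ : Γ, Tendsto (fun n => dist (x n) (γ • x n) / dist o (x n)) atTop (𝓝 0)) :
    ∃ ξ : VisualBoundary X, ∀ γ : Γ, γ • ξ = ξ := by
  obtain ⟨r, c, h0, hc, hr⟩ := hX.exists_limit_ray o x hx
  refine ⟨VisualBoundary.mk r, fun γ => ?_⟩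
  refine Quotient.sound ((asymptoticSetoid X).symm ⟨dist o (γ • o), fun t => ?_⟩)
  have l1 : Tendsto (fun n => dist (c n ((t : ℝ) / dist o (x n)))
      (γ • c n ((t : ℝ) / dist o (x n)))) (hyperfilter ℕ : Filter ℕ)
      (𝓝 (dist (r.1 t) (γ • r.1 t))) :=
    (hr t).dist (((isometry_smul X γ).continuous.tendsto _).comp (hr t))
  have l2 : Tendsto (fun n => dist o (γ • o) + t * (dist (x n) (γ • x n) / dist o (x n)))
      (hyperfilter ℕ : Filter ℕ) (𝓝 (dist o (γ • o) + t * 0)) :=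
    (((hd γ).const_mul _).const_add _).mono_left Nat.hyperfilter_le_atTop
  rw [mul_zero, add_zero] at l2
  refine le_of_tendsto_of_tendsto l1 l2 ?_
  filter_upwards [Nat.hyperfilter_le_atTop
      ((hx.eventually_ge_atTop (t : ℝ)).and (hx.eventually_gt_atTop 0))] with n hn
  have ht0 : 0 ≤ (t : ℝ) / dist o (x n) := by positivity
  have ht1 : (t : ℝ) / dist o (x n) ≤ 1 := (div_le_one hn.2).2 hn.1
  have hcv := (hX.convex _ _ (hc n).1 ((hc n).1.smul γ)).2
      (left_mem_Icc.2 zero_le_one) (right_mem_Icc.2 zero_le_one)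
      (sub_nonneg.2 ht1) ht0 (sub_add_cancel _ _)
  simp only [smul_eq_mul, mul_zero, mul_one, zero_add, (hc n).2.1, (hc n).2.2] at hcv
  have e : (t : ℝ) / dist o (x n) * dist (x n) (γ • x n)
      = t * (dist (x n) (γ • x n) / dist o (x n)) := by ring
  have : (1 - (t : ℝ) / dist o (x n)) * dist o (γ • o) ≤ dist o (γ • o) :=
    mul_le_of_le_one_left dist_nonneg (by linarith)
  linarith

/-- Without fixed points at infinity, the displacement by finitely many elements grows
linearly. -/
theorem IsBusemannNPC.exists_dist_le_displacement [ProperSpace X] (hX : IsBusemannNPC X)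
    {Γ : Type*} [Group Γ] [Countable Γ] [MulAction Γ X] [IsIsometricSMul Γ X]
    (hfix : ¬ ∃ ξ : VisualBoundary X, ∀ γ : Γ, γ • ξ = ξ) (o : X) :
    ∃ (S : Finset Γ) (C : ℝ), 0 ≤ C ∧ ∀ x : X, dist o x ≤ C + C * ∑ γ ∈ S, dist x (γ • x) := by
  classical
  by_contra! hcon
  obtain ⟨e, he⟩ := exists_surjective_nat Γ
  choose x hx using fun n : ℕ => hcon ((Finset.range n).image e) n n.cast_nonneg
  have hs : ∀ n, 0 ≤ ∑ γ ∈ (Finset.range n).image e, dist (x n) (γ • x n) := fun n =>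
    Finset.sum_nonneg fun _ _ => dist_nonneg
  have hx1 : ∀ n : ℕ, (n : ℝ) < dist o (x n) := fun n =>
    lt_of_le_of_lt (le_add_of_nonneg_right (mul_nonneg n.cast_nonneg (hs n))) (hx n)
  have hxt : Tendsto (fun n => dist o (x n)) atTop atTop :=
    tendsto_atTop_mono (fun n => (hx1 n).le) tendsto_natCast_atTop_atTop
  refine hfix (hX.exists_fixed_of_sublinear o x hxt fun γ => ?_)
  obtain ⟨j, rfl⟩ := he γ
  refine squeeze_zero' (Eventually.of_forall fun n => by positivity) ?_
    tendsto_one_div_atTop_nhds_zero_nat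
  filter_upwards [eventually_gt_atTop j] with n hn
  have hn0 : (0 : ℝ) < n := by exact_mod_cast (Nat.zero_le j).trans_lt hn
  have h1 : dist (x n) (e j • x n) ≤ ∑ γ ∈ (Finset.range n).image e, dist (x n) (γ • x n) :=
    Finset.single_le_sum (f := fun γ => dist (x n) (γ • x n)) (fun _ _ => dist_nonneg)
      (Finset.mem_image_of_mem e (Finset.mem_range.2 hn))
  have h2 : (n : ℝ) * dist (x n) (e j • x n) ≤ dist o (x n) := by
    have := mul_le_mul_of_nonneg_left h1 hn0.le
    linarith [hx n]
  rw [div_le_div_iff₀ (hn0.trans (hx1 n)) hn0]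
  linarith

theorem VisualBoundary.t2Space [ProperSpace X] [Nonempty X] (hX : IsBusemannNPC X) :
    T2Space (VisualBoundary X) :=
  ((VisualBoundary.isHomeomorph_mk hX (Classical.arbitrary X)).homeomorph).t2Space

/-- A closed subset of a uniformly convex Busemann space that contains the midpoints of its points
is a Busemann space. -/
theorem IsUCBusemann.isBusemannNPC_subtype (hX : IsUCBusemann X) {K : Set X} (hK : IsClosed K)
    (hmid : ∀ x ∈ K, ∀ y ∈ K, hX.mid x y ∈ K) : IsBusemannNPC K where
  complete := by
    have := hX.npc.complete
    exact hK.completeSpace_coe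
  geodesic := by
    rintro ⟨x, hx⟩ ⟨y, hy⟩
    obtain ⟨c, hc, rfl, rfl⟩ := hX.npc.geodesic x y
    have hcont : ContinuousOn c (Icc 0 1) := by
      refine (LipschitzOnWith.of_dist_le_mul (K := ⟨dist (c 0) (c 1), dist_nonneg⟩)
        fun s hs t ht => ?_).continuousOn
      rw [hc s hs t ht, Real.dist_eq, mul_comm]
      rfl
    have hcl : IsClosed (Icc (0 : ℝ) 1 ∩ c ⁻¹' K) := hcont.preimage_isClosed_of_isClosed
      isClosed_Icc hK
    have hall : ∀ t ∈ Icc (0 : ℝ) 1, c t ∈ K := by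
      intro t ht
      by_contra htK
      -- the gap of the closed set `c ⁻¹' K` around `t` would contain the midpoint of its ends
      have hA : IsCompact (Icc (0 : ℝ) t ∩ (Icc (0 : ℝ) 1 ∩ c ⁻¹' K)) := isCompact_Icc.inter_right hcl
      have hB : IsCompact (Icc t 1 ∩ (Icc (0 : ℝ) 1 ∩ c ⁻¹' K)) := isCompact_Icc.inter_right hcl
      obtain ⟨a, ⟨ha, haK⟩, hamax⟩ := hA.exists_isGreatest
        ⟨0, ⟨le_rfl, ht.1⟩, left_mem_Icc.2 zero_le_one, hx⟩
      obtain ⟨b, ⟨hb, hbK⟩, hbmin⟩ := hB.exists_isLeast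
        ⟨1, ⟨ht.2, le_rfl⟩, right_mem_Icc.2 zero_le_one, hy⟩
      have hat : a < t := ha.2.lt_of_ne fun h => htK (h ▸ haK.2)
      have htb : t < b := hb.1.lt_of_ne fun h => htK (h ▸ hbK.2)
      have hm : (a + b) / 2 ∈ Icc (0 : ℝ) 1 ∩ c ⁻¹' K := by
        refine ⟨⟨by linarith [ha.1, hb.1, ht.1], by linarith [ha.2, hb.2, ht.2]⟩, ?_⟩
        rw [mem_preimage, hX.eq_mid (hc.isMetricMidpoint haK.1 hbK.1)]
        exact hmid _ haK.2 _ hbK.2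
      rcases le_total ((a + b) / 2) t with h | h
      · have := hamax ⟨⟨hm.1.1, h⟩, hm⟩
        linarith
      · have := hbmin ⟨⟨h, hm.1.2⟩, hm⟩
        linarith
    refine ⟨fun t => ⟨c (projIcc 0 1 zero_le_one t), hall _ (projIcc 0 1 zero_le_one t).2⟩,
      fun s hs t ht => ?_, ?_, ?_⟩
    · simp only [Subtype.dist_eq, projIcc_of_mem zero_le_one hs, projIcc_of_mem zero_le_one ht,
        projIcc_left, projIcc_right, hc s hs t ht]
    · simp [projIcc_left]
    · simp [projIcc_right]
  convex c c' hc hc' :=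
    hX.npc.convex (fun t => c t) (fun t => c' t) hc hc'

/-- A ray of a subspace, as a ray of the space. -/
def GeodesicRay.incl {K : Set X} (r : GeodesicRay K) : GeodesicRay X :=
  ⟨⟨fun t => r.1 t, continuous_subtype_val.comp r.1.continuous⟩, isometry_subtype_coe.comp r.2⟩

theorem GeodesicRay.continuous_incl {K : Set X} :
    Continuous (GeodesicRay.incl : GeodesicRay K → GeodesicRay X) := by
  refine Continuous.subtype_mk (f := fun r : GeodesicRay K => (GeodesicRay.incl r).1) ?_ _
  exact (ContinuousMap.continuous_postcomp ⟨_, continuous_subtype_val⟩).comp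
    continuous_subtype_val

/-- The map of visual boundaries induced by the inclusion of a subspace. -/
def VisualBoundary.incl {K : Set X} : VisualBoundary K → VisualBoundary X :=
  Quotient.map GeodesicRay.incl fun _ _ ⟨C, h⟩ => ⟨C, h⟩

theorem VisualBoundary.isClosedEmbedding_incl [ProperSpace X] (hX : IsBusemannNPC X) {K : Set X}
    (hK : IsClosed K) (hKX : IsBusemannNPC K) (o : K) :
    IsClosedEmbedding (VisualBoundary.incl : VisualBoundary K → VisualBoundary X) := by
  have : ProperSpace K := .of_isClosed hK
  set e := (VisualBoundary.isHomeomorph_mk hKX o).homeomorph with he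
  have hmk := VisualBoundary.isHomeomorph_mk hX (o : X)
  set J : {r : GeodesicRay K // r.1 0 = o} → {r : GeodesicRay X // r.1 0 = (o : X)} :=
    fun r => ⟨r.1.incl, congrArg Subtype.val r.2⟩ with hJ
  have hJc : Continuous J :=
    (GeodesicRay.continuous_incl.comp continuous_subtype_val).subtype_mk _
  have hcomp : VisualBoundary.incl = (fun r => VisualBoundary.mk r.1) ∘ J ∘ e.symm := by
    funext ξ
    obtain ⟨r, rfl⟩ := e.surjective ξ
    simp only [Function.comp_apply, e.symm_apply_apply]
    rfl
  have hincl : IsEmbedding (GeodesicRay.incl : GeodesicRay K → GeodesicRay X) := by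
    refine IsEmbedding.of_comp GeodesicRay.continuous_incl continuous_subtype_val ?_
    exact (ContinuousMap.isEmbedding_postcomp ⟨_, continuous_subtype_val⟩
      IsEmbedding.subtypeVal).comp IsEmbedding.subtypeVal
  have hJe : IsEmbedding J :=
    IsEmbedding.of_comp hJc continuous_subtype_val (hincl.comp IsEmbedding.subtypeVal)
  have hJr : range J = ⋂ t : ℝ≥0, {r | r.1.1 t ∈ K} := by
    ext r
    simp only [mem_iInter, mem_ofPred_eq]
    constructor
    · rintro ⟨r, rfl⟩ t
      exact (r.1.1 t).2
    · intro h
      refine ⟨⟨⟨⟨fun t => ⟨r.1.1 t, h t⟩, r.1.1.continuous.subtype_mk _⟩,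
        fun s t => r.1.2 s t⟩, Subtype.ext r.2⟩, rfl⟩
  have hJcl : IsClosedEmbedding J := by
    refine ⟨hJe, hJr ▸ isClosed_iInter fun t => hK.preimage ?_⟩
    fun_prop
  rw [hcomp]
  exact hmk.isClosedEmbedding.comp (hJcl.comp e.symm.isClosedEmbedding)

theorem GeodesicRay.continuous_translate {H : Type*} [Group H] [TopologicalSpace H]
    [MulAction H X] [IsIsometricSMul H X] [ContinuousSMul H X] :
    Continuous fun p : H × GeodesicRay X => GeodesicRay.translate p.1 p.2 := by
  refine Continuous.subtype_mk
    (f := fun p : H × GeodesicRay X => (GeodesicRay.translate p.1 p.2).1) ?_ _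
  refine ContinuousMap.continuous_of_continuous_uncurry _ ?_
  have h1 : Continuous fun q : (H × GeodesicRay X) × ℝ≥0 => q.1.2.1 q.2 := by fun_prop
  exact (continuous_fst.comp continuous_fst).smul h1

theorem VisualBoundary.continuous_smul [ProperSpace X] [Nonempty X] (hX : IsBusemannNPC X)
    {H : Type*} [Group H] [TopologicalSpace H] [MulAction H X] [IsIsometricSMul H X]
    [ContinuousSMul H X] : Continuous fun p : H × VisualBoundary X => p.1 • p.2 := by
  set e := (VisualBoundary.isHomeomorph_mk hX (Classical.arbitrary X)).homeomorph with he
  have h1 : Continuous fun p : H × VisualBoundary X =>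
      VisualBoundary.mk (GeodesicRay.translate p.1 (e.symm p.2).1) :=
    continuous_quotient_mk'.comp (GeodesicRay.continuous_translate.comp
      (continuous_fst.prodMk (continuous_subtype_val.comp (e.symm.continuous.comp continuous_snd))))
  convert h1 using 2 with p
  obtain ⟨r, hr⟩ := e.surjective p.2
  rw [← hr, e.symm_apply_apply]
  rfl

/-- A group acts on the boundary of a closed convex subset on which it acts by isometries. If the
action of `Γ` on the ambient space stays at bounded distance from the action through `π : Γ → H` on
the convex subset, then the boundary action of `H` extends that of `Γ`. -/
theorem IsUCBusemann.exists_boundary_action [ProperSpace X] (hX : IsUCBusemann X)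
    {Γ : Type*} [Group Γ] [MulAction Γ X] [IsIsometricSMul Γ X]
    {H : Type*} [Group H] [TopologicalSpace H]
    {K : Set X} (hK : IsClosed K) (hmid : ∀ x ∈ K, ∀ y ∈ K, hX.mid x y ∈ K)
    (hunb : ¬ Bornology.IsBounded K) [MulAction H K] [IsIsometricSMul H K] [ContinuousSMul H K]
    (π : Γ →* H) (hπ : ∀ γ : Γ, ∃ C : ℝ, ∀ x : K, dist (γ • (x : X)) (π γ • x : K) ≤ C) :
    ∃ L : Set (VisualBoundary X), L.Nonempty ∧ IsClosed L ∧ (∀ γ : Γ, ∀ ξ ∈ L, γ • ξ ∈ L) ∧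
      ∃ ρ : H →* Equiv.Perm L, Continuous (fun p : H × L => ρ p.1 p.2) ∧
        ∀ (γ : Γ) (ξ : L), ((ρ (π γ) ξ : L) : VisualBoundary X) = γ • (ξ : VisualBoundary X) := by
  have : ProperSpace K := .of_isClosed hK
  have hKX := hX.isBusemannNPC_subtype hK hmid
  have hne : K.Nonempty := by
    rw [nonempty_iff_ne_empty]
    rintro rfl
    exact hunb Bornology.isBounded_empty
  have : Nonempty K := hne.to_subtype
  set o : K := Classical.arbitrary K
  have hemb := VisualBoundary.isClosedEmbedding_incl hX.npc hK hKX o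
  have hΓ : ∀ (γ : Γ) (ξ : VisualBoundary K),
      (VisualBoundary.incl (π γ • ξ) : VisualBoundary X) = γ • VisualBoundary.incl ξ := by
    intro γ ξ
    induction ξ using Quotient.inductionOn with
    | h r =>
      obtain ⟨C, hC⟩ := hπ γ
      exact Quotient.sound ((asymptoticSetoid X).symm ⟨C, fun t => hC (r.1 t)⟩)
  set e : VisualBoundary K ≃ₜ range (VisualBoundary.incl : VisualBoundary K → VisualBoundary X) :=
    hemb.isEmbedding.toHomeomorph
  have hray : ∃ r : GeodesicRay K, r.1 0 = o := by
    have : ∀ n : ℕ, ∃ x : K, (n : ℝ) ≤ dist o x := by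
      by_contra! hcon
      obtain ⟨n, hn⟩ := hcon
      refine hunb (Metric.isBounded_iff_subset_closedBall (o : X) |>.2 ⟨n, fun x hx => ?_⟩)
      rw [Metric.mem_closedBall, dist_comm]
      exact (hn ⟨x, hx⟩).le
    choose x hx using this
    obtain ⟨r, -, h0, -⟩ := hKX.exists_limit_ray o x
      (tendsto_atTop_mono hx tendsto_natCast_atTop_atTop)
    exact ⟨r, h0⟩
  refine ⟨range VisualBoundary.incl, ⟨_, ⟨VisualBoundary.mk hray.choose, rfl⟩⟩, hemb.isClosed_range, ?_,
    (e.toEquiv.permCongrHom : Equiv.Perm _ →* _).comp (MulAction.toPermHom H (VisualBoundary K)),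
    ?_, ?_⟩
  · rintro γ _ ⟨ξ, rfl⟩
    exact ⟨π γ • ξ, hΓ γ ξ⟩
  · exact e.continuous.comp ((VisualBoundary.continuous_smul hKX).comp
      (continuous_fst.prodMk (e.symm.continuous.comp continuous_snd)))
  · intro γ ξ
    obtain ⟨η, rfl⟩ := e.surjective ξ
    change VisualBoundary.incl (π γ • (e.symm (e η))) = γ • VisualBoundary.incl η
    rw [e.symm_apply_apply, hΓ]

end Rays

/-! ### Fundamental domains of uniform lattices -/

section Lattices

open MeasureTheory Measure
open scoped Pointwise ENNReal

theorem IsCompactlyGeneratedGroup.sigmaCompactSpace {G : Type*} [Group G] [TopologicalSpace G]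
    [IsTopologicalGroup G] (hG : IsCompactlyGeneratedGroup G) : SigmaCompactSpace G := by
  obtain ⟨K, hK, hgen⟩ := hG
  set S : Set G := insert 1 (K ∪ K⁻¹) with hS
  have hSc : IsCompact S := (hK.union hK.inv).insert 1
  have hSinv : S⁻¹ = S := by
    ext x
    simp only [hS, Set.mem_inv, mem_insert_iff, mem_union, inv_inv, inv_eq_one]
    tauto
  have hpow : ∀ n : ℕ, IsCompact (S ^ n) := by
    intro n
    induction n with
    | zero => rw [pow_zero]; exact isCompact_singleton
    | succ n ih => rw [pow_succ]; exact ih.mul hSc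
  refine SigmaCompactSpace.of_countable (range fun n : ℕ => S ^ n) (countable_range _) ?_ ?_
  · rintro _ ⟨n, rfl⟩
    exact hpow n
  · rw [sUnion_range, eq_univ_iff_forall]
    intro g
    have hg : g ∈ Subgroup.closure K := hgen ▸ Subgroup.mem_top g
    rw [mem_iUnion]
    induction hg using Subgroup.closure_induction with
    | mem x hx => exact ⟨1, by rw [pow_one]; exact mem_insert_of_mem _ (Or.inl hx)⟩
    | one => exact ⟨0, by rw [pow_zero]; rfl⟩
    | mul x y _ _ hx hy =>
      obtain ⟨m, hm⟩ := hx
      obtain ⟨n, hn⟩ := hy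
      exact ⟨m + n, by rw [pow_add]; exact Set.mul_mem_mul hm hn⟩
    | inv x _ hx =>
      obtain ⟨n, hn⟩ := hx
      refine ⟨n, ?_⟩
      rw [← hSinv, inv_pow, Set.mem_inv, inv_inv]
      exact hn

variable {G : Type*} [Group G] [TopologicalSpace G] [IsTopologicalGroup G]

theorem IsUniformLattice.finite_mem [T2Space G] {Γ : Subgroup G} (hΓ : IsUniformLattice Γ)
    {K : Set G} (hK : IsCompact K) : {γ : Γ | (γ : G) ∈ K}.Finite := by
  have := hΓ.discrete
  have hcl : IsClosed (Γ : Set G) := Subgroup.isClosed_of_discrete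
  exact (hcl.isClosedEmbedding_subtypeVal.isCompact_preimage hK).finite_of_discrete

theorem IsUniformLattice.countable [T2Space G] [SigmaCompactSpace G] {Γ : Subgroup G}
    (hΓ : IsUniformLattice Γ) : Countable Γ := by
  rw [← countable_univ_iff]
  have : (univ : Set Γ) = ⋃ n, {γ : Γ | (γ : G) ∈ compactCovering G n} := by
    refine (eq_univ_of_forall fun γ => ?_).symm
    obtain ⟨n, hn⟩ := mem_iUnion.1 ((iUnion_compactCovering G).symm ▸ mem_univ (γ : G))
    exact mem_iUnion.2 ⟨n, hn⟩
  rw [this]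
  exact countable_iUnion fun n => (hΓ.finite_mem (isCompact_compactCovering G n)).countable

theorem IsUniformLattice.exists_isCompact_cover [LocallyCompactSpace G] {Γ : Subgroup G}
    (hΓ : IsUniformLattice Γ) : ∃ C : Set G, IsCompact C ∧ ∀ g : G, ∃ γ : Γ, (γ : G) * g ∈ C := by
  have := hΓ.cocompact
  obtain ⟨V, hV, hV1⟩ := exists_compact_mem_nhds (1 : G)
  have hopen : ∀ g : G, IsOpen ((QuotientGroup.mk : G → G ⧸ Γ) '' (g • interior V)) := fun g =>
    QuotientGroup.isOpenMap_coe _ (isOpen_interior.smul g)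
  obtain ⟨t, ht⟩ := isCompact_univ.elim_finite_subcover _ hopen (fun q _ => by
    obtain ⟨g, rfl⟩ := QuotientGroup.mk_surjective q
    exact mem_iUnion.2 ⟨g, mem_image_of_mem _
      ⟨1, mem_interior_iff_mem_nhds.2 hV1, by simp⟩⟩)
  refine ⟨(⋃ g ∈ t, g • V)⁻¹, (t.isCompact_biUnion fun g _ => hV.smul g).inv, fun g => ?_⟩
  have := ht (mem_univ (QuotientGroup.mk g⁻¹ : G ⧸ Γ))
  simp only [mem_iUnion] at this
  obtain ⟨h, hh, x, hx, hxg⟩ := this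
  rw [QuotientGroup.eq] at hxg
  refine ⟨⟨_, hxg⟩, ?_⟩
  simp only [inv_mul_cancel_right, Set.mem_inv, mem_iUnion, inv_inv]
  exact ⟨h, hh, by simpa using Set.smul_set_mono interior_subset hx⟩

/-- A Borel strict fundamental domain, contained in a compact set, for the action of a subgroup by
left translations. The last field records the discreteness of the subgroup. -/
structure IsLatticeDomain [MeasurableSpace G] (Γ : Subgroup G) (F : Set G) : Prop where
  measurableSet : MeasurableSet F
  existsUnique : ∀ g : G, ∃! γ : Γ, γ • g ∈ F
  subset_compact : ∃ C : Set G, IsCompact C ∧ F ⊆ C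
  finite_mem : ∀ K : Set G, IsCompact K → {γ : Γ | (γ : G) ∈ K}.Finite

theorem IsUniformLattice.exists_isLatticeDomain [T2Space G] [LocallyCompactSpace G]
    [MeasurableSpace G] [BorelSpace G] {Γ : Subgroup G} (hΓ : IsUniformLattice Γ) :
    ∃ F : Set G, IsLatticeDomain Γ F := by
  obtain ⟨C, hC, hcov⟩ := hΓ.exists_isCompact_cover
  -- an open neighbourhood `U` of `1` whose right translates meet each orbit at most once
  obtain ⟨U, hUo, hU1, hUc, hU⟩ : ∃ U : Set G, IsOpen U ∧ (1 : G) ∈ U ∧ IsCompact (closure U) ∧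
      ∀ x ∈ U, ∀ y ∈ U, x * y⁻¹ ∈ Γ → x * y⁻¹ = 1 := by
    have := hΓ.discrete
    obtain ⟨V, hV, hVΓ⟩ : ∃ V ∈ 𝓝 (1 : G), ∀ x ∈ V, x ∈ Γ → x = 1 := by
      have h1 : ({1} : Set Γ) ∈ 𝓝 (1 : Γ) := by simp [nhds_discrete]
      rw [nhds_subtype_eq_comap] at h1
      obtain ⟨V, hV, hVs⟩ := h1
      exact ⟨V, hV, fun x hx hxΓ => congrArg Subtype.val (@hVs ⟨x, hxΓ⟩ hx)⟩
    have hcont : Tendsto (fun p : G × G => p.1 * p.2⁻¹) (𝓝 (1, 1)) (𝓝 1) := by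
      have : Continuous fun p : G × G => p.1 * p.2⁻¹ := by fun_prop
      simpa using this.tendsto (1, 1)
    have h2 := hcont hV
    rw [mem_map, nhds_prod_eq, mem_prod_same_iff] at h2
    obtain ⟨W, hW, hWs⟩ := h2
    obtain ⟨D, hD, hD1⟩ := exists_compact_mem_nhds (1 : G)
    refine ⟨interior (W ∩ D), isOpen_interior,
      mem_interior_iff_mem_nhds.2 (inter_mem hW hD1), ?_, ?_⟩
    · exact hD.of_isClosed_subset isClosed_closure
        (closure_minimal (interior_subset.trans inter_subset_right) hD.isClosed)
    · intro x hx y hy hxy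
      exact hVΓ _ (@hWs (x, y) ⟨(interior_subset hx).1, (interior_subset hy).1⟩) hxy
  obtain ⟨t, -, ht⟩ := hC.elim_nhds_subcover (fun g => MulOpposite.op g • U) fun g _ =>
    (hUo.smul (MulOpposite.op g)).mem_nhds ⟨1, hU1, by simp⟩
  set e := t.equivFin
  set A : Fin t.card → Set G := fun j => MulOpposite.op ((e.symm j : G)) • U with hA
  have hAo : ∀ j, IsOpen (A j) := fun j => hUo.smul _
  have hAuniq : ∀ j (γ γ' : Γ) (g : G), γ • g ∈ A j → γ' • g ∈ A j → γ = γ' := by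
    rintro j γ γ' g ⟨x, hx, hxg⟩ ⟨y, hy, hyg⟩
    simp only [MulOpposite.smul_eq_mul_unop, MulOpposite.unop_op, Subgroup.smul_def,
      smul_eq_mul] at hxg hyg
    have hxy : x * y⁻¹ = (γ * γ'⁻¹ : Γ) := by
      have e1 : x = γ * g * (e.symm j : G)⁻¹ := by rw [← hxg, mul_inv_cancel_right]
      have e2 : y = γ' * g * (e.symm j : G)⁻¹ := by rw [← hyg, mul_inv_cancel_right]
      rw [e1, e2]
      push_cast
      group
    have := hU x hx y hy (hxy ▸ (γ * γ'⁻¹ : Γ).2)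
    rw [hxy] at this
    exact mul_inv_eq_one.1 (Subtype.ext this)
  have hAcov : ∀ g : G, ∃ j, ∃ γ : Γ, γ • g ∈ A j := by
    intro g
    obtain ⟨γ, hγ⟩ := hcov g
    have := ht hγ
    simp only [mem_iUnion] at this
    obtain ⟨h, hh, hx⟩ := this
    exact ⟨e ⟨h, hh⟩, γ, by simpa [hA, Subgroup.smul_def] using hx⟩
  -- each orbit is represented in the first translate that it meets
  refine ⟨⋃ j, A j \ ⋃ l, ⋃ (_ : l < j), ⋃ γ : Γ, (fun g => γ • g) ⁻¹' A l, ?_, ?_, ?_, ?_⟩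
  · refine MeasurableSet.iUnion fun j => (hAo j).measurableSet.diff (IsOpen.measurableSet ?_)
    exact isOpen_iUnion fun l => isOpen_iUnion fun _ => isOpen_iUnion fun γ =>
      (hAo l).preimage (continuous_const_smul γ)
  · intro g
    obtain ⟨j, ⟨γ, hγ⟩, hmin⟩ : ∃ j, (∃ γ : Γ, γ • g ∈ A j) ∧
        ∀ l < j, ¬ ∃ γ : Γ, γ • g ∈ A l := by
      have hne : {j | ∃ γ : Γ, γ • g ∈ A j}.Nonempty := hAcov g
      exact ⟨WellFounded.min wellFounded_lt _ hne, WellFounded.min_mem wellFounded_lt _ hne,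
        fun l hl h => WellFounded.not_lt_min wellFounded_lt
          (s := {j | ∃ γ : Γ, γ • g ∈ A j}) h hl⟩
    refine ⟨γ, mem_iUnion.2 ⟨j, hγ, ?_⟩, ?_⟩
    · simp only [mem_iUnion, mem_preimage, not_exists]
      intro l hl γ' h
      exact hmin l hl ⟨γ' * γ, by rwa [mul_smul]⟩
    · intro γ' h'
      obtain ⟨j', h1, h2⟩ := mem_iUnion.1 h'
      simp only [mem_iUnion, mem_preimage, not_exists] at h2
      rcases lt_trichotomy j j' with h | rfl | h
      · exact absurd (by rwa [← mul_smul, inv_mul_cancel_right]) (h2 j h (γ * γ'⁻¹))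
      · exact hAuniq j _ _ g h1 hγ
      · exact absurd ⟨γ', h1⟩ (hmin j' h)
  · refine ⟨⋃ j, MulOpposite.op ((e.symm j : G)) • closure U,
      isCompact_iUnion fun j => hUc.smul _, iUnion_mono fun j => ?_⟩
    exact sdiff_subset.trans (Set.smul_set_mono subset_closure)
  · exact fun K hK => hΓ.finite_mem hK

namespace IsLatticeDomain

variable [MeasurableSpace G] [BorelSpace G] {Γ : Subgroup G} {F : Set G}

theorem isFundamentalDomain (hF : IsLatticeDomain Γ F) (μ : Measure G) :
    IsFundamentalDomain Γ F μ :=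
  IsFundamentalDomain.mk' hF.measurableSet.nullMeasurableSet hF.existsUnique

theorem measure_lt_top (hF : IsLatticeDomain Γ F) (μ : Measure G)
    [IsFiniteMeasureOnCompacts μ] : μ F < ∞ := by
  obtain ⟨C, hC, hFC⟩ := hF.subset_compact
  exact (measure_mono hFC).trans_lt hC.measure_lt_top

theorem measure_ne_zero [Countable Γ] (hF : IsLatticeDomain Γ F) (μ : Measure G)
    [IsHaarMeasure μ] : μ F ≠ 0 :=
  (hF.isFundamentalDomain μ).measure_ne_zero (NeZero.ne μ)

theorem mul_right (hF : IsLatticeDomain Γ F) (h : G) : IsLatticeDomain Γ ((· * h) ⁻¹' F) where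
  measurableSet := (measurable_mul_const h) hF.measurableSet
  existsUnique g := by
    simpa only [mem_preimage, Subgroup.smul_def, smul_eq_mul, mul_assoc] using
      hF.existsUnique (g * h)
  subset_compact := by
    obtain ⟨C, hC, hFC⟩ := hF.subset_compact
    exact ⟨_, (Homeomorph.mulRight h).isCompact_preimage.2 hC, preimage_mono hFC⟩
  finite_mem := hF.finite_mem

/-- A group with a uniform lattice is unimodular. -/
theorem isMulRightInvariant [LocallyCompactSpace G] [Countable Γ] (hF : IsLatticeDomain Γ F)
    (μ : Measure G) [IsHaarMeasure μ] [Regular μ] : IsMulRightInvariant μ := by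
  refine ⟨fun h => ?_⟩
  have hreg : Regular (μ.map (· * h)) := Regular.map (Homeomorph.mulRight h)
  have key := isMulLeftInvariant_eq_smul_of_regular (μ.map (· * h)) μ
  set c := haarScalarFactor (μ.map (· * h)) μ
  have h1 : μ.map (· * h) F = μ F := by
    rw [map_apply (measurable_mul_const h) hF.measurableSet]
    exact ((hF.mul_right h).isFundamentalDomain μ).measure_eq (hF.isFundamentalDomain μ)
  have h2 : (c : ℝ≥0∞) * μ F = 1 * μ F := by
    rw [one_mul]
    conv_rhs => rw [← h1, key]
    rfl
  have h3 : (c : ℝ≥0∞) = 1 :=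
    (ENNReal.mul_left_inj (hF.measure_ne_zero μ) (hF.measure_lt_top μ).ne).1 h2
  rw [key, ENNReal.coe_eq_one.1 h3, one_smul]

variable [Countable Γ] {μ : Measure G} [IsMulLeftInvariant μ]

/-- Right translations preserve the integral of a left `Γ`-invariant function over a fundamental
domain. -/
theorem setLIntegral_mul_right [IsMulRightInvariant μ] (hF : IsLatticeDomain Γ F) {f : G → ℝ≥0∞}
    (hf : ∀ (γ : Γ) (g : G), f (γ * g) = f g) (h : G) :
    ∫⁻ g in F, f (g * h) ∂μ = ∫⁻ g in F, f g ∂μ := by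
  have h1 : ∫⁻ g in (· * h) ⁻¹' F, f (g * h) ∂μ = ∫⁻ g in F, f g ∂μ :=
    (measurePreserving_mul_right μ h).setLIntegral_comp_preimage_emb
      (Homeomorph.mulRight h).measurableEmbedding f F
  rw [← h1]
  refine (hF.isFundamentalDomain μ).setLIntegral_eq ((hF.mul_right h).isFundamentalDomain μ) _ ?_
  intro γ g
  rw [Subgroup.smul_def, smul_eq_mul, mul_assoc, hf]

/-- Integrals of `Γ`-invariant functions over a compact set are controlled by the integral over a
fundamental domain. -/
theorem exists_setLIntegral_le (hF : IsLatticeDomain Γ F) {K : Set G} (hK : IsCompact K) :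
    ∃ N : ℕ, ∀ f : G → ℝ≥0∞, (∀ (γ : Γ) (g : G), f (γ * g) = f g) →
      ∫⁻ g in K, f g ∂μ ≤ N * ∫⁻ g in F, f g ∂μ := by
  classical
  obtain ⟨C, hC, hFC⟩ := hF.subset_compact
  set T := (hF.finite_mem (K * C⁻¹) (hK.mul hC.inv)).toFinset with hT
  refine ⟨T.card, fun f hf => ?_⟩
  have hcov : K ⊆ ⋃ γ ∈ T, γ • F := by
    intro g hg
    obtain ⟨γ, hγ, -⟩ := hF.existsUnique g
    refine mem_biUnion (x := γ⁻¹) ?_ ⟨γ • g, hγ, by simp⟩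
    rw [hT, Finset.mem_coe, Set.Finite.mem_toFinset]
    refine ⟨g, hg, (γ • g)⁻¹, Set.inv_mem_inv.2 (hFC hγ), ?_⟩
    simp [Subgroup.smul_def]
  calc ∫⁻ g in K, f g ∂μ ≤ ∫⁻ g in ⋃ γ ∈ T, γ • F, f g ∂μ := lintegral_mono_set hcov
    _ ≤ ∑ γ ∈ T, ∫⁻ g in γ • F, f g ∂μ := by
        have : ∀ S : Finset Γ, ∫⁻ g in ⋃ γ ∈ S, γ • F, f g ∂μ
            ≤ ∑ γ ∈ S, ∫⁻ g in γ • F, f g ∂μ := by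
          intro S
          induction S using Finset.induction_on with
          | empty => simp
          | insert a S ha ih =>
            rw [Finset.set_biUnion_insert, Finset.sum_insert ha]
            exact (lintegral_union_le f _ _).trans (add_le_add le_rfl ih)
        exact this T
    _ = ∑ γ ∈ T, ∫⁻ g in F, f g ∂μ := by
        refine Finset.sum_congr rfl fun γ _ => ?_
        exact ((hF.isFundamentalDomain μ).smul γ).setLIntegral_eq (hF.isFundamentalDomain μ) f hf
    _ = T.card * ∫⁻ g in F, f g ∂μ := by rw [Finset.sum_const, nsmul_eq_mul]

/-- A `Γ`-invariant property that holds almost everywhere on a fundamental domain holds almost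
everywhere. -/
theorem ae_of_ae_restrict (hF : IsLatticeDomain Γ F) {p : G → Prop}
    (hp : ∀ (γ : Γ) (g : G), p (γ * g) ↔ p g) (h : ∀ᵐ g ∂μ.restrict F, p g) :
    ∀ᵐ g ∂μ, p g := by
  rw [ae_restrict_iff' hF.measurableSet] at h
  have : ∀ᵐ g ∂μ, ∀ γ : Γ, γ • g ∈ F → p (γ • g) := by
    rw [ae_all_iff]
    intro γ
    exact (measurePreserving_smul γ μ).quasiMeasurePreserving.ae h
  filter_upwards [this] with g hg
  obtain ⟨γ, hγ, -⟩ := hF.existsUnique g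
  exact (hp γ g).1 (hg γ hγ)

end IsLatticeDomain

end Lattices

/-! ### Smoothing on unimodular groups, ergodicity and continuous representatives -/

section Smoothing

open MeasureTheory Measure
open scoped Pointwise ENNReal

variable {G : Type*} [Group G] [TopologicalSpace G] [IsTopologicalGroup G] [T2Space G]
  [LocallyCompactSpace G] [SigmaCompactSpace G] [MeasurableSpace G] [BorelSpace G]
  {μ : Measure G} [IsHaarMeasure μ] [Regular μ]

/-- A bounded measurable function is determined up to null sets, and with its order, by its
integrals against continuous functions with compact support. -/
theorem ae_nonpos_of_integral_mul_nonpos {h : G → ℝ} (hm : Measurable h) {M : ℝ}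
    (hM : ∀ g, |h g| ≤ M) (H : ∀ ζ : G → ℝ, Continuous ζ → HasCompactSupport ζ → 0 ≤ ζ →
      ∫ g, ζ g * h g ∂μ ≤ 0) : ∀ᵐ g ∂μ, h g ≤ 0 := by
  have hM0 : 0 ≤ M := (abs_nonneg _).trans (hM 1)
  have key : ∀ n, μ (compactCovering G n ∩ {g | 0 < h g}) = 0 := by
    intro n
    set P := compactCovering G n ∩ {g | 0 < h g} with hP
    have hK := isCompact_compactCovering G n
    have hPm : MeasurableSet P := hK.measurableSet.inter (measurableSet_lt measurable_const hm)
    have hPf : μ P < ∞ := (measure_mono inter_subset_left).trans_lt hK.measure_lt_top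
    have hPi : Integrable (P.indicator (1 : G → ℝ)) μ :=
      (integrable_indicator_iff hPm).2 (integrableOn_const hPf.ne)
    have hle : ∫ g, P.indicator (1 : G → ℝ) g * h g ∂μ ≤ 0 := by
      refine le_of_forall_pos_le_add fun ε hε => ?_
      obtain ⟨ζ, hζc, hζ, hζcont, hζi⟩ := hPi.exists_hasCompactSupport_integral_sub_le
        (ε := ε / (M + 1)) (by positivity)
      set ζ' : G → ℝ := fun g => max (ζ g) 0 with hζ'
      have hζ'c : HasCompactSupport ζ' := hζc.comp_left (g := fun x => max x 0) (by simp)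
      have hζ'cont : Continuous ζ' := hζcont.max continuous_const
      have hζ'i : Integrable ζ' μ := hζ'cont.integrable_of_hasCompactSupport hζ'c
      have h1 := H ζ' hζ'cont hζ'c fun g => le_max_right _ _
      have hb : ∀ {q : G → ℝ}, Integrable q μ → Integrable (fun g => q g * h g) μ := fun hq =>
        hq.mul_bdd (c := M) hm.aestronglyMeasurable (Eventually.of_forall hM)
      have h2 : ∫ g, P.indicator (1 : G → ℝ) g * h g ∂μ - ∫ g, ζ' g * h g ∂μ
          ≤ ∫ g, M * ‖(P.indicator (1 : G → ℝ) - ζ) g‖ ∂μ := by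
        rw [← integral_sub (hb hPi) (hb hζ'i)]
        refine integral_mono ((hb hPi).sub (hb hζ'i)) ((hPi.sub hζi).norm.const_mul M)
          fun g => ?_
        simp only [Pi.sub_apply, Real.norm_eq_abs]
        have e1 : |P.indicator (1 : G → ℝ) g - ζ' g| ≤ |P.indicator (1 : G → ℝ) g - ζ g| := by
          have : P.indicator (1 : G → ℝ) g = max (P.indicator (1 : G → ℝ) g) 0 :=
            (max_eq_left (indicator_nonneg (fun _ _ => zero_le_one) g)).symm
          rw [this, hζ']
          exact (abs_max_sub_max_le_abs _ _ _).trans_eq (by rw [← this])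
        calc P.indicator (1 : G → ℝ) g * h g - ζ' g * h g
            = (P.indicator (1 : G → ℝ) g - ζ' g) * h g := by ring
          _ ≤ |(P.indicator (1 : G → ℝ) g - ζ' g) * h g| := le_abs_self _
          _ = |P.indicator (1 : G → ℝ) g - ζ' g| * |h g| := abs_mul _ _
          _ ≤ |P.indicator (1 : G → ℝ) g - ζ g| * M :=
            mul_le_mul e1 (hM g) (abs_nonneg _) (abs_nonneg _)
          _ = _ := mul_comm _ _
      rw [integral_const_mul] at h2
      have h3 : M * ∫ g, ‖(P.indicator (1 : G → ℝ) - ζ) g‖ ∂μ ≤ M * (ε / (M + 1)) :=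
        mul_le_mul_of_nonneg_left hζ hM0
      have h4 : M * (ε / (M + 1)) ≤ ε := by
        rw [mul_div_assoc', div_le_iff₀ (by positivity)]
        nlinarith
      linarith
    have h5 : ∫ g in P, h g ∂μ ≤ 0 := by
      rw [← integral_indicator hPm]
      convert hle using 2 with g
      ext g
      by_cases hg : g ∈ P <;> simp [hg]
    by_contra hne
    have hpos : 0 < ∫ g in P, h g ∂μ := by
      rw [setIntegral_pos_iff_support_of_nonneg_ae]
      · have : Function.support h ∩ P = P := inter_eq_right.2 fun g hg => hg.2.ne'
        rw [this]
        exact pos_iff_ne_zero.2 hne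
      · exact (ae_restrict_iff' hPm).2 (Eventually.of_forall fun g hg => hg.2.le)
      · exact Measure.integrableOn_of_bounded hPf.ne hm.aestronglyMeasurable
          (Eventually.of_forall hM)
    linarith
  have : μ {g | ¬ h g ≤ 0} = 0 := by
    have e : {g | ¬ h g ≤ 0} = ⋃ n, compactCovering G n ∩ {g | 0 < h g} := by
      rw [← iUnion_inter, iUnion_compactCovering, univ_inter]
      ext g
      simp
    rw [e, measure_iUnion_null_iff]
    exact key
  exact this

theorem ae_eq_of_integral_mul_eq {f h : G → ℝ} (hf : Measurable f) (hh : Measurable h) {M : ℝ}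
    (hfM : ∀ g, |f g| ≤ M) (hhM : ∀ g, |h g| ≤ M)
    (H : ∀ ζ : G → ℝ, Continuous ζ → HasCompactSupport ζ →
      ∫ g, ζ g * f g ∂μ = ∫ g, ζ g * h g ∂μ) : f =ᵐ[μ] h := by
  have hb : ∀ {q k : G → ℝ}, Integrable q μ → Measurable k → (∀ g, |k g| ≤ M) →
      Integrable (fun g => q g * k g) μ := fun hq hk hkM =>
    hq.mul_bdd (c := M) hk.aestronglyMeasurable (Eventually.of_forall hkM)
  have key : ∀ {f h : G → ℝ}, Measurable f → Measurable h → (∀ g, |f g| ≤ M) →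
      (∀ g, |h g| ≤ M) → (∀ ζ : G → ℝ, Continuous ζ → HasCompactSupport ζ →
      ∫ g, ζ g * f g ∂μ = ∫ g, ζ g * h g ∂μ) → ∀ᵐ g ∂μ, f g - h g ≤ 0 := by
    intro f h hf hh hfM hhM H
    refine ae_nonpos_of_integral_mul_nonpos (M := 2 * M) (hf.sub hh) (fun g => ?_)
      fun ζ hζ hζc _ => ?_
    · exact (abs_sub _ _).trans (by linarith [hfM g, hhM g])
    · have hi := hζ.integrable_of_hasCompactSupport hζc (μ := μ)
      simp only [mul_sub]
      rw [integral_sub (hb hi hf hfM) (hb hi hh hhM), H ζ hζ hζc, sub_self]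
  filter_upwards [key hf hh hfM hhM H, key hh hf hhM hfM fun ζ h1 h2 => (H ζ h1 h2).symm]
    with g h1 h2
  linarith

/-- Right convolution of a bounded nonnegative function with a continuous function `η`. -/
noncomputable def rightSmoothing (μ : Measure G) (f η : G → ℝ) (g : G) : ℝ :=
  ∫ u, η (u⁻¹ * g) * f u ∂μ

section

variable {f : G → ℝ} (hf : Measurable f) (hf0 : 0 ≤ f) {M : ℝ} (hfM : ∀ g, f g ≤ M)
include hf hf0 hfM

theorem isFiniteMeasureOnCompacts_withDensity_of_le :
    IsFiniteMeasureOnCompacts (μ.withDensity fun g => ENNReal.ofReal (f g)) := by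
  refine ⟨fun K hK => ?_⟩
  rw [withDensity_apply _ hK.measurableSet]
  calc ∫⁻ g in K, ENNReal.ofReal (f g) ∂μ ≤ ∫⁻ _ in K, ENNReal.ofReal M ∂μ :=
        lintegral_mono fun g => ENNReal.ofReal_le_ofReal (hfM g)
    _ = ENNReal.ofReal M * μ K := by rw [setLIntegral_const]
    _ < ∞ := ENNReal.mul_lt_top ENNReal.ofReal_lt_top hK.measure_lt_top

theorem integral_withDensity_ofReal (q : G → ℝ) :
    ∫ g, q g ∂(μ.withDensity fun g => ENNReal.ofReal (f g)) = ∫ g, q g * f g ∂μ := by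
  rw [integral_withDensity_eq_integral_toReal_smul hf.ennreal_ofReal
    (Eventually.of_forall fun _ => ENNReal.ofReal_lt_top)]
  refine integral_congr_ae (Eventually.of_forall fun g => ?_)
  simp only [ENNReal.toReal_ofReal (hf0 g), smul_eq_mul, mul_comm]

theorem continuous_rightSmoothing {η : G → ℝ} (hη : Continuous η) (hηc : HasCompactSupport η) :
    Continuous (rightSmoothing μ f η) := by
  have := isFiniteMeasureOnCompacts_withDensity_of_le (μ := μ) hf hf0 hfM
  have h := continuous_integral_apply_inv_mul
    (μ := μ.withDensity fun g => ENNReal.ofReal (f g)) hη hηc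
  convert h using 2 with g
  exact (integral_withDensity_ofReal hf hf0 hfM fun u => η (u⁻¹ * g)).symm

theorem continuous_integral_mul_right_mul {ζ : G → ℝ} (hζ : Continuous ζ)
    (hζc : HasCompactSupport ζ) : Continuous fun g => ∫ u, ζ (u * g) * f u ∂μ := by
  set ν := μ.withDensity fun g => ENNReal.ofReal (f g) with hν
  have hνf := isFiniteMeasureOnCompacts_withDensity_of_le (μ := μ) hf hf0 hfM
  have : IsFiniteMeasureOnCompacts (ν.map (·⁻¹)) := ⟨fun K hK => by
    rw [map_apply measurable_inv hK.measurableSet]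
    exact ((Homeomorph.inv G).isCompact_preimage.2 hK).measure_lt_top (μ := ν)⟩
  have h := continuous_integral_apply_inv_mul (μ := ν.map (·⁻¹)) hζ hζc
  convert h using 2 with g
  have e := (Homeomorph.inv G).measurableEmbedding.integral_map (μ := ν) fun y => ζ (y⁻¹ * g)
  simp only [Homeomorph.coe_inv, inv_inv] at e
  rw [← integral_withDensity_ofReal hf hf0 hfM]
  exact e.symm

/-- The smoothing, tested against a continuous function. The proof uses Fubini's theorem for
continuous functions with compact support only, so that the group need not be second countable. -/
theorem integral_mul_rightSmoothing {η ζ : G → ℝ} (hη : Continuous η) (hηc : HasCompactSupport η)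
    (hζ : Continuous ζ) (hζc : HasCompactSupport ζ) :
    ∫ g, ζ g * rightSmoothing μ f η g ∂μ = ∫ g, η g * ∫ u, ζ (u * g) * f u ∂μ ∂μ := by
  set ν := μ.withDensity fun g => ENNReal.ofReal (f g) with hν
  have hνf := isFiniteMeasureOnCompacts_withDensity_of_le (μ := μ) hf hf0 hfM
  have e : ∀ q : G → ℝ, ∫ u, q u * f u ∂μ = ∫ u, q u ∂ν := fun q =>
    (integral_withDensity_ofReal hf hf0 hfM q).symm
  simp only [rightSmoothing, e]
  calc ∫ g, ζ g * ∫ u, η (u⁻¹ * g) ∂ν ∂μ = ∫ g, ∫ u, ζ g * η (u⁻¹ * g) ∂ν ∂μ := by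
        simp_rw [integral_const_mul]
    _ = ∫ u, ∫ g, ζ g * η (u⁻¹ * g) ∂μ ∂ν := by
        apply integral_integral_swap_of_hasCompactSupport
        · exact (hζ.comp continuous_fst).mul (hη.comp (continuous_snd.inv.mul continuous_fst))
        · refine HasCompactSupport.intro (K := tsupport ζ ×ˢ (tsupport ζ * (tsupport η)⁻¹))
            (hζc.isCompact.prod (hζc.isCompact.mul hηc.isCompact.inv)) ?_
          rintro ⟨g, u⟩ hgu
          by_cases hg : g ∈ tsupport ζ
          · have : u⁻¹ * g ∉ tsupport η := fun h =>
              hgu ⟨hg, g, hg, (u⁻¹ * g)⁻¹, Set.inv_mem_inv.2 h, by simp⟩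
            simp [image_eq_zero_of_notMem_tsupport this]
          · simp [image_eq_zero_of_notMem_tsupport hg]
    _ = ∫ u, ∫ g, ζ (u * g) * η g ∂μ ∂ν := by
        congr with u
        rw [← integral_mul_left_eq_self _ u]
        simp
    _ = ∫ g, ∫ u, ζ (u * g) * η g ∂ν ∂μ := by
        symm
        apply integral_integral_swap_of_hasCompactSupport
        · exact (hζ.comp (continuous_snd.mul continuous_fst)).mul (hη.comp continuous_fst)
        · refine HasCompactSupport.intro (K := tsupport η ×ˢ (tsupport ζ * (tsupport η)⁻¹))
            (hηc.isCompact.prod (hζc.isCompact.mul hηc.isCompact.inv)) ?_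
          rintro ⟨g, u⟩ hgu
          by_cases hg : g ∈ tsupport η
          · have : u * g ∉ tsupport ζ := fun h =>
              hgu ⟨hg, u * g, h, g⁻¹, Set.inv_mem_inv.2 hg, by simp⟩
            simp [image_eq_zero_of_notMem_tsupport this]
          · simp [image_eq_zero_of_notMem_tsupport hg]
    _ = ∫ g, η g * ∫ u, ζ (u * g) ∂ν ∂μ := by
        simp_rw [integral_mul_const, mul_comm]

theorem abs_rightSmoothing_le {η : G → ℝ} (hη : Continuous η) (hηc : HasCompactSupport η)
    (g : G) : |rightSmoothing μ f η g| ≤ M * ∫ u, |η u⁻¹| ∂μ := by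
  have hi : Integrable (fun u => η (u⁻¹ * g)) μ :=
    (by fun_prop : Continuous fun u : G => η (u⁻¹ * g)).integrable_of_hasCompactSupport
      (hηc.comp_homeomorph ((Homeomorph.inv G).trans (Homeomorph.mulRight g)))
  calc |rightSmoothing μ f η g| ≤ ∫ u, |η (u⁻¹ * g) * f u| ∂μ := by
        simpa only [Real.norm_eq_abs, rightSmoothing] using
          norm_integral_le_integral_norm (μ := μ) fun u => η (u⁻¹ * g) * f u
    _ ≤ ∫ u, M * |η (u⁻¹ * g)| ∂μ := by
        refine integral_mono_of_nonneg (Eventually.of_forall fun u => abs_nonneg _)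
          (hi.abs.const_mul M) (Eventually.of_forall fun u => ?_)
        simp only [abs_mul, abs_of_nonneg (hf0 u)]
        rw [mul_comm M]
        exact mul_le_mul_of_nonneg_left (hfM u) (abs_nonneg _)
    _ = M * ∫ u, |η u⁻¹| ∂μ := by
        rw [integral_const_mul, ← integral_mul_left_eq_self (fun u => |η (u⁻¹ * g)|) g]
        simp

/-- Ergodicity: a function that is invariant under the left translations of `Γ` and the right
translations of a normal subgroup `A` is constant almost everywhere if `Γ * A` is dense. -/
theorem ae_eq_const_of_invariant [IsMulRightInvariant μ] (Γ A : Subgroup G) [A.Normal]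
    (hdense : Dense {g : G | ∃ γ ∈ Γ, ∃ a ∈ A, g = γ * a})
    (hΓ : ∀ γ ∈ Γ, ∀ g, f (γ * g) = f g) (hA : ∀ a ∈ A, ∀ᵐ g ∂μ, f (g * a) = f g) :
    ∃ c : ℝ, ∀ᵐ g ∂μ, f g = c := by
  have hM0 : 0 ≤ M := (hf0 1).trans (hfM 1)
  have hfabs : ∀ g, |f g| ≤ M := fun g => (abs_of_nonneg (hf0 g)).trans_le (hfM g)
  have hrA : ∀ a ∈ A, ∀ q : G → ℝ, ∫ u, q (u * a) * f u ∂μ = ∫ u, q u * f u ∂μ := by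
    intro a ha q
    rw [← integral_mul_right_eq_self (fun u => q u * f u) a]
    refine integral_congr_ae ((hA a ha).mono fun u hu => ?_)
    simp only [hu]
  -- a smoothing of `f` is a continuous function, which inherits both invariances, the right one because
  -- `A` is normal; it is constant by density
  have hconst : ∀ η : G → ℝ, Continuous η → HasCompactSupport η → ∀ g,
      rightSmoothing μ f η g = rightSmoothing μ f η 1 := by
    intro η hη hηc
    have hc := continuous_rightSmoothing (μ := μ) hf hf0 hfM hη hηc
    have hHΓ : ∀ γ ∈ Γ, ∀ g, rightSmoothing μ f η (γ * g) = rightSmoothing μ f η g := by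
      intro γ hγ g
      rw [rightSmoothing, ← integral_mul_left_eq_self _ γ]
      simp only [mul_inv_rev, mul_assoc, inv_mul_cancel_left, hΓ γ hγ]
      rfl
    have hHA : ∀ a ∈ A, ∀ g, rightSmoothing μ f η (g * a) = rightSmoothing μ f η g := by
      intro a ha
      have hca : Continuous fun g => rightSmoothing μ f η (g * a) :=
        hc.comp (continuous_mul_const a)
      refine congrFun (hca.ae_eq_iff_eq (μ := μ) hc |>.1 ?_)
      refine ae_eq_of_integral_mul_eq (M := M * ∫ u, |η u⁻¹| ∂μ) hca.measurable hc.measurable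
        (fun g => abs_rightSmoothing_le hf hf0 hfM hη hηc _)
        (fun g => abs_rightSmoothing_le hf hf0 hfM hη hηc _) fun ζ hζ hζc => ?_
      have hζa : HasCompactSupport fun g => ζ (g * a⁻¹) :=
        hζc.comp_homeomorph (Homeomorph.mulRight a⁻¹)
      rw [integral_mul_rightSmoothing hf hf0 hfM hη hηc hζ hζc,
        ← integral_mul_right_eq_self (fun g => ζ g * rightSmoothing μ f η (g * a)) a⁻¹]
      simp only [inv_mul_cancel_right]
      rw [integral_mul_rightSmoothing hf hf0 hfM hη hηc (by fun_prop) hζa]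
      congr with g
      have := hrA _ (‹A.Normal›.conj_mem _ (A.inv_mem ha) g) fun u => ζ (u * g)
      rw [← this]
      simp only [mul_assoc, inv_mul_cancel, mul_one]
    refine congrFun (hc.ext_on hdense continuous_const ?_)
    rintro _ ⟨γ, hγ, a, ha, rfl⟩
    rw [hHA a ha, ← mul_one γ, hHΓ γ hγ]
  -- hence `f` is almost everywhere invariant under all left translations
  have hleft : ∀ g : G, ∀ᵐ u ∂μ, f (g * u) = f u := by
    intro g
    refine ae_eq_of_integral_mul_eq (M := M) (hf.comp (measurable_const_mul g)) hf
      (fun u => hfabs _) hfabs fun ζ hζ hζc => ?_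
    have h1 := hconst (fun z => ζ z⁻¹) (by fun_prop) (hζc.comp_homeomorph (Homeomorph.inv G)) g
    simp only [rightSmoothing, mul_inv_rev, inv_inv, inv_one, one_mul] at h1
    rw [← h1, ← integral_mul_left_eq_self (fun u => ζ (g⁻¹ * u) * f u) g]
    simp only [inv_mul_cancel_left]
  -- the measure `f μ` is left invariant, so it is a multiple of the Haar measure `μ`
  set ν := μ.withDensity fun g => ENNReal.ofReal (f g) with hν
  have hνf := isFiniteMeasureOnCompacts_withDensity_of_le (μ := μ) hf hf0 hfM
  have : IsMulLeftInvariant ν := by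
    refine ⟨fun g => Measure.ext fun s hs => ?_⟩
    rw [map_apply (measurable_const_mul g) hs, withDensity_apply _ hs,
      withDensity_apply _ (measurable_const_mul g hs),
      ← (measurePreserving_mul_left μ g).setLIntegral_comp_preimage hs hf.ennreal_ofReal]
    exact setLIntegral_congr_fun_ae (measurable_const_mul g hs)
      ((hleft g).mono fun u hu _ => by rw [hu])
  obtain ⟨c, hc⟩ := exists_integral_isMulLeftInvariant_eq_smul_of_hasCompactSupport ν μ
  refine ⟨c, ae_eq_of_integral_mul_eq (M := max M c) hf measurable_const
    (fun g => (hfabs g).trans (le_max_left _ _)) (fun g => ?_) fun ζ hζ hζc => ?_⟩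
  · rw [abs_of_nonneg c.coe_nonneg]
    exact le_max_right _ _
  · have := hc ζ hζ hζc
    rw [integral_withDensity_ofReal hf hf0 hfM, integral_smul_nnreal_measure] at this
    rw [this, integral_mul_const, mul_comm]
    rfl

/-- An essential modulus of continuity is a modulus of continuity off a null set. -/
theorem exists_ae_modulus_of_bounded [IsMulRightInvariant μ] {ω : G → ℝ}
    (hω : Tendsto ω (𝓝 1) (𝓝 0)) (h : ∀ u, ∀ᵐ g ∂μ, |f (g * u) - f g| ≤ ω u) :
    ∃ E : Set G, (∀ᵐ g ∂μ, g ∈ E) ∧ ∀ g ∈ E, ∀ g' ∈ E, |f g' - f g| ≤ ω (g⁻¹ * g') := by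
  have hfabs : ∀ g, |f g| ≤ M := fun g => (abs_of_nonneg (hf0 g)).trans_le (hfM g)
  have hfi : ∀ {q : G → ℝ}, Integrable q μ → Integrable (fun g => q g * f g) μ := fun hq =>
    hq.mul_bdd (c := M) hf.aestronglyMeasurable (Eventually.of_forall hfabs)
  -- approximation by continuous functions
  have happ : ∀ ε : ℝ, 0 < ε → ∃ q : G → ℝ, Continuous q ∧ ∀ᵐ g ∂μ, |q g - f g| ≤ ε := by
    intro ε hε
    have hinv : Tendsto (fun u : G => ω u⁻¹) (𝓝 1) (𝓝 0) :=
      hω.comp (by simpa using (continuous_inv.tendsto (1 : G)))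
    obtain ⟨V, hVε, hVo, hV1⟩ := eventually_nhds_iff.1 (hinv.eventually (gt_mem_nhds hε))
    obtain ⟨η, hη1, hηc, hηV, hη01⟩ :
        ∃ η : C(G, ℝ), η 1 ≠ 0 ∧ HasCompactSupport η ∧ (∀ v ∉ V, η v = 0) ∧ ∀ v, 0 ≤ η v := by
      obtain ⟨η, h1, h2, h3, h4⟩ := exists_continuous_one_zero_of_isCompact
        (isCompact_singleton (x := (1 : G))) hVo.isClosed_compl (by simpa using hV1)
      exact ⟨η, by rw [h1 rfl]; exact one_ne_zero, h3, fun v hv => h2 hv, fun v => (h4 v).1⟩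
    set I := ∫ v, η v ∂μ with hI
    have hIpos : 0 < I := η.continuous.integral_pos_of_hasCompactSupport_nonneg_nonzero hηc
      (fun v => hη01 v) hη1
    have hηi : Integrable η μ := η.continuous.integrable_of_hasCompactSupport hηc
    have hqc := continuous_rightSmoothing (μ := μ) hf hf0 hfM η.continuous hηc
    refine ⟨fun g => I⁻¹ * rightSmoothing μ f η g, continuous_const.mul hqc, ?_⟩
    have hqb := abs_rightSmoothing_le (μ := μ) hf hf0 hfM η.continuous hηc
    set B := M * ∫ u, |η u⁻¹| ∂μ with hB
    have hbd : ∀ g, |I⁻¹ * rightSmoothing μ f η g - f g| ≤ I⁻¹ * B + M := by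
      intro g
      refine (abs_sub _ _).trans (add_le_add ?_ (hfabs g))
      rw [abs_mul, abs_of_pos (inv_pos.2 hIpos)]
      exact mul_le_mul_of_nonneg_left (hqb g) (inv_pos.2 hIpos).le
    have hqm := (continuous_const (y := I⁻¹)).mul hqc |>.measurable
    have htest : ∀ ζ : G → ℝ, Continuous ζ → HasCompactSupport ζ → 0 ≤ ζ →
        |∫ g, ζ g * (I⁻¹ * rightSmoothing μ f η g - f g) ∂μ| ≤ ε * ∫ g, ζ g ∂μ := by
      intro ζ hζ hζc hζ0
      have hζi : Integrable ζ μ := hζ.integrable_of_hasCompactSupport hζc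
      have hJ := continuous_integral_mul_right_mul (μ := μ) hf hf0 hfM hζ hζc
      have hηJ : Integrable (fun g => η g * ∫ u, ζ (u * g) * f u ∂μ) μ :=
        (η.continuous.mul hJ).integrable_of_hasCompactSupport hηc.mul_right
      have e1 : ∫ g, ζ g * (I⁻¹ * rightSmoothing μ f η g - f g) ∂μ
          = I⁻¹ * ∫ g, η g * (∫ u, ζ (u * g) * f u ∂μ - ∫ u, ζ u * f u ∂μ) ∂μ := by
        have i1 : Integrable (fun g => ζ g * rightSmoothing μ f η g) μ :=
          (hζ.mul hqc).integrable_of_hasCompactSupport hζc.mul_right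
        simp only [mul_sub]
        rw [integral_sub hηJ (hηi.mul_const _), integral_mul_const,
          ← integral_mul_rightSmoothing hf hf0 hfM η.continuous hηc hζ hζc, mul_sub, ← hI,
          inv_mul_cancel_left₀ hIpos.ne', ← integral_const_mul, ← integral_sub _ (hfi hζi)]
        · congr with g
          ring
        · exact i1.const_mul _
      rw [e1, abs_mul, abs_of_pos (inv_pos.2 hIpos), inv_mul_le_iff₀ hIpos]
      calc |∫ g, η g * (∫ u, ζ (u * g) * f u ∂μ - ∫ u, ζ u * f u ∂μ) ∂μ|
          ≤ ∫ g, η g * (ε * ∫ u, ζ u ∂μ) ∂μ := by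
            rw [← Real.norm_eq_abs]
            refine norm_integral_le_of_norm_le (hηi.mul_const _)
              (Eventually.of_forall fun g => ?_)
            rw [norm_mul, Real.norm_of_nonneg (hη01 g)]
            by_cases hg : g ∈ V
            · refine mul_le_mul_of_nonneg_left ?_ (hη01 g)
              have e2 : ∫ u, ζ (u * g) * f u ∂μ = ∫ u, ζ u * f (u * g⁻¹) ∂μ := by
                rw [← integral_mul_right_eq_self (fun u => ζ (u * g) * f u) g⁻¹]
                simp
              have i2 : Integrable (fun u => ζ u * f (u * g⁻¹)) μ :=
                hζi.mul_bdd (c := M) (hf.comp (measurable_mul_const _)).aestronglyMeasurable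
                  (Eventually.of_forall fun u => hfabs _)
              rw [e2, ← integral_sub i2 (hfi hζi), ← integral_const_mul]
              refine norm_integral_le_of_norm_le (hζi.const_mul ε) ?_
              filter_upwards [h g⁻¹] with u hu
              rw [← mul_sub, norm_mul, Real.norm_of_nonneg (hζ0 u), Real.norm_eq_abs, mul_comm]
              exact mul_le_mul_of_nonneg_right (hu.trans (hVε g hg).le) (hζ0 u)
            · rw [hηV g hg, zero_mul, zero_mul]
        _ = I * (ε * ∫ u, ζ u ∂μ) := by rw [integral_mul_const]
    have hfrom : ∀ {h : G → ℝ}, Measurable h → (∀ g, |h g| ≤ I⁻¹ * B + M) →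
        (∀ ζ : G → ℝ, Continuous ζ → HasCompactSupport ζ → 0 ≤ ζ →
          ∫ g, ζ g * h g ∂μ ≤ ε * ∫ g, ζ g ∂μ) → ∀ᵐ g ∂μ, h g - ε ≤ 0 := by
      intro h hm hhb ht
      refine ae_nonpos_of_integral_mul_nonpos (M := I⁻¹ * B + M + ε) (hm.sub_const ε)
        (fun g => (abs_sub _ _).trans (add_le_add (hhb g) (abs_of_pos hε).le))
        fun ζ hζ hζc hζ0 => ?_
      have hζi : Integrable ζ μ := hζ.integrable_of_hasCompactSupport hζc
      simp only [mul_sub]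
      rw [integral_sub (hζi.mul_bdd hm.aestronglyMeasurable (Eventually.of_forall hhb))
        (hζi.mul_const _), integral_mul_const]
      linarith [ht ζ hζ hζc hζ0]
    have hb1 : ∀ᵐ g ∂μ, I⁻¹ * rightSmoothing μ f η g - f g - ε ≤ 0 :=
      hfrom (hqm.sub hf) hbd fun ζ h1 h2 h3 => (abs_le.1 (htest ζ h1 h2 h3)).2
    have hb2 : ∀ᵐ g ∂μ, -(I⁻¹ * rightSmoothing μ f η g - f g) - ε ≤ 0 := by
      refine hfrom (hqm.sub hf).neg (fun g => by rw [abs_neg]; exact hbd g)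
        fun ζ h1 h2 h3 => ?_
      simp only [mul_neg]
      rw [integral_neg]
      linarith [(abs_le.1 (htest ζ h1 h2 h3)).1]
    filter_upwards [hb1, hb2] with g h1 h2
    exact abs_le.2 ⟨by linarith, by linarith⟩
  choose q hqc hq using fun n : ℕ => happ (1 / ((n : ℝ) + 1)) Nat.one_div_pos_of_nat
  refine ⟨{g | ∀ n, |q n g - f g| ≤ 1 / ((n : ℝ) + 1)}, ae_all_iff.2 hq, fun g hg g' hg' => ?_⟩
  have hqu : ∀ n u g, |q n (g * u) - q n g| ≤ ω u + 2 * (1 / ((n : ℝ) + 1)) := by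
    intro n u
    have hcl : IsClosed {g | |q n (g * u) - q n g| ≤ ω u + 2 * (1 / ((n : ℝ) + 1))} :=
      isClosed_le ((((hqc n).comp (continuous_mul_const u)).sub (hqc n)).abs) continuous_const
    have hae : ∀ᵐ g ∂μ, |q n (g * u) - q n g| ≤ ω u + 2 * (1 / ((n : ℝ) + 1)) := by
      filter_upwards [h u, hq n,
        (measurePreserving_mul_right μ u).quasiMeasurePreserving.ae (hq n)] with g h1 h2 h3
      rw [abs_le] at *
      constructor <;> linarith
    exact fun g => hcl.closure_subset (Measure.dense_of_ae hae g)
  have hlim : Tendsto (fun n : ℕ => ω (g⁻¹ * g') + 4 * (1 / ((n : ℝ) + 1))) atTop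
      (𝓝 (ω (g⁻¹ * g') + 4 * 0)) :=
    (tendsto_one_div_add_atTop_nhds_zero_nat.const_mul 4).const_add _
  rw [mul_zero, add_zero] at hlim
  refine ge_of_tendsto' hlim fun n => ?_
  have h1 := hqu n (g⁻¹ * g') g
  rw [mul_inv_cancel_left] at h1
  have h2 := hg n
  have h3 := hg' n
  rw [abs_le] at *
  constructor <;> linarith

end

/-- A measurable map to a proper space with an essential modulus of continuity is almost everywhere
equal to a continuous map. -/
theorem exists_continuous_ae_eq [IsMulRightInvariant μ] {X : Type*} [MetricSpace X]
    [ProperSpace X] [MeasurableSpace X] [BorelSpace X] {ψ : G → X} (hψ : Measurable ψ)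
    {ω : G → ℝ} (hω : Tendsto ω (𝓝 1) (𝓝 0))
    (h : ∀ u, ∀ᵐ g ∂μ, dist (ψ (g * u)) (ψ g) ≤ ω u) :
    ∃ ψ' : G → X, Continuous ψ' ∧ (∀ᵐ g ∂μ, ψ g = ψ' g) ∧
      ∀ g u, dist (ψ' (g * u)) (ψ' g) ≤ ω u := by
  have : Nonempty X := ⟨ψ 1⟩
  set x := TopologicalSpace.denseSeq X with hx
  have hxd : DenseRange x := TopologicalSpace.denseRange_denseSeq X
  have hf : ∀ p : ℕ × ℕ, ∃ E : Set G, (∀ᵐ g ∂μ, g ∈ E) ∧ ∀ g ∈ E, ∀ g' ∈ E,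
      |min (dist (ψ g') (x p.1)) p.2 - min (dist (ψ g) (x p.1)) p.2| ≤ ω (g⁻¹ * g') := by
    rintro ⟨j, N⟩
    refine exists_ae_modulus_of_bounded (f := fun g => min (dist (ψ g) (x j)) N) (M := N)
      ((hψ.dist measurable_const).min measurable_const)
      (fun g => le_min dist_nonneg N.cast_nonneg) (fun g => min_le_right _ _) hω fun u => ?_
    filter_upwards [h u] with g hg
    refine (abs_min_sub_min_le_max _ _ _ _).trans (max_le ?_ ?_)
    · exact (abs_dist_sub_le _ _ _).trans hg
    · rw [sub_self, abs_zero]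
      exact dist_nonneg.trans hg
  choose E₀ hE₀ hE₀ω using hf
  set E := ⋂ p, E₀ p with hEdef
  have hE : ∀ᵐ g ∂μ, g ∈ E := by
    simp only [hEdef, mem_iInter]
    exact ae_all_iff.2 hE₀
  have hEω : ∀ g ∈ E, ∀ g' ∈ E, dist (ψ g') (ψ g) ≤ ω (g⁻¹ * g') := by
    intro g hg g' hg'
    refine le_of_forall_pos_le_add fun δ hδ => ?_
    obtain ⟨j, hj⟩ := hxd.exists_dist_lt (ψ g) (half_pos hδ)
    obtain ⟨N, hN⟩ := exists_nat_ge (dist (ψ g') (x j))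
    have h1 := hE₀ω (j, N) g (mem_iInter.1 hg _) g' (mem_iInter.1 hg' _)
    simp only [min_eq_left hN] at h1
    have h2 := (abs_le.1 h1).2
    have h3 := min_le_left (dist (ψ g) (x j)) (N : ℝ)
    have h4 := dist_triangle_right (ψ g') (ψ g) (x j)
    linarith
  have hEd : Dense E := Measure.dense_of_ae hE
  have di : IsDenseInducing (Subtype.val : E → G) := hEd.isDenseInducing_val
  have hlim : ∀ g : G, ∃ c, Tendsto (fun e : E => ψ e) (comap Subtype.val (𝓝 g)) (𝓝 c) := by
    intro g
    have hne : NeBot (comap (Subtype.val : E → G) (𝓝 g)) := di.comap_nhds_neBot g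
    refine CompleteSpace.complete (f := map (fun e : E => ψ e) (comap Subtype.val (𝓝 g))) ?_
    rw [Metric.cauchy_iff]
    refine ⟨hne.map _, fun ε hε => ?_⟩
    have hc : Tendsto (fun p : G × G => ω (p.1⁻¹ * p.2)) (𝓝 (g, g)) (𝓝 0) := by
      refine hω.comp ?_
      have : Continuous fun p : G × G => p.1⁻¹ * p.2 := by fun_prop
      simpa using this.tendsto (g, g)
    have h1 := hc.eventually (gt_mem_nhds hε)
    rw [nhds_prod_eq, Filter.Eventually, mem_prod_same_iff] at h1
    obtain ⟨W, hW, hWs⟩ := h1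
    refine ⟨_, image_mem_map (preimage_mem_comap hW), ?_⟩
    rintro _ ⟨a, ha, rfl⟩ _ ⟨b, hb, rfl⟩
    exact (hEω b b.2 a a.2).trans_lt (@hWs (_, _) ⟨hb, ha⟩)
  have hcont : Continuous (di.extend fun e : E => ψ e) := di.continuous_extend hlim
  have hEcont : Continuous fun e : E => ψ e := by
    rw [continuous_iff_continuousAt]
    intro e
    obtain ⟨c, hc⟩ := hlim e
    rw [← nhds_induced, ← instTopologicalSpaceSubtype.eq_1] at hc
    exact continuousAt_of_tendsto_nhds hc
  have hext : ∀ g ∈ E, ψ g = di.extend (fun e : E => ψ e) g := fun g hg =>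
    (di.extend_eq hEcont ⟨g, hg⟩).symm
  have hae := hE.mono hext
  refine ⟨_, hcont, hae, fun g u => ?_⟩
  have hcl : IsClosed {g | dist (di.extend (fun e : E => ψ e) (g * u))
      (di.extend (fun e : E => ψ e) g) ≤ ω u} :=
    isClosed_le ((hcont.comp (continuous_mul_const u)).dist hcont) continuous_const
  refine hcl.closure_subset (Measure.dense_of_ae (μ := μ) ?_ g)
  filter_upwards [h u, hae, (measurePreserving_mul_right μ u).quasiMeasurePreserving.ae hae]
    with g h1 h2 h3
  rw [← h2, ← h3]
  exact h1

end Smoothing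

/-! ### Minimal invariant convex sets in uniformly convex spaces -/

section Minimal

variable {Y : Type*} [PseudoMetricSpace Y]

/-- Uniform convexity of a pseudometric space, with respect to a choice of midpoints. -/
structure IsUniformlyConvexMid (m : Y → Y → Y) : Prop where
  dist_le_max : ∀ x y z, dist x (m y z) ≤ max (dist x y) (dist x z)
  exists_dist_le : ∀ η : ℝ, 0 < η → ∃ δ : ℝ, 0 < δ ∧ ∀ (x y z : Y) (r : ℝ), 0 < r →
    dist x y ≤ r → dist x z ≤ r → η * r ≤ dist y z → dist x (m y z) ≤ (1 - δ) * r

variable {G : Type*} [Group G] [MulAction G Y]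

/-- A nonempty closed convex set invariant under a group of symmetries; convexity is tested on
midpoints. -/
structure IsInvariantConvex (m : Y → Y → Y) (B : Subgroup G) (Z : Set Y) : Prop where
  nonempty : Z.Nonempty
  isClosed : IsClosed Z
  mid_mem : ∀ x ∈ Z, ∀ y ∈ Z, m x y ∈ Z
  smul_mem : ∀ b ∈ B, ∀ x ∈ Z, b • x ∈ Z

variable {m : Y → Y → Y} {B : Subgroup G} {Z : Set Y}

/-- A chain of closed convex sets at bounded distance from a point has nonempty intersection: the
points of the members that are almost as close as possible to the given point form a Cauchy
filter. -/
theorem IsUniformlyConvexMid.nonempty_sInter [CompleteSpace Y] (hm : IsUniformlyConvexMid m)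
    {c : Set (Set Y)} (hc : IsChain (· ⊆ ·) c) (hcne : c.Nonempty) (hZ : ∀ Z ∈ c,
    IsClosed Z ∧ ∀ x ∈ Z, ∀ y ∈ Z, m x y ∈ Z) (φ : Y) {M : ℝ}
    (hM : ∀ Z ∈ c, ∃ z ∈ Z, dist φ z ≤ M) : (⋂₀ c).Nonempty := by
  have hne : ∀ Z ∈ c, Z.Nonempty := fun Z h => (hM Z h).imp fun _ h => h.1
  have hbdd : BddAbove ((fun Z => Metric.infDist φ Z) '' c) := by
    refine ⟨M, ?_⟩
    rintro _ ⟨Z, hZc, rfl⟩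
    obtain ⟨z, hz, hzM⟩ := hM Z hZc
    exact (Metric.infDist_le_dist_of_mem hz).trans hzM
  set s := sSup ((fun Z => Metric.infDist φ Z) '' c) with hs
  have hle : ∀ Z ∈ c, Metric.infDist φ Z ≤ s := fun Z h => le_csSup hbdd (mem_image_of_mem _ h)
  have hs0 : 0 ≤ s := by
    obtain ⟨Z, h⟩ := hcne
    exact Metric.infDist_nonneg.trans (hle Z h)
  have hcnt : Nonempty c := hcne.to_subtype
  set A : c × {ε : ℝ // 0 < ε} → Set Y := fun p => p.1 ∩ {y | dist φ y ≤ s + p.2} with hA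
  have hAne : ∀ p, (A p).Nonempty := by
    rintro ⟨⟨Z, hZc⟩, ε, hε⟩
    obtain ⟨z, hz, h⟩ := (Metric.infDist_lt_iff (hne Z hZc)).1
      ((hle Z hZc).trans_lt (lt_add_of_pos_right s hε))
    exact ⟨z, hz, h.le⟩
  have hdir : Directed (· ≥ ·) fun p => 𝓟 (A p) := by
    rintro ⟨Z, ε⟩ ⟨Z', ε'⟩
    obtain ⟨Z'', h1, h2⟩ : ∃ Z'' : c, Z''.1 ⊆ Z.1 ∧ Z''.1 ⊆ Z'.1 := by
      rcases hc.total Z.2 Z'.2 with h | h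
      · exact ⟨Z, Subset.rfl, h⟩
      · exact ⟨Z', h, Subset.rfl⟩
    refine ⟨(Z'', ⟨min ε ε', lt_min ε.2 ε'.2⟩), ?_, ?_⟩
    · refine principal_mono.2 fun y hy => ⟨h1 hy.1, le_trans (b := s + min (ε : ℝ) ε') hy.2 ?_⟩
      exact add_le_add le_rfl (min_le_left _ _)
    · refine principal_mono.2 fun y hy => ⟨h2 hy.1, le_trans (b := s + min (ε : ℝ) ε') hy.2 ?_⟩
      exact add_le_add le_rfl (min_le_right _ _)
  set l : Filter Y := ⨅ p, 𝓟 (A p) with hl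
  have : Nonempty (c × {ε : ℝ // 0 < ε}) := ⟨(Classical.arbitrary _, ⟨1, one_pos⟩)⟩
  have hlne : NeBot l := iInf_neBot_of_directed' hdir fun p => principal_neBot_iff.2 (hAne p)
  have hAl : ∀ p, A p ∈ l := fun p => mem_iInf_of_mem p (mem_principal_self _)
  have hcauchy : Cauchy l := by
    rw [Metric.cauchy_iff]
    refine ⟨hlne, fun ζ hζ => ?_⟩
    rcases hs0.eq_or_lt with h0 | h0
    · refine ⟨_, hAl (Classical.arbitrary _, ⟨ζ / 4, by positivity⟩), fun x hx y hy => ?_⟩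
      have h1 : dist φ x ≤ s + ζ / 4 := hx.2
      have h2 : dist φ y ≤ s + ζ / 4 := hy.2
      linarith [dist_triangle_left x y φ]
    · obtain ⟨δ, hδ, H⟩ := hm.exists_dist_le (ζ / (s + 1)) (by positivity)
      set ε := min 1 (δ * s / (2 + δ)) / 2 with hε
      have hmin : 0 < min 1 (δ * s / (2 + δ)) := lt_min one_pos (by positivity)
      have hε0 : 0 < ε := by positivity
      have hε1 : ε ≤ 1 := by
        have := min_le_left 1 (δ * s / (2 + δ))
        linarith
      have hε2 : ε * (2 + δ) < δ * s := by
        rw [← lt_div_iff₀ (by positivity)]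
        exact (half_lt_self hmin).trans_le (min_le_right _ _)
      obtain ⟨_, ⟨Z, hZc, rfl⟩, hZs⟩ := exists_lt_of_lt_csSup (hcne.image _)
        (sub_lt_self s hε0)
      refine ⟨_, hAl (⟨Z, hZc⟩, ⟨ε, hε0⟩), fun x hx y hy => ?_⟩
      by_contra! hcon
      have h1 := H φ x y (s + ε) (by linarith) hx.2 hy.2 (by
        refine le_trans ?_ hcon
        rw [div_mul_eq_mul_div, div_le_iff₀ (by linarith)]
        exact mul_le_mul_of_nonneg_left (by linarith) hζ.le)
      have h2 : Metric.infDist φ Z ≤ dist φ (m x y) :=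
        Metric.infDist_le_dist_of_mem ((hZ Z hZc).2 x hx.1 y hy.1)
      nlinarith
  obtain ⟨x, hx⟩ := CompleteSpace.complete hcauchy
  refine ⟨x, fun Z hZc => (hZ Z hZc).1.mem_of_tendsto (f := id) (b := l) hx ?_⟩
  exact mem_of_superset (hAl (⟨Z, hZc⟩, ⟨1, one_pos⟩)) inter_subset_left

/-- A minimal invariant closed convex set exists as soon as such sets do not escape to infinity. -/
theorem IsUniformlyConvexMid.exists_minimal [CompleteSpace Y] (hm : IsUniformlyConvexMid m)
    {Z₀ : Set Y} (h₀ : IsInvariantConvex m B Z₀) (φ : Y) {M : ℝ}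
    (hM : ∀ Z ⊆ Z₀, IsInvariantConvex m B Z → ∃ z ∈ Z, dist φ z ≤ M) :
    ∃ Z ⊆ Z₀, Minimal (IsInvariantConvex m B) Z := by
  obtain ⟨Z, hZ₀, hZ⟩ := zorn_superset_nonempty {Z | Z ⊆ Z₀ ∧ IsInvariantConvex m B Z}
    (fun c hcS hc hcne => by
      refine ⟨⋂₀ c, ⟨?_, ?_⟩, fun s hs => sInter_subset_of_mem hs⟩
      · obtain ⟨Z, hZ⟩ := hcne
        exact (sInter_subset_of_mem hZ).trans (hcS hZ).1
      · refine ⟨hm.nonempty_sInter hc hcne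
          (fun Z hZ => ⟨(hcS hZ).2.isClosed, (hcS hZ).2.mid_mem⟩) φ
          (fun Z hZ => hM Z (hcS hZ).1 (hcS hZ).2),
          isClosed_sInter fun Z hZ => (hcS hZ).2.isClosed, ?_, ?_⟩
        · exact fun x hx y hy Z hZ => (hcS hZ).2.mid_mem x (hx Z hZ) y (hy Z hZ)
        · exact fun b hb x hx Z hZ => (hcS hZ).2.smul_mem b hb x (hx Z hZ)) Z₀ ⟨Subset.rfl, h₀⟩
  exact ⟨Z, hZ₀, hZ.1.2, fun W hW hWZ => hZ.2 ⟨hWZ.trans hZ₀, hW⟩ hWZ⟩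

/-- A point `p` of an invariant convex set that is almost as close as possible to `φ` is almost
fixed, relatively to its distance to `φ`, by the symmetries that move `φ` a bounded amount. -/
theorem IsUniformlyConvexMid.exists_almost_fixed [IsIsometricSMul G Y]
    (hm : IsUniformlyConvexMid m) {η : ℝ} (hη : 0 < η) :
    ∃ δ : ℝ, 0 < δ ∧ ∀ (Z : Set Y) (φ : Y), IsInvariantConvex m B Z → ∃ p ∈ Z, ∀ b ∈ B, ∀ c : ℝ,
      dist φ (b • φ) ≤ c → dist p (b • p) ≤ η * (dist φ p + c) ∨ δ * dist φ p ≤ 1 + c := by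
  obtain ⟨δ, hδ, H⟩ := hm.exists_dist_le η hη
  refine ⟨δ, hδ, fun Z φ hZ => ?_⟩
  obtain ⟨p, hp, hpd⟩ := (Metric.infDist_lt_iff (x := φ) hZ.nonempty).1 (lt_add_one _)
  refine ⟨p, hp, fun b hb c hc => ?_⟩
  by_contra! hcon
  have hc0 : 0 ≤ c := dist_nonneg.trans hc
  have h0 : 0 < dist φ p + c := by
    by_contra! h
    have h1 : dist φ p = 0 := le_antisymm (by linarith) dist_nonneg
    rw [h1] at hcon
    linarith [hcon.2]
  have h1 : dist φ (b • p) ≤ dist φ p + c := by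
    have := dist_triangle φ (b • φ) (b • p)
    rw [dist_smul] at this
    linarith
  have h2 := H φ p (b • p) _ h0 (by linarith) h1 hcon.1.le
  have h3 : Metric.infDist φ Z ≤ dist φ (m p (b • p)) :=
    Metric.infDist_le_dist_of_mem (hZ.mid_mem p hp _ (hZ.smul_mem b hb p hp))
  nlinarith [hcon.2]

/-- If the displacement under a family of symmetries is a proper function on `Z₀`, in the
quantitative sense of linear growth, then `Z₀` contains a minimal invariant closed convex set. -/
theorem IsUniformlyConvexMid.exists_minimal_of_coercive [CompleteSpace Y] [IsIsometricSMul G Y]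
    (hm : IsUniformlyConvexMid m) {Z₀ : Set Y} (h₀ : IsInvariantConvex m B Z₀) (φ : Y) {Q : Set G}
    (hQ : Q ⊆ B) {c C₁ C₂ : ℝ} (hc0 : 0 ≤ c) (hc : ∀ b ∈ Q, dist φ (b • φ) ≤ c) (hC₂ : 0 ≤ C₂)
    (hcoer : ∀ p ∈ Z₀, ∀ s : ℝ, 0 ≤ s → (∀ b ∈ Q, dist p (b • p) ≤ s) →
      dist φ p ≤ C₁ + C₂ * s) :
    ∃ Z ⊆ Z₀, Minimal (IsInvariantConvex m B) Z := by
  obtain ⟨δ, hδ, H⟩ := hm.exists_almost_fixed (B := B) (η := 1 / (2 * (C₂ + 1))) (by positivity)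
  refine hm.exists_minimal h₀ φ (M := max (2 * C₁ + c) ((1 + c) / δ)) fun Z hZ₀ hZ => ?_
  obtain ⟨p, hp, hpb⟩ := H Z φ hZ
  refine ⟨p, hp, le_max_iff.2 (or_iff_not_imp_right.2 fun hcon => ?_)⟩
  rw [le_div_iff₀ hδ, mul_comm] at hcon
  have hd : 0 ≤ dist φ p := dist_nonneg
  have h1 := hcoer p (hZ₀ hp) (1 / (2 * (C₂ + 1)) * (dist φ p + c)) (by positivity)
    fun b hb => (hpb b (hQ hb) c (hc b hb)).resolve_right hcon
  have h2 : C₂ * (1 / (2 * (C₂ + 1)) * (dist φ p + c)) ≤ 1 / 2 * (dist φ p + c) := by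
    rw [← mul_assoc]
    refine mul_le_mul_of_nonneg_right ?_ (by positivity)
    rw [mul_one_div, div_le_div_iff₀ (by positivity) two_pos]
    linarith
  linarith

/-- An invariant quasiconvex function is constant on a minimal invariant convex set. -/
theorem Minimal.eq_of_invariant (hZ : Minimal (IsInvariantConvex m B) Z) {f : Y → ℝ}
    (hf : ContinuousOn f Z) (hfm : ∀ x ∈ Z, ∀ y ∈ Z, f (m x y) ≤ max (f x) (f y))
    (hfB : ∀ b ∈ B, ∀ x ∈ Z, f (b • x) ≤ f x) {x y : Y} (hx : x ∈ Z) (hy : y ∈ Z) : f x = f y := by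
  have key : ∀ x ∈ Z, ∀ y ∈ Z, f y ≤ f x := by
    intro x hx y hy
    have h : IsInvariantConvex m B (Z ∩ f ⁻¹' Iic (f x)) := by
      refine ⟨⟨x, hx, le_refl (f x)⟩, hf.preimage_isClosed_of_isClosed hZ.1.isClosed isClosed_Iic, ?_, ?_⟩
      · exact fun y hy z hz => ⟨hZ.1.mid_mem y hy.1 z hz.1,
          (hfm y hy.1 z hz.1).trans (max_le hy.2 hz.2)⟩
      · exact fun b hb y hy => ⟨hZ.1.smul_mem b hb y hy.1, (hfB b hb y hy.1).trans hy.2⟩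
    exact (hZ.2 h inter_subset_left hy).2
  exact le_antisymm (key y hy x hx) (key x hx y hy)

/-- A bounded minimal invariant convex set has diameter zero, since its circumradius function is
constant. -/
theorem IsUniformlyConvexMid.dist_eq_zero_of_minimal [IsIsometricSMul G Y]
    (hm : IsUniformlyConvexMid m) (hZ : Minimal (IsInvariantConvex m B) Z)
    (hb : Bornology.IsBounded Z) {x y : Y} (hx : x ∈ Z) (hy : y ∈ Z) : dist x y = 0 := by
  obtain ⟨M, hM⟩ := Metric.isBounded_iff.1 hb
  set R : Y → ℝ := fun x => ⨆ y : Z, dist x y with hR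
  have hne : Nonempty Z := ⟨⟨x, hx⟩⟩
  have hbdd : ∀ x ∈ Z, BddAbove (range fun y : Z => dist x y) := by
    rintro x hx
    refine ⟨M, ?_⟩
    rintro _ ⟨y, rfl⟩
    exact hM hx y.2
  have hle : ∀ x ∈ Z, ∀ y ∈ Z, dist x y ≤ R x := fun x hx y hy =>
    le_ciSup (hbdd x hx) ⟨y, hy⟩
  have hcont : ContinuousOn R Z := by
    have hl : LipschitzOnWith 1 R Z := LipschitzOnWith.of_le_add fun x hx y hy =>
      ciSup_le fun z => by
        have := hle y hy z z.2
        linarith [dist_triangle_left (x : Y) z y, dist_comm x y, dist_triangle x y z]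
    exact hl.continuousOn
  have hconst : ∀ x ∈ Z, ∀ y ∈ Z, R x = R y := fun x hx y hy => by
    refine hZ.eq_of_invariant hcont ?_ ?_ hx hy
    · intro x hx y hy
      refine ciSup_le fun z => ?_
      rw [dist_comm]
      refine (hm.dist_le_max z x y).trans (max_le_max ?_ ?_) <;> rw [dist_comm]
      exacts [hle x hx z z.2, hle y hy z z.2]
    · intro b hb x hx
      refine ciSup_le fun z => ?_
      have := hle x hx _ (hZ.1.smul_mem _ (B.inv_mem hb) z z.2)
      rwa [← dist_smul b, smul_inv_smul] at this
  by_contra hxy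
  have hR0 : 0 < R x := (dist_nonneg.lt_of_ne' hxy).trans_le (hle x hx y hy)
  obtain ⟨δ, hδ, H⟩ := hm.exists_dist_le (1 / 2) (by norm_num)
  obtain ⟨z, hz⟩ := exists_lt_of_lt_ciSup (show 1 / 2 * R x < R x by linarith)
  have hzm := hZ.1.mid_mem x hx z z.2
  have h1 : R (m x z) ≤ (1 - δ) * R x := ciSup_le fun w => by
    rw [dist_comm]
    refine H w x z _ hR0 ?_ ?_ hz.le
    · rw [dist_comm]
      exact hle x hx w w.2
    · rw [dist_comm, hconst x hx z z.2]
      exact hle z z.2 w w.2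
  rw [hconst _ hzm x hx] at h1
  nlinarith

end Minimal

/-! ### Square integrable equivariant maps -/

section EquivariantMaps

open MeasureTheory Measure
open scoped Pointwise ENNReal

section L2

variable {α X : Type*} [MeasurableSpace α] [PseudoMetricSpace X]

/-- The `L²` distance of two maps, with respect to a measure on the source. -/
noncomputable def l2edist (ν : Measure α) (φ ψ : α → X) : ℝ≥0∞ :=
  (∫⁻ g, edist (φ g) (ψ g) ^ (2 : ℝ) ∂ν) ^ (1 / 2 : ℝ)

variable {ν : Measure α} {φ ψ χ : α → X}

theorem l2edist_sq : l2edist ν φ ψ ^ 2 = ∫⁻ g, edist (φ g) (ψ g) ^ 2 ∂ν := by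
  rw [l2edist, ← ENNReal.rpow_two, ← ENNReal.rpow_mul]
  norm_num

theorem l2edist_self : l2edist ν φ φ = 0 := by simp [l2edist]

theorem l2edist_comm : l2edist ν φ ψ = l2edist ν ψ φ := by simp only [l2edist, edist_comm]

theorem l2edist_le_add [SecondCountableTopology X] [MeasurableSpace X] [OpensMeasurableSpace X]
    {φ₁ ψ₁ φ₂ ψ₂ : α → X} (h₁ : Measurable φ₁) (h₁' : Measurable ψ₁) (h₂ : Measurable φ₂)
    (h₂' : Measurable ψ₂)
    (h : ∀ g, edist (φ g) (ψ g) ≤ edist (φ₁ g) (ψ₁ g) + edist (φ₂ g) (ψ₂ g)) :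
    l2edist ν φ ψ ≤ l2edist ν φ₁ ψ₁ + l2edist ν φ₂ ψ₂ :=
  (ENNReal.rpow_le_rpow (lintegral_mono fun g => ENNReal.rpow_le_rpow (h g) (by norm_num))
    (by norm_num)).trans
    (ENNReal.lintegral_Lp_add_le (h₁.edist h₁').aemeasurable (h₂.edist h₂').aemeasurable
      (by norm_num))

theorem l2edist_triangle [SecondCountableTopology X] [MeasurableSpace X]
    [OpensMeasurableSpace X] (hφ : Measurable φ) (hψ : Measurable ψ) (hχ : Measurable χ) :
    l2edist ν φ χ ≤ l2edist ν φ ψ + l2edist ν ψ χ :=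
  l2edist_le_add hφ hψ hψ hχ fun _ => edist_triangle _ _ _

theorem l2edist_le_of_ae_le {c : ℝ≥0∞} (h : ∀ᵐ g ∂ν, edist (φ g) (ψ g) ≤ c) :
    l2edist ν φ ψ ≤ c * ν univ ^ (1 / 2 : ℝ) := by
  have h1 : l2edist ν φ ψ ≤ (∫⁻ _, c ^ (2 : ℝ) ∂ν) ^ (1 / 2 : ℝ) :=
    ENNReal.rpow_le_rpow (lintegral_mono_ae (h.mono fun g hg =>
      ENNReal.rpow_le_rpow hg (by norm_num))) (by norm_num)
  refine h1.trans_eq ?_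
  rw [lintegral_const, ENNReal.mul_rpow_of_nonneg _ _ (by norm_num), ← ENNReal.rpow_mul]
  norm_num

theorem lintegral_edist_le_l2edist [SecondCountableTopology X] [MeasurableSpace X]
    [OpensMeasurableSpace X] (hφ : Measurable φ) (hψ : Measurable ψ) :
    ∫⁻ g, edist (φ g) (ψ g) ∂ν ≤ l2edist ν φ ψ * ν univ ^ (1 / 2 : ℝ) := by
  have h2 : Real.HolderConjugate 2 2 := by
    rw [Real.holderConjugate_iff]
    norm_num
  have := ENNReal.lintegral_mul_le_Lp_mul_Lq ν h2 (hφ.edist hψ).aemeasurable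
    (aemeasurable_const (b := (1 : ℝ≥0∞)))
  simpa [l2edist] using this

end L2

variable {G : Type*} [Group G] [TopologicalSpace G] [MeasurableSpace G]

theorem IsLatticeDomain.restrict_univ_rpow_lt_top [IsTopologicalGroup G] [BorelSpace G]
    {Γ : Subgroup G} {F : Set G} (hF : IsLatticeDomain Γ F) (μ : Measure G)
    [IsFiniteMeasureOnCompacts μ] : μ.restrict F univ ^ (1 / 2 : ℝ) < ∞ := by
  rw [restrict_apply_univ]
  exact ENNReal.rpow_lt_top_of_nonneg (by norm_num) (hF.measure_lt_top μ).ne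

/-- Measurable maps `G → X` that are equivariant for a subgroup `Γ` of `G` and that are limits, in
the `L²` distance on a domain `F`, of continuous equivariant maps. Maps that agree almost everywhere
are not identified, so that these maps form a pseudometric space. -/
structure L2Equivariant (Γ : Subgroup G) (F : Set G) (μ : Measure G) (X : Type*) [MetricSpace X]
    [MeasurableSpace X] [MulAction Γ X] where
  toFun : G → X
  measurable' : Measurable toFun
  map_mul' : ∀ (γ : Γ) (g : G), toFun (γ * g) = γ • toFun g
  approx' : ∀ ε : ℝ≥0∞, ε ≠ 0 → ∃ χ : G → X, Continuous χ ∧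
    (∀ (γ : Γ) (g : G), χ (γ * g) = γ • χ g) ∧ l2edist (μ.restrict F) toFun χ ≤ ε

namespace L2Equivariant

variable {Γ : Subgroup G} {F : Set G} {μ : Measure G} {X : Type*} [MetricSpace X]
  [MeasurableSpace X] [MulAction Γ X]

instance : CoeFun (L2Equivariant Γ F μ X) fun _ => G → X := ⟨toFun⟩

theorem measurable (φ : L2Equivariant Γ F μ X) : Measurable φ := φ.measurable'

theorem map_mul (φ : L2Equivariant Γ F μ X) (γ : Γ) (g : G) : φ (γ * g) = γ • φ g :=
  φ.map_mul' γ g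

variable [IsIsometricSMul Γ X]

theorem edist_map_mul (φ ψ : L2Equivariant Γ F μ X) (γ : Γ) (g : G) :
    edist (φ (γ * g)) (ψ (γ * g)) = edist (φ g) (ψ g) := by
  rw [map_mul, map_mul, edist_smul_left]

variable [ProperSpace X] [BorelSpace X] [IsTopologicalGroup G] [BorelSpace G]

/-- A continuous equivariant map. -/
def ofContinuous (φ : G → X) (hφ : Continuous φ)
    (hφΓ : ∀ (γ : Γ) (g : G), φ (γ * g) = γ • φ g) : L2Equivariant Γ F μ X where
  toFun := φ
  measurable' := hφ.measurable
  map_mul' := hφΓ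
  approx' ε _ := ⟨φ, hφ, hφΓ, by rw [l2edist_self]; exact zero_le⟩

noncomputable instance : PseudoEMetricSpace (L2Equivariant Γ F μ X) where
  edist φ ψ := l2edist (μ.restrict F) φ ψ
  edist_self _ := l2edist_self
  edist_comm _ _ := l2edist_comm
  edist_triangle φ ψ χ := l2edist_triangle φ.measurable ψ.measurable χ.measurable

theorem edist_def (φ ψ : L2Equivariant Γ F μ X) :
    edist φ ψ = l2edist (μ.restrict F) φ ψ := rfl

theorem exists_continuous_edist_le (φ : L2Equivariant Γ F μ X) {ε : ℝ≥0∞} (hε : ε ≠ 0) :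
    ∃ (χ : G → X) (hχ : Continuous χ) (hχΓ : ∀ (γ : Γ) (g : G), χ (γ * g) = γ • χ g),
      edist φ (ofContinuous χ hχ hχΓ) ≤ ε := by
  obtain ⟨χ, h1, h2, h3⟩ := φ.approx' ε hε
  exact ⟨χ, h1, h2, h3⟩

/-- The pointwise midpoint of two equivariant maps. -/
noncomputable def mid (hX : IsUCBusemann X) (φ ψ : L2Equivariant Γ F μ X) :
    L2Equivariant Γ F μ X where
  toFun g := hX.mid (φ g) (ψ g)
  measurable' := hX.continuous_mid.measurable.comp (φ.measurable.prodMk ψ.measurable)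
  map_mul' γ g := by rw [map_mul, map_mul, hX.smul_mid]
  approx' ε hε := by
    obtain ⟨χ, hχ, hχΓ, h⟩ := φ.approx' (ε / 2) (ENNReal.half_pos hε).ne'
    obtain ⟨χ', hχ', hχΓ', h'⟩ := ψ.approx' (ε / 2) (ENNReal.half_pos hε).ne'
    refine ⟨fun g => hX.mid (χ g) (χ' g), hX.continuous_mid.comp (hχ.prodMk hχ'),
      fun γ g => by simp only [hχΓ, hχΓ', hX.smul_mid], ?_⟩
    calc _ ≤ l2edist (μ.restrict F) φ χ + l2edist (μ.restrict F) ψ χ' := by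
          refine l2edist_le_add φ.measurable hχ.measurable ψ.measurable hχ'.measurable fun g => ?_
          simp only [edist_dist]
          rw [← ENNReal.ofReal_add dist_nonneg dist_nonneg]
          refine ENNReal.ofReal_le_ofReal ((hX.dist_mid_mid_le _ _ _ _).trans (half_le_self ?_))
          positivity
      _ ≤ ε / 2 + ε / 2 := add_le_add h h'
      _ = ε := ENNReal.add_halves ε

theorem mid_apply (hX : IsUCBusemann X) (φ ψ : L2Equivariant Γ F μ X) (g : G) :
    φ.mid hX ψ g = hX.mid (φ g) (ψ g) := rfl

variable [hF : Fact (IsLatticeDomain Γ F)] [Countable Γ] [IsHaarMeasure μ]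

theorem edist_ne_top (φ ψ : L2Equivariant Γ F μ X) : edist φ ψ ≠ ∞ := by
  obtain ⟨χ, hχ, hχΓ, h⟩ := φ.exists_continuous_edist_le one_ne_zero
  obtain ⟨χ', hχ', hχΓ', h'⟩ := ψ.exists_continuous_edist_le one_ne_zero
  have h3 : edist (ofContinuous χ hχ hχΓ : L2Equivariant Γ F μ X)
      (ofContinuous χ' hχ' hχΓ') < ∞ := by
    obtain ⟨C, hC, hFC⟩ := hF.out.subset_compact
    obtain ⟨M, hM⟩ := hC.bddAbove_image (f := fun g => dist (χ g) (χ' g))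
      (hχ.dist hχ').continuousOn
    have := l2edist_le_of_ae_le (ν := μ.restrict F) (φ := χ) (ψ := χ') (c := ENNReal.ofReal M)
      ((ae_restrict_iff' hF.out.measurableSet).2 (Eventually.of_forall fun g hg => by
        rw [edist_dist]
        exact ENNReal.ofReal_le_ofReal (hM (mem_image_of_mem _ (hFC hg)))))
    exact this.trans_lt (ENNReal.mul_lt_top ENNReal.ofReal_lt_top
      (hF.out.restrict_univ_rpow_lt_top μ))
  have := (edist_triangle4 φ (ofContinuous χ hχ hχΓ) (ofContinuous χ' hχ' hχΓ') ψ)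
  refine (this.trans_lt ?_).ne
  rw [edist_comm _ ψ]
  exact ENNReal.add_lt_top.2 ⟨ENNReal.add_lt_top.2 ⟨h.trans_lt ENNReal.one_lt_top, h3⟩,
    h'.trans_lt ENNReal.one_lt_top⟩

noncomputable instance : PseudoMetricSpace (L2Equivariant Γ F μ X) :=
  PseudoEMetricSpace.toPseudoMetricSpace edist_ne_top

theorem lintegral_sq_edist (φ ψ : L2Equivariant Γ F μ X) :
    ∫⁻ g in F, edist (φ g) (ψ g) ^ 2 ∂μ = ENNReal.ofReal (dist φ ψ ^ 2) := by
  rw [← l2edist_sq, ← edist_def, edist_dist, ENNReal.ofReal_pow dist_nonneg]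

theorem integrable_sq_dist (φ ψ : L2Equivariant Γ F μ X) :
    Integrable (fun g => dist (φ g) (ψ g) ^ 2) (μ.restrict F) := by
  refine ⟨((φ.measurable.dist ψ.measurable).pow_const 2).aestronglyMeasurable, ?_⟩
  rw [hasFiniteIntegral_iff_ofReal (Eventually.of_forall fun g => sq_nonneg _)]
  simp only [ENNReal.ofReal_pow dist_nonneg, ← edist_dist, lintegral_sq_edist]
  exact ENNReal.pow_lt_top (edist_ne_top φ ψ).lt_top

theorem sq_dist_eq_integral (φ ψ : L2Equivariant Γ F μ X) :
    dist φ ψ ^ 2 = ∫ g in F, dist (φ g) (ψ g) ^ 2 ∂μ := by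
  rw [integral_eq_lintegral_of_nonneg_ae (Eventually.of_forall fun g => sq_nonneg _)
    ((φ.measurable.dist ψ.measurable).pow_const 2).aestronglyMeasurable]
  simp only [ENNReal.ofReal_pow dist_nonneg, ← edist_dist, lintegral_sq_edist]
  rw [edist_dist, ← ENNReal.ofReal_pow dist_nonneg, ENNReal.toReal_ofReal (sq_nonneg _)]

theorem dist_le_of_ae_le {φ ψ : L2Equivariant Γ F μ X} {c : ℝ} (hc : 0 ≤ c)
    (h : ∀ᵐ g ∂μ, dist (φ g) (ψ g) ≤ c) : dist φ ψ ≤ c * √(μ.real F) := by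
  refine abs_le_of_sq_le_sq' ?_ (by positivity) |>.2
  rw [sq_dist_eq_integral, mul_pow, Real.sq_sqrt measureReal_nonneg]
  calc ∫ g in F, dist (φ g) (ψ g) ^ 2 ∂μ ≤ ∫ g in F, c ^ 2 ∂μ := by
        refine integral_mono_ae (integrable_sq_dist φ ψ)
          (integrableOn_const (hF.out.measure_lt_top μ).ne) ?_
        exact (ae_restrict_of_ae h).mono fun g hg => pow_le_pow_left₀ dist_nonneg hg 2
    _ = c ^ 2 * μ.real F := by rw [setIntegral_const, smul_eq_mul, mul_comm]

/-- A convergent sequence of equivariant maps has a subsequence that converges almost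
everywhere. -/
theorem exists_seq_tendsto_ae {u : ℕ → L2Equivariant Γ F μ X} {φ : L2Equivariant Γ F μ X}
    (h : Tendsto u atTop (𝓝 φ)) : ∃ ns : ℕ → ℕ, StrictMono ns ∧
      ∀ᵐ g ∂μ, Tendsto (fun n => u (ns n) g) atTop (𝓝 (φ g)) := by
  have hm : TendstoInMeasure (μ.restrict F) (fun n g => dist (u n g) (φ g)) atTop
      (fun _ => (0 : ℝ)) := by
    refine tendstoInMeasure_of_tendsto_eLpNorm (p := 1) one_ne_zero
      (fun n => ((u n).measurable.dist φ.measurable).aestronglyMeasurable)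
      aestronglyMeasurable_const ?_
    have h1 : Tendsto (fun n => edist (u n) φ * μ.restrict F univ ^ (1 / 2 : ℝ)) atTop
        (𝓝 (0 * μ.restrict F univ ^ (1 / 2 : ℝ))) :=
      ENNReal.Tendsto.mul_const (tendsto_iff_edist_tendsto_0.1 h)
        (Or.inr (hF.out.restrict_univ_rpow_lt_top μ).ne)
    rw [zero_mul] at h1
    refine tendsto_of_tendsto_of_tendsto_of_le_of_le tendsto_const_nhds h1 (fun _ => zero_le)
      fun n => ?_
    refine le_trans (le_of_eq ?_)
      (lintegral_edist_le_l2edist (ν := μ.restrict F) (u n).measurable φ.measurable)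
    rw [eLpNorm_one_eq_lintegral_enorm]
    refine lintegral_congr fun g => ?_
    simp [edist_dist, Real.enorm_eq_ofReal]
  obtain ⟨ns, hns, hae⟩ := hm.exists_seq_tendsto_ae
  refine ⟨ns, hns, hF.out.ae_of_ae_restrict (fun γ g => ?_) ?_⟩
  · refine tendsto_iff_dist_tendsto_zero.trans (Iff.trans ?_ tendsto_iff_dist_tendsto_zero.symm)
    simp only [map_mul, dist_smul]
  · exact hae.mono fun g hg => tendsto_iff_dist_tendsto_zero.2 hg

end L2Equivariant

end EquivariantMaps

/-! ### The geometry of the space of equivariant maps -/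

section EquivariantMaps

open MeasureTheory Measure
open scoped Pointwise ENNReal

namespace L2Equivariant

variable {G : Type*} [Group G] [TopologicalSpace G] [MeasurableSpace G] {Γ : Subgroup G}
  {F : Set G} {μ : Measure G} {X : Type*} [MetricSpace X] [MeasurableSpace X] [MulAction Γ X]
  [IsIsometricSMul Γ X] [ProperSpace X] [BorelSpace X] [IsTopologicalGroup G] [BorelSpace G]
  [hF : Fact (IsLatticeDomain Γ F)] [Countable Γ] [IsHaarMeasure μ]

theorem mid_self (hX : IsUCBusemann X) (φ : L2Equivariant Γ F μ X) : mid hX φ φ = φ := by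
  obtain ⟨φ, -, -, -⟩ := φ
  simp only [mid, hX.mid_self]

theorem dist_mid_mid_le_max (hX : IsUCBusemann X) (φ ψ φ' ψ' : L2Equivariant Γ F μ X) :
    dist (mid hX φ φ') (mid hX ψ ψ') ≤ max (dist φ ψ) (dist φ' ψ') := by
  have i1 := integrable_sq_dist φ ψ
  have i2 := integrable_sq_dist φ' ψ'
  have h1 : dist (mid hX φ φ') (mid hX ψ ψ') ^ 2 ≤ (dist φ ψ ^ 2 + dist φ' ψ' ^ 2) / 2 := by
    simp only [sq_dist_eq_integral]
    rw [← integral_add i1 i2, ← integral_div]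
    refine integral_mono (integrable_sq_dist _ _) ((i1.add i2).div_const 2) fun g => ?_
    have h1 := pow_le_pow_left₀ dist_nonneg (hX.dist_mid_mid_le (φ g) (φ' g) (ψ g) (ψ' g)) 2
    rw [← mid_apply, ← mid_apply] at h1
    nlinarith [sq_nonneg (dist (φ g) (ψ g) - dist (φ' g) (ψ' g))]
  refine abs_le_of_sq_le_sq' (h1.trans ?_) (le_max_of_le_left dist_nonneg) |>.2
  have h2 := pow_le_pow_left₀ dist_nonneg (le_max_left (dist φ ψ) (dist φ' ψ')) 2
  have h3 := pow_le_pow_left₀ dist_nonneg (le_max_right (dist φ ψ) (dist φ' ψ')) 2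
  linarith

/-- Uniform convexity of the target passes to equivariant maps. -/
theorem isUniformlyConvexMid (hX : IsUCBusemann X) :
    IsUniformlyConvexMid (mid hX : L2Equivariant Γ F μ X → _ → _) where
  dist_le_max φ ψ χ := by
    have h := dist_mid_mid_le_max hX φ ψ φ χ
    rwa [mid_self] at h
  exists_dist_le η hη := by
    obtain ⟨c, hc, H⟩ := hX.exists_sq_dist_mid_le (half_pos hη)
    refine ⟨c * η ^ 2 / 4, by positivity, fun φ ψ χ r hr hψ hχ hψχ => ?_⟩
    have h1 : dist φ (mid hX ψ χ) ^ 2 ≤ (dist φ ψ ^ 2 + dist φ χ ^ 2) / 2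
        - c * (dist ψ χ ^ 2 - (η / 2) ^ 2 * (dist φ ψ ^ 2 + dist φ χ ^ 2)) := by
      have i1 := integrable_sq_dist φ ψ
      have i2 := integrable_sq_dist φ χ
      have i3 := integrable_sq_dist ψ χ
      have i12 : Integrable (fun g => dist (φ g) (ψ g) ^ 2 + dist (φ g) (χ g) ^ 2)
        (μ.restrict F) := i1.add i2
      have i4 : Integrable (fun g => dist (ψ g) (χ g) ^ 2 -
        (η / 2) ^ 2 * (dist (φ g) (ψ g) ^ 2 + dist (φ g) (χ g) ^ 2)) (μ.restrict F) :=
        i3.sub (i12.const_mul _)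
      simp only [sq_dist_eq_integral]
      rw [← integral_add i1 i2, ← integral_div, ← integral_const_mul,
        ← integral_sub i3 (i12.const_mul _), ← integral_const_mul,
        ← integral_sub (i12.div_const 2) (i4.const_mul c)]
      exact integral_mono (integrable_sq_dist _ _)
        ((i12.div_const 2).sub (i4.const_mul c))
        fun g => H (φ g) (ψ g) (χ g)
    have h2 := pow_le_pow_left₀ dist_nonneg hψ 2
    have h3 := pow_le_pow_left₀ dist_nonneg hχ 2
    have h4 := pow_le_pow_left₀ (by positivity) hψχ 2
    have h5 : dist φ (mid hX ψ χ) ^ 2 ≤ (1 - 2 * (c * η ^ 2 / 4)) * r ^ 2 := by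
      have e1 : c * (η ^ 2 * r ^ 2 / 2) ≤
          c * (dist ψ χ ^ 2 - (η / 2) ^ 2 * (dist φ ψ ^ 2 + dist φ χ ^ 2)) := by
        refine mul_le_mul_of_nonneg_left ?_ hc.le
        have : (η / 2) ^ 2 * (dist φ ψ ^ 2 + dist φ χ ^ 2) ≤ (η / 2) ^ 2 * (r ^ 2 + r ^ 2) :=
          mul_le_mul_of_nonneg_left (by linarith) (by positivity)
        nlinarith
      nlinarith
    set t := c * η ^ 2 / 4 with ht
    rcases le_or_gt t 1 with h | h
    · refine abs_le_of_sq_le_sq' (h5.trans ?_) (mul_nonneg (by linarith) hr.le) |>.2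
      nlinarith [mul_nonneg (sq_nonneg t) (sq_nonneg r)]
    · have : 0 < r ^ 2 := by positivity
      nlinarith [sq_nonneg (dist φ (mid hX ψ χ))]

section Complete

open Classical in
/-- The pointwise limit of a sequence of equivariant maps where it exists, and the first member of
the sequence elsewhere. -/
noncomputable def pointwiseLimit (u : ℕ → L2Equivariant Γ F μ X) (g : G) : X :=
  if h : ∃ c, Tendsto (fun n => u n g) atTop (𝓝 c) then h.choose else u 0 g

theorem tendsto_pointwiseLimit {u : ℕ → L2Equivariant Γ F μ X} {g : G}
    (h : ∃ c, Tendsto (fun n => u n g) atTop (𝓝 c)) :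
    Tendsto (fun n => u n g) atTop (𝓝 (pointwiseLimit u g)) := by
  rw [pointwiseLimit, dif_pos h]
  exact h.choose_spec

theorem measurable_pointwiseLimit (u : ℕ → L2Equivariant Γ F μ X) :
    Measurable (pointwiseLimit u) := by
  classical
  set E := {g | ∃ c, Tendsto (fun n => u n g) atTop (𝓝 c)} with hE
  have hEm : MeasurableSet E := measurableSet_exists_tendsto fun n => (u n).measurable
  refine measurable_of_tendsto_metrizable (f := fun n => E.piecewise (u n) (u 0))
    (fun n => (u n).measurable.piecewise hEm (u 0).measurable) (tendsto_pi_nhds.2 fun g => ?_)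
  by_cases hg : g ∈ E
  · simpa only [piecewise_eq_of_mem _ _ _ hg] using tendsto_pointwiseLimit hg
  · have hg' : ¬ ∃ c, Tendsto (fun n => u n g) atTop (𝓝 c) := hg
    simp only [piecewise_eq_of_notMem _ _ _ hg]
    rw [pointwiseLimit, dif_neg hg']
    exact tendsto_const_nhds

theorem pointwiseLimit_map_mul (u : ℕ → L2Equivariant Γ F μ X) (γ : Γ) (g : G) :
    pointwiseLimit u (γ * g) = γ • pointwiseLimit u g := by
  by_cases h : ∃ c, Tendsto (fun n => u n g) atTop (𝓝 c)
  · have h1 := (tendsto_pointwiseLimit h).const_smul γ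
    simp only [← map_mul] at h1
    exact tendsto_nhds_unique (tendsto_pointwiseLimit ⟨_, h1⟩) h1
  · have h' : ¬ ∃ c, Tendsto (fun n => u n (γ * g)) atTop (𝓝 c) := by
      rintro ⟨c, hc⟩
      refine h ⟨γ⁻¹ • c, ?_⟩
      simpa only [map_mul, inv_smul_smul] using hc.const_smul γ⁻¹
    rw [pointwiseLimit, dif_neg h', pointwiseLimit, dif_neg h, map_mul]

instance : CompleteSpace (L2Equivariant Γ F μ X) := by
  refine EMetric.complete_of_convergent_controlled_sequences (fun n => (2⁻¹ : ℝ≥0∞) ^ n)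
    (fun n => ENNReal.pow_pos (by norm_num) n) fun u hu => ?_
  have hsum : ∀ᵐ g ∂μ.restrict F, ∑' n, edist (u n g) (u (n + 1) g) < ∞ := by
    refine ae_lt_top (Measurable.tsum fun n =>
      (u n).measurable.edist (u (n + 1)).measurable) ?_
    rw [lintegral_tsum fun n => ((u n).measurable.edist (u (n + 1)).measurable).aemeasurable]
    refine ne_top_of_le_ne_top (b := ∑' n : ℕ, (2⁻¹ : ℝ≥0∞) ^ n *
      μ.restrict F univ ^ (1 / 2 : ℝ)) ?_ (ENNReal.tsum_le_tsum fun n => ?_)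
    · rw [ENNReal.tsum_mul_right, ENNReal.tsum_geometric]
      refine ENNReal.mul_ne_top ?_ (hF.out.restrict_univ_rpow_lt_top μ).ne
      simp
    · refine (lintegral_edist_le_l2edist (u n).measurable (u (n + 1)).measurable).trans ?_
      gcongr
      exact (hu n n (n + 1) le_rfl n.le_succ).le
  have hlim : ∀ᵐ g ∂μ.restrict F, Tendsto (fun n => u n g) atTop (𝓝 (pointwiseLimit u g)) := by
    filter_upwards [hsum] with g hg
    exact tendsto_pointwiseLimit (cauchySeq_tendsto_of_complete
      (cauchySeq_of_edist_le_of_tsum_ne_top _ (fun n => le_rfl) hg.ne))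
  -- Fatou's lemma
  have hle : ∀ N, l2edist (μ.restrict F) (u N) (pointwiseLimit u) ≤ (2⁻¹ : ℝ≥0∞) ^ N := by
    intro N
    have h1 : ∫⁻ g in F, edist (u N g) (pointwiseLimit u g) ^ (2 : ℝ) ∂μ ≤
        ((2⁻¹ : ℝ≥0∞) ^ N) ^ (2 : ℝ) := by
      calc ∫⁻ g in F, edist (u N g) (pointwiseLimit u g) ^ (2 : ℝ) ∂μ
          = ∫⁻ g in F, liminf (fun n => edist (u N g) (u n g) ^ (2 : ℝ)) atTop ∂μ := by
            refine lintegral_congr_ae (hlim.mono fun g hg => ?_)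
            exact (((tendsto_const_nhds.edist hg).ennrpow_const 2).liminf_eq).symm
        _ ≤ liminf (fun n => ∫⁻ g in F, edist (u N g) (u n g) ^ (2 : ℝ) ∂μ) atTop :=
            lintegral_liminf_le fun n => ((u N).measurable.edist (u n).measurable).pow_const _
        _ ≤ _ := by
            refine liminf_le_of_frequently_le' (Eventually.frequently ?_)
            filter_upwards [eventually_ge_atTop N] with n hn
            have := ENNReal.rpow_le_rpow (z := 2) (hu N N n le_rfl hn).le (by norm_num)
            refine le_trans (le_of_eq ?_) this
            rw [edist_def, l2edist, ← ENNReal.rpow_mul]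
            norm_num
    refine (ENNReal.rpow_le_rpow h1 (by norm_num : (0 : ℝ) ≤ 1 / 2)).trans_eq ?_
    rw [← ENNReal.rpow_mul]
    norm_num
  have hpow : Tendsto (fun n : ℕ => (2⁻¹ : ℝ≥0∞) ^ n) atTop (𝓝 0) :=
    ENNReal.tendsto_pow_atTop_nhds_zero_of_lt_one (by norm_num)
  refine ⟨⟨pointwiseLimit u, measurable_pointwiseLimit u, pointwiseLimit_map_mul u,
    fun ε hε => ?_⟩, ?_⟩
  · obtain ⟨N, hN⟩ := (hpow.eventually (gt_mem_nhds (ENNReal.half_pos hε))).exists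
    obtain ⟨χ, hχ, hχΓ, h⟩ := (u N).approx' (ε / 2) (ENNReal.half_pos hε).ne'
    refine ⟨χ, hχ, hχΓ, (l2edist_triangle (measurable_pointwiseLimit u) (u N).measurable
      hχ.measurable).trans ((add_le_add ?_ h).trans_eq (ENNReal.add_halves ε))⟩
    rw [l2edist_comm]
    exact (hle N).trans hN.le
  · rw [tendsto_iff_edist_tendsto_0]
    exact tendsto_of_tendsto_of_tendsto_of_le_of_le tendsto_const_nhds hpow
      (fun _ => zero_le) hle

end Complete

variable [IsMulRightInvariant μ]

theorem l2edist_comp_mul_right {φ ψ : G → X} (hφ : ∀ (γ : Γ) (g : G), φ (γ * g) = γ • φ g)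
    (hψ : ∀ (γ : Γ) (g : G), ψ (γ * g) = γ • ψ g) (h : G) :
    l2edist (μ.restrict F) (fun g => φ (g * h)) (fun g => ψ (g * h)) =
      l2edist (μ.restrict F) φ ψ := by
  unfold l2edist
  rw [hF.out.setLIntegral_mul_right (f := fun g => edist (φ g) (ψ g) ^ (2 : ℝ))]
  intro γ g
  simp only [hφ, hψ, edist_smul_left]

/-- The group acts on the equivariant maps by right translations of the source. -/
instance : MulAction G (L2Equivariant Γ F μ X) where
  smul h φ :=
    { toFun := fun g => φ (g * h)
      measurable' := φ.measurable.comp (measurable_mul_const h)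
      map_mul' := fun γ g => by rw [mul_assoc, map_mul]
      approx' := fun ε hε => by
        obtain ⟨χ, hχ, hχΓ, hle⟩ := φ.approx' ε hε
        refine ⟨fun g => χ (g * h), hχ.comp (continuous_mul_const h),
          fun γ g => by simp only [mul_assoc, hχΓ], ?_⟩
        rwa [l2edist_comp_mul_right φ.map_mul' hχΓ] }
  one_smul φ := by
    obtain ⟨φ, -, -, -⟩ := φ
    change L2Equivariant.mk _ _ _ _ = _
    simp only [mul_one]
  mul_smul a b φ := by
    change L2Equivariant.mk _ _ _ _ = L2Equivariant.mk _ _ _ _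
    congr 1
    funext g
    change φ (g * (a * b)) = φ (g * a * b)
    rw [mul_assoc]

theorem smul_apply (h : G) (φ : L2Equivariant Γ F μ X) (g : G) : (h • φ) g = φ (g * h) := rfl

instance : IsIsometricSMul G (L2Equivariant Γ F μ X) :=
  ⟨fun h φ ψ => l2edist_comp_mul_right φ.map_mul' ψ.map_mul' h⟩

theorem smul_mid (hX : IsUCBusemann X) (h : G) (φ ψ : L2Equivariant Γ F μ X) :
    h • mid hX φ ψ = mid hX (h • φ) (h • ψ) := rfl

end L2Equivariant

end EquivariantMaps

/-! ### Continuous equivariant maps -/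

section ContinuousEquivariant

variable {G : Type*} [Group G] [TopologicalSpace G] [IsTopologicalGroup G] [T2Space G]
  [LocallyCompactSpace G] {Γ : Subgroup G} {X : Type*} [MetricSpace X] [MulAction Γ X]
  [IsIsometricSMul Γ X]

theorem IsUCBusemann.sq_dist_mid_lt (hX : IsUCBusemann X) (x : X) {y z : X} (h : y ≠ z) :
    dist x (hX.mid y z) ^ 2 < (dist x y ^ 2 + dist x z ^ 2) / 2 := by
  have hd : 0 < dist y z := dist_pos.2 h
  have hs : 0 < dist x y + dist x z := hd.trans_le (dist_triangle_left _ _ _)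
  obtain ⟨c, hc, H⟩ := hX.exists_sq_dist_mid_le (ε := dist y z / (2 * (dist x y + dist x z)))
    (by positivity)
  refine (H x y z).trans_lt (sub_lt_self _ (mul_pos hc ?_))
  rw [div_pow, div_mul_eq_mul_div, sub_pos, div_lt_iff₀ (by positivity)]
  refine mul_lt_mul_of_pos_left ?_ (by positivity)
  nlinarith [mul_nonneg (dist_nonneg (x := x) (y := y)) (dist_nonneg (x := x) (y := z)),
    sq_nonneg (dist x y), sq_nonneg (dist x z), mul_pos hs hs]

/-- Continuous equivariant maps exist: a smoothly weighted orbit has a unique barycentre, the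
minimum point of a weighted sum of squared distances. -/
theorem IsUniformLattice.exists_continuous_equivariant (hΓ : IsUniformLattice Γ) [ProperSpace X]
    [Nonempty X] (hX : IsUCBusemann X) :
    ∃ φ : G → X, Continuous φ ∧ ∀ (γ : Γ) (g : G), φ (γ * g) = γ • φ g := by
  classical
  obtain ⟨C, hC, hcov⟩ := hΓ.exists_isCompact_cover
  obtain ⟨v, hv1, -, hvc, hv01⟩ := exists_continuous_one_zero_of_isCompact hC isClosed_empty
    (disjoint_empty C)
  have hv0 : ∀ g, 0 ≤ v g := fun g => (hv01 g).1
  set o : X := Classical.arbitrary X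
  set T : Γ → G × X → ℝ := fun γ p => v (γ * p.1) * dist (γ • p.2) o ^ 2 with hT
  set Φ : G × X → ℝ := fun p => ∑ᶠ γ : Γ, T γ p with hΦ
  have hT0 : ∀ γ p, 0 ≤ T γ p := fun γ p => mul_nonneg (hv0 _) (sq_nonneg _)
  have hTc : ∀ γ, Continuous (T γ) := fun γ => by
    have : Continuous fun p : G × X => γ • p.2 := continuous_snd.const_smul γ
    simp only [hT]
    fun_prop
  have hfin : ∀ K : Set G, IsCompact K → {γ : Γ | ∃ g ∈ K, v (γ * g) ≠ 0}.Finite := by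
    intro K hK
    refine (hΓ.finite_mem (hvc.mul hK.inv)).subset ?_
    rintro γ ⟨g, hg, h⟩
    exact ⟨γ * g, subset_tsupport _ h, g⁻¹, Set.inv_mem_inv.2 hg, by simp⟩
  have hfin' : ∀ p : G × X, (Function.support fun γ => T γ p).Finite := fun p =>
    (hfin {p.1} isCompact_singleton).subset fun γ hγ => ⟨p.1, rfl, left_ne_zero_of_mul hγ⟩
  have hlf : LocallyFinite fun γ => Function.support (T γ) := by
    rintro ⟨g, x⟩
    obtain ⟨K, hK, hKg⟩ := exists_compact_mem_nhds g
    refine ⟨Prod.fst ⁻¹' K, continuous_fst.continuousAt hKg, (hfin K hK).subset ?_⟩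
    rintro γ ⟨⟨g', x'⟩, h1, h2⟩
    exact ⟨g', h2, left_ne_zero_of_mul h1⟩
  have hΦc : Continuous Φ := continuous_finsum hTc hlf
  have hle : ∀ γ p, T γ p ≤ Φ p := fun γ p => single_le_finsum γ (hfin' p) fun γ => hT0 γ p
  have hΦsum : ∀ g : G, ∃ s : Finset Γ, (∀ γ : Γ, v (γ * g) ≠ 0 → γ ∈ s) ∧
      ∀ x, Φ (g, x) = ∑ γ ∈ s, T γ (g, x) := by
    intro g
    refine ⟨(hfin {g} isCompact_singleton).toFinset, fun γ hγ => by simpa using hγ,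
      fun x => finsum_eq_sum_of_support_subset _ fun γ hγ => ?_⟩
    have : v (γ * g) ≠ 0 := left_ne_zero_of_mul hγ
    simpa using this
  -- `Φ (g, ·)` is continuous and proper, so it attains its minimum
  have hex : ∀ g, ∃ x, ∀ y, Φ (g, x) ≤ Φ (g, y) := by
    intro g
    obtain ⟨γ, hγ⟩ := hcov g
    refine (hΦc.comp (Continuous.prodMk_right g)).exists_forall_le ?_
    refine tendsto_atTop_mono (fun x => hle γ (g, x)) ?_
    have h1 : ∀ x, T γ (g, x) = dist x (γ⁻¹ • o) ^ 2 := by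
      intro x
      have : v (γ * g) = 1 := hv1 hγ
      simp only [hT, this, one_mul]
      rw [← dist_smul γ x, smul_inv_smul]
    simp only [h1]
    exact (tendsto_pow_atTop two_ne_zero).comp (tendsto_dist_right_cocompact_atTop _)
  -- the minimum is unique, since `Φ (g, ·)` is strictly convex
  have huniq : ∀ g x y, (∀ z, Φ (g, x) ≤ Φ (g, z)) → (∀ z, Φ (g, y) ≤ Φ (g, z)) → x = y := by
    intro g x y hx hy
    by_contra hne
    obtain ⟨s, hs, hsum⟩ := hΦsum g
    obtain ⟨γ, hγ⟩ := hcov g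
    have hvγ : v (γ * g) = 1 := hv1 hγ
    have hlt : ∀ γ : Γ, dist (γ • hX.mid x y) o ^ 2 <
        (dist (γ • x) o ^ 2 + dist (γ • y) o ^ 2) / 2 := by
      intro γ
      have := hX.sq_dist_mid_lt o ((MulAction.injective γ).ne hne)
      rw [← hX.smul_mid] at this
      simpa only [dist_comm o] using this
    have h1 : ∑ γ ∈ s, T γ (g, hX.mid x y) <
        ∑ γ ∈ s, (T γ (g, x) + T γ (g, y)) / 2 := by
      refine Finset.sum_lt_sum (fun γ _ => ?_) ⟨γ, hs γ (by simp [hvγ]), ?_⟩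
      · have := mul_le_mul_of_nonneg_left (hlt γ).le (hv0 (γ * g))
        simp only [hT]
        linarith
      · have := hlt γ
        simp only [hT, hvγ]
        linarith
    rw [← Finset.sum_div, Finset.sum_add_distrib, ← hsum, ← hsum, ← hsum] at h1
    have h2 := hx (hX.mid x y)
    have h3 := hy (hX.mid x y)
    linarith
  choose φ hφ using hex
  refine ⟨φ, ?_, fun γ g => ?_⟩
  -- near `g` the minimum points stay in a ball, and their limits are minimum points at `g`
  · rw [continuous_iff_ultrafilter]
    intro g l hl
    obtain ⟨γ, hγ⟩ := hcov g
    have hvγ : v (γ * g) = 1 := hv1 hγ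
    have e1 : ∀ᶠ g' in (l : Filter G), 1 / 2 < v (γ * g') := by
      have : Tendsto (fun g' => v (γ * g')) (𝓝 g) (𝓝 1) := by
        rw [← hvγ]
        exact (v.continuous.comp (continuous_const_mul (γ : G))).tendsto g
      exact hl (this.eventually (lt_mem_nhds (by norm_num)))
    have e2 : ∀ᶠ g' in (l : Filter G), Φ (g', o) < Φ (g, o) + 1 := by
      have : Tendsto (fun g' => Φ (g', o)) (𝓝 g) (𝓝 (Φ (g, o))) :=
        (hΦc.comp (Continuous.prodMk_left o)).tendsto g
      exact hl (this.eventually (gt_mem_nhds (lt_add_one _)))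
    have e3 : ∀ᶠ g' in (l : Filter G),
        φ g' ∈ Metric.closedBall (γ⁻¹ • o) (√(2 * (Φ (g, o) + 1))) := by
      filter_upwards [e1, e2] with g' h1 h2
      have h3 : T γ (g', φ g') ≤ Φ (g, o) + 1 :=
        (hle γ _).trans ((hφ g' o).trans h2.le)
      rw [Metric.mem_closedBall, ← dist_smul γ, smul_inv_smul]
      refine Real.le_sqrt_of_sq_le ?_
      simp only [hT] at h3
      nlinarith [sq_nonneg (dist (γ • φ g') o)]
    obtain ⟨y, -, hy⟩ := isCompact_iff_ultrafilter_le_nhds.1 (isCompact_closedBall _ _)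
      (l.map φ) (le_principal_iff.2 e3)
    have hy' : Tendsto φ l (𝓝 y) := hy
    have hmin : ∀ z, Φ (g, y) ≤ Φ (g, z) := by
      intro z
      have t1 : Tendsto (fun g' => Φ (g', φ g')) l (𝓝 (Φ (g, y))) :=
        (hΦc.tendsto (g, y)).comp (Tendsto.prodMk_nhds (tendsto_id'.2 hl) hy')
      have t2 : Tendsto (fun g' => Φ (g', z)) l (𝓝 (Φ (g, z))) :=
        ((hΦc.comp (Continuous.prodMk_left z)).tendsto g).mono_left hl
      exact le_of_tendsto_of_tendsto' t1 t2 fun g' => hφ g' z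
    rw [huniq g _ _ (hφ g) hmin]
    exact hy'
  · have hinv : ∀ x, Φ (γ * g, γ • x) = Φ (g, x) := by
      intro x
      simp only [hΦ]
      rw [← finsum_comp_equiv (Equiv.mulRight γ) (f := fun γ' => T γ' (g, x))]
      refine finsum_congr fun γ' => ?_
      simp [hT, mul_assoc, mul_smul]
    refine huniq (γ * g) _ _ (hφ _) fun z => ?_
    have := hφ g (γ⁻¹ • z)
    rwa [← hinv, ← hinv (γ⁻¹ • z), smul_inv_smul] at this

/-- Continuous equivariant maps are uniformly continuous for right translations. -/
theorem IsUniformLattice.exists_modulus (hΓ : IsUniformLattice Γ) {φ : G → X} (hφ : Continuous φ)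
    (hφΓ : ∀ (γ : Γ) (g : G), φ (γ * g) = γ • φ g) : ∃ ω : G → ℝ, Continuous ω ∧
      (∀ u, 0 ≤ ω u) ∧ (∀ g u, dist (φ g) (φ (g * u)) ≤ ω u) ∧
      ∀ u, (∀ g, φ (g * u) = φ g) → ω u = 0 := by
  obtain ⟨C, hC, hcov⟩ := hΓ.exists_isCompact_cover
  have hc : Continuous (Function.uncurry fun u g => dist (φ g) (φ (g * u))) :=
    (hφ.comp continuous_snd).dist (hφ.comp (continuous_snd.mul continuous_fst))
  refine ⟨fun u => sSup ((fun g => dist (φ g) (φ (g * u))) '' C),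
    hC.continuous_sSup (f := fun u g => dist (φ g) (φ (g * u))) hc, fun u => ?_, fun g u => ?_,
    fun u hu => ?_⟩
  · refine Real.sSup_nonneg ?_
    rintro _ ⟨g, -, rfl⟩
    exact dist_nonneg
  · obtain ⟨γ, hγ⟩ := hcov g
    rw [← dist_smul γ, ← hφΓ, ← hφΓ, ← mul_assoc]
    exact le_csSup (hC.bddAbove_image
      (f := fun g => dist (φ g) (φ (g * u))) (hc.comp (Continuous.prodMk_right u)).continuousOn)
      ⟨_, hγ, rfl⟩
  · simp only [hu, dist_self]
    rcases C.eq_empty_or_nonempty with h | h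
    · simp [h]
    · rw [h.image_const, csSup_singleton]

end ContinuousEquivariant

/-! ### Linear growth of the displacement of equivariant maps -/

section Coercivity

open MeasureTheory Measure
open scoped Pointwise ENNReal

namespace L2Equivariant

variable {G : Type*} [Group G] [TopologicalSpace G] [IsTopologicalGroup G] [T2Space G]
  [LocallyCompactSpace G] [MeasurableSpace G] [BorelSpace G] {Γ : Subgroup G} {F : Set G}
  {μ : Measure G} [IsHaarMeasure μ] [IsMulRightInvariant μ] {X : Type*} [MetricSpace X]
  [MeasurableSpace X] [BorelSpace X] [ProperSpace X] [MulAction Γ X] [IsIsometricSMul Γ X]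
  [hF : Fact (IsLatticeDomain Γ F)] [Countable Γ]

theorem exists_setIntegral_sq_dist_le (F : Set G) [hF : Fact (IsLatticeDomain Γ F)] {K : Set G}
    (hK : IsCompact K) : ∃ N : ℕ, ∀ φ ψ : L2Equivariant Γ F μ X,
      ∫ g in K, dist (φ g) (ψ g) ^ 2 ∂μ ≤ N * dist φ ψ ^ 2 := by
  obtain ⟨N, hN⟩ := hF.out.exists_setLIntegral_le (μ := μ) hK
  refine ⟨N, fun φ ψ => ?_⟩
  rw [integral_eq_lintegral_of_nonneg_ae (Eventually.of_forall fun g => sq_nonneg _)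
    ((φ.measurable.dist ψ.measurable).pow_const 2).aestronglyMeasurable]
  refine ENNReal.toReal_le_of_le_ofReal (by positivity) ?_
  have := hN (fun g => edist (φ g) (ψ g) ^ 2) fun γ g => by rw [edist_map_mul]
  rw [lintegral_sq_edist] at this
  rw [ENNReal.ofReal_mul N.cast_nonneg, ENNReal.ofReal_natCast]
  simpa only [ENNReal.ofReal_pow dist_nonneg, ← edist_dist] using this

/-- Distances between the values of an equivariant map are controlled, in the mean, by its
displacement under translations. -/
theorem exists_integral_integral_le (F : Set G) [hF : Fact (IsLatticeDomain Γ F)] {ζ η : G → ℝ}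
    (hζ : Continuous ζ) (hζc : HasCompactSupport ζ) (hζ0 : ∀ g, 0 ≤ ζ g) (hη : Continuous η)
    (hηc : HasCompactSupport η) (hη0 : ∀ g, 0 ≤ η g) :
    ∃ (Q : Set G) (C : ℝ), IsCompact Q ∧ 0 ≤ C ∧ ∀ (χ : G → X) (hχ : Continuous χ)
      (hχΓ : ∀ (γ : Γ) (g : G), χ (γ * g) = γ • χ g) (s : ℝ),
      (∀ v ∈ Q, dist (ofContinuous χ hχ hχΓ : L2Equivariant Γ F μ X)
        (v • ofContinuous χ hχ hχΓ) ≤ s) →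
      ∫ h, ∫ g, ζ h * (η g * dist (χ h) (χ g) ^ 2) ∂μ ∂μ ≤ C * s ^ 2 := by
  obtain ⟨N, hN⟩ := exists_setIntegral_sq_dist_le (Γ := Γ) (μ := μ) (X := X) F hζc
  obtain ⟨M₁, hM₁⟩ := hζ.bounded_above_of_compact_support hζc
  obtain ⟨M₂, hM₂⟩ := hη.bounded_above_of_compact_support hηc
  have hM₁0 : 0 ≤ M₁ := (norm_nonneg _).trans (hM₁ 1)
  have hM₂0 : 0 ≤ M₂ := (norm_nonneg _).trans (hM₂ 1)
  have hQ : IsCompact ((tsupport ζ)⁻¹ * tsupport η) := hζc.inv.mul hηc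
  set Q := (tsupport ζ)⁻¹ * tsupport η with hQdef
  refine ⟨Q, M₁ * M₂ * N * μ.real Q, hQ, by positivity, fun χ hχ hχΓ s hs => ?_⟩
  set p : L2Equivariant Γ F μ X := ofContinuous χ hχ hχΓ with hp
  set f : G → G → ℝ := fun h v => ζ h * (η (h * v) * dist (χ h) (χ (h * v)) ^ 2) with hf
  have hf0 : ∀ h v, 0 ≤ f h v := fun h v =>
    mul_nonneg (hζ0 _) (mul_nonneg (hη0 _) (sq_nonneg _))
  have hfz : ∀ h v, (h ∉ tsupport ζ ∨ v ∉ Q) → f h v = 0 := by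
    intro h v hv
    by_cases hh : h ∈ tsupport ζ
    · have : h * v ∉ tsupport η := fun hhv => hv.elim (absurd hh)
        (absurd ⟨h⁻¹, Set.inv_mem_inv.2 hh, h * v, hhv, by simp⟩)
      simp only [hf, image_eq_zero_of_notMem_tsupport this, zero_mul, mul_zero]
    · simp only [hf, image_eq_zero_of_notMem_tsupport hh, zero_mul]
  have hfc : Continuous (Function.uncurry f) := by
    simp only [hf, Function.uncurry_def]
    fun_prop
  -- substitute `g = h * v` and exchange the integrals; `v` then ranges over the compact set `Q`
  have h1 : ∫ h, ∫ g, ζ h * (η g * dist (χ h) (χ g) ^ 2) ∂μ ∂μ = ∫ v, ∫ h, f h v ∂μ ∂μ := by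
    rw [← integral_integral_swap_of_hasCompactSupport hfc]
    · refine integral_congr_ae (Eventually.of_forall fun h => ?_)
      exact (integral_mul_left_eq_self (fun g => ζ h * (η g * dist (χ h) (χ g) ^ 2)) h).symm
    · refine HasCompactSupport.intro (hζc.isCompact.prod hQ) ?_
      rintro ⟨h, v⟩ hhv
      exact hfz h v (not_and_or.1 hhv)
  rw [h1]
  have h2 : ∀ v, ∫ h, f h v ∂μ ≤ Q.indicator (fun _ => M₁ * M₂ * N * s ^ 2) v := by
    intro v
    by_cases hv : v ∈ Q
    · rw [indicator_of_mem hv]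
      have hint : Integrable ((tsupport ζ).indicator
          fun h => M₁ * M₂ * dist (χ h) (χ (h * v)) ^ 2) μ := by
        refine (ContinuousOn.integrableOn_compact hζc ?_).integrable_indicator
          (isClosed_tsupport ζ).measurableSet
        fun_prop
      calc ∫ h, f h v ∂μ ≤ ∫ h, (tsupport ζ).indicator
            (fun h => M₁ * M₂ * dist (χ h) (χ (h * v)) ^ 2) h ∂μ := by
            refine integral_mono_of_nonneg (Eventually.of_forall fun h => hf0 h v) hint
              (Eventually.of_forall fun h => ?_)
            by_cases hh : h ∈ tsupport ζ
            · rw [indicator_of_mem hh]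
              simp only [hf, ← mul_assoc]
              refine mul_le_mul_of_nonneg_right ?_ (sq_nonneg _)
              exact mul_le_mul ((le_abs_self _).trans (hM₁ h)) ((le_abs_self _).trans (hM₂ _))
                (hη0 _) hM₁0
            · rw [indicator_of_notMem hh]
              exact (hfz h v (Or.inl hh)).le
        _ = M₁ * M₂ * ∫ h in tsupport ζ, dist (p h) ((v • p) h) ^ 2 ∂μ := by
            rw [integral_indicator (isClosed_tsupport ζ).measurableSet, integral_const_mul]
            rfl
        _ ≤ M₁ * M₂ * (N * s ^ 2) := by
            refine mul_le_mul_of_nonneg_left ((hN p (v • p)).trans ?_) (by positivity)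
            exact mul_le_mul_of_nonneg_left (pow_le_pow_left₀ dist_nonneg (hs v hv) 2)
              N.cast_nonneg
        _ = _ := by ring
    · rw [indicator_of_notMem hv]
      simp only [hfz _ v (Or.inr hv), integral_zero, le_refl]
  calc ∫ v, ∫ h, f h v ∂μ ∂μ ≤ ∫ v, Q.indicator (fun _ => M₁ * M₂ * N * s ^ 2) v ∂μ := by
        refine integral_mono_of_nonneg
          (Eventually.of_forall fun v => integral_nonneg fun h => hf0 h v) ?_
          (Eventually.of_forall h2)
        exact (integrableOn_const hQ.measure_lt_top.ne).integrable_indicator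
          (hζc.inv.mul hηc).measurableSet
    _ = _ := by
        rw [integral_indicator hQ.measurableSet, setIntegral_const, smul_eq_mul]
        ring

/-- The displacement of the values of an equivariant map under `γ ∈ Γ` is controlled, in the mean,
by the displacement of the map under translations. -/
theorem exists_setIntegral_sq_dist_smul_le (F : Set G) [hF : Fact (IsLatticeDomain Γ F)] (γ : Γ) :
    ∃ (Q : Set G) (C : ℝ), IsCompact Q ∧ 0 ≤ C ∧ ∀ (χ : G → X) (hχ : Continuous χ)
      (hχΓ : ∀ (γ : Γ) (g : G), χ (γ * g) = γ • χ g) (s : ℝ),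
      (∀ v ∈ Q, dist (ofContinuous χ hχ hχΓ : L2Equivariant Γ F μ X)
        (v • ofContinuous χ hχ hχΓ) ≤ s) →
      ∫ g in F, dist (χ g) (γ • χ g) ^ 2 ∂μ ≤ C * s ^ 2 := by
  obtain ⟨K, hK, hFK⟩ := hF.out.subset_compact
  obtain ⟨ζ, hζ1, -, hζc, hζ01⟩ := exists_continuous_one_zero_of_isCompact hK isClosed_empty
    (disjoint_empty K)
  have hζ0 : ∀ g, 0 ≤ ζ g := fun g => (hζ01 g).1
  have hζ := ζ.continuous
  set ζ' : G → ℝ := fun g => ζ ((γ : G)⁻¹ * g) with hζ'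
  have hζ'' : Continuous ζ' := hζ.comp (continuous_const_mul _)
  have hζ'c : HasCompactSupport ζ' :=
    hζc.comp_homeomorph (Homeomorph.mulLeft (γ : G)⁻¹)
  obtain ⟨Q₁, C₁, hQ₁, hC₁, H₁⟩ := exists_integral_integral_le (Γ := Γ) (μ := μ) (X := X) F hζ hζc hζ0
    hζ hζc hζ0
  obtain ⟨Q₂, C₂, hQ₂, hC₂, H₂⟩ := exists_integral_integral_le (Γ := Γ) (μ := μ) (X := X) F hζ hζc hζ0
    hζ'' hζ'c fun g => hζ0 _
  have hI : 0 < ∫ g, ζ g ∂μ := by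
    have h1 : μ.real F ≤ ∫ g, ζ g ∂μ := by
      rw [← integral_indicator_one hF.out.measurableSet]
      refine integral_mono ((integrableOn_const (hF.out.measure_lt_top μ).ne).integrable_indicator
        hF.out.measurableSet) (hζ.integrable_of_hasCompactSupport hζc) fun g => ?_
      refine indicator_le' (fun g hg => ?_) (fun g _ => hζ0 g) g
      rw [hζ1 (hFK hg)]
    exact (ENNReal.toReal_pos (hF.out.measure_ne_zero μ) (hF.out.measure_lt_top μ).ne).trans_le h1
  refine ⟨Q₁ ∪ Q₂, (2 * C₁ + 2 * C₂) / ∫ g, ζ g ∂μ, hQ₁.union hQ₂, by positivity,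
    fun χ hχ hχΓ s hs => ?_⟩
  set A := ∫ g in F, dist (χ g) (γ • χ g) ^ 2 ∂μ with hA
  set a : (G → ℝ) → G → ℝ := fun η h => ∫ g, η g * dist (χ h) (χ g) ^ 2 ∂μ with ha
  have hint : ∀ {q : G → ℝ}, Continuous q → Integrable (fun g => ζ g * q g) μ := fun hq =>
    (hζ.mul hq).integrable_of_hasCompactSupport hζc.mul_right
  have hac : ∀ η : G → ℝ, Continuous η → HasCompactSupport η → Continuous (a η) := by
    intro η hη hηc
    rw [← continuousOn_univ]
    refine continuousOn_integral_of_compact_support (k := tsupport η) hηc ?_ ?_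
    · refine Continuous.continuousOn ?_
      simp only [Function.uncurry_def]
      fun_prop
    · intro h g _ hg
      rw [image_eq_zero_of_notMem_tsupport hg, zero_mul]
  have h1 : ∀ h, A ≤ 2 * a ζ h + 2 * a ζ' h := by
    intro h
    have e : a ζ' h = ∫ g, ζ g * dist (χ h) (χ (γ * g)) ^ 2 ∂μ := by
      rw [← integral_mul_left_eq_self _ (γ : G)⁻¹]
      simp only [ha, hζ', mul_inv_cancel_left]
    rw [e, ← integral_const_mul, ← integral_const_mul, ← integral_add
      ((hint (by fun_prop)).const_mul 2) ((hint (by fun_prop)).const_mul 2), hA,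
      ← integral_indicator hF.out.measurableSet]
    refine integral_mono_of_nonneg (Eventually.of_forall fun g =>
      indicator_nonneg (fun _ _ => sq_nonneg _) g) (((hint (by fun_prop)).const_mul 2).add
      ((hint (by fun_prop)).const_mul 2)) (Eventually.of_forall fun g => ?_)
    by_cases hg : g ∈ F
    · rw [indicator_of_mem hg]
      simp only [hζ1 (hFK hg), ← hχΓ, Pi.one_apply, one_mul]
      have := pow_le_pow_left₀ dist_nonneg (dist_triangle_left (χ g) (χ (γ * g)) (χ h)) 2
      nlinarith [sq_nonneg (dist (χ h) (χ g) - dist (χ h) (χ (γ * g)))]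
    · rw [indicator_of_notMem hg]
      have := hζ0 g
      positivity
  clear_value A
  have h2 : (∫ h, ζ h ∂μ) * A ≤ 2 * (∫ h, ζ h * a ζ h ∂μ) + 2 * ∫ h, ζ h * a ζ' h ∂μ := by
    rw [← integral_const_mul, ← integral_const_mul, ← integral_mul_const A, ← integral_add
      ((hint (hac _ hζ hζc)).const_mul 2) ((hint (hac _ hζ'' hζ'c)).const_mul 2)]
    refine integral_mono ((hζ.integrable_of_hasCompactSupport hζc).mul_const A)
      (((hint (hac _ hζ hζc)).const_mul 2).add ((hint (hac _ hζ'' hζ'c)).const_mul 2))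
      fun h => ?_
    have := mul_le_mul_of_nonneg_left (h1 h) (hζ0 h)
    simp only
    linarith
  have h3 := H₁ χ hχ hχΓ s fun v hv => hs v (Or.inl hv)
  have h4 := H₂ χ hχ hχΓ s fun v hv => hs v (Or.inr hv)
  simp only [integral_const_mul] at h3 h4
  rw [div_mul_eq_mul_div, le_div_iff₀ hI]
  linarith

/-- If `Γ` fixes no point at infinity, the displacement of equivariant maps under translations by a
suitable compact set grows at least linearly with the distance to a given map. -/
theorem exists_coercive (F : Set G) [hF : Fact (IsLatticeDomain Γ F)] [Nonempty X]
    (hX : IsBusemannNPC X)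
    (hfix : ¬ ∃ ξ : VisualBoundary X, ∀ γ : Γ, γ • ξ = ξ) {φ : G → X} (hφ : Continuous φ)
    (hφΓ : ∀ (γ : Γ) (g : G), φ (γ * g) = γ • φ g) :
    ∃ (Q : Set G) (C₁ C₂ : ℝ), IsCompact Q ∧ 0 ≤ C₂ ∧ ∀ (p : L2Equivariant Γ F μ X) (s : ℝ),
      0 ≤ s → (∀ v ∈ Q, dist p (v • p) ≤ s) → dist (ofContinuous φ hφ hφΓ) p ≤ C₁ + C₂ * s := by
  obtain ⟨K, hK, hFK⟩ := hF.out.subset_compact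
  set o : X := Classical.arbitrary X
  obtain ⟨S, C, hC, H⟩ := hX.exists_dist_le_displacement hfix o
  choose Q c hQ hc hQc using fun γ : Γ =>
    exists_setIntegral_sq_dist_smul_le (μ := μ) (X := X) F γ
  obtain ⟨M, hM⟩ := hK.bddAbove_image (f := fun g => dist (φ g) o) (hφ.dist continuous_const
    ).continuousOn
  set R := 2 * (max M 0 + C) ^ 2 * μ.real F with hR
  set R' := 2 * (C ^ 2 * S.card * ∑ γ ∈ S, c γ) with hR'
  have hR0 : 0 ≤ R := by positivity
  have hR'0 : 0 ≤ R' := by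
    have : 0 ≤ ∑ γ ∈ S, c γ := Finset.sum_nonneg fun γ _ => hc γ
    positivity
  have hcF : ∀ {q : G → ℝ}, Continuous q → IntegrableOn q F μ := fun hq =>
    (hq.continuousOn.integrableOn_compact hK).mono_set hFK
  -- for continuous maps, integrate the linear growth of displacements in `X` over `F`
  have key : ∀ (χ : G → X) (hχ : Continuous χ) (hχΓ : ∀ (γ : Γ) (g : G), χ (γ * g) = γ • χ g)
      (s : ℝ), 0 ≤ s → (∀ v ∈ ⋃ γ ∈ S, Q γ, dist (ofContinuous χ hχ hχΓ : L2Equivariant Γ F μ X)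
        (v • ofContinuous χ hχ hχΓ) ≤ s) →
      dist (ofContinuous φ hφ hφΓ : L2Equivariant Γ F μ X) (ofContinuous χ hχ hχΓ) ≤
        √R + √R' * s := by
    intro χ hχ hχΓ s hs0 hs
    have hc' : ∀ γ : Γ, Continuous fun g => dist (χ g) (γ • χ g) ^ 2 := fun γ =>
      (hχ.dist (hχ.const_smul γ)).pow 2
    have hsum : IntegrableOn (fun g => 2 * (C ^ 2 * S.card) *
        ∑ γ ∈ S, dist (χ g) (γ • χ g) ^ 2) F μ :=
      hcF (continuous_const.mul (continuous_finsetSum _ fun γ _ => hc' γ))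
    have h1 : dist (ofContinuous φ hφ hφΓ : L2Equivariant Γ F μ X) (ofContinuous χ hχ hχΓ) ^ 2
        ≤ R + R' * s ^ 2 := by
      rw [sq_dist_eq_integral]
      calc ∫ g in F, dist (φ g) (χ g) ^ 2 ∂μ
          ≤ ∫ g in F, (2 * (max M 0 + C) ^ 2 +
              2 * (C ^ 2 * S.card) * ∑ γ ∈ S, dist (χ g) (γ • χ g) ^ 2) ∂μ := by
            refine setIntegral_mono_on (hcF ((hφ.dist hχ).pow 2)) ((hcF continuous_const).add hsum)
              hF.out.measurableSet fun g hg => ?_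
            have e1 : dist (φ g) o ≤ max M 0 :=
              (hM (mem_image_of_mem _ (hFK hg))).trans (le_max_left _ _)
            have e2 : dist (φ g) (χ g) ≤ (max M 0 + C) + C * ∑ γ ∈ S, dist (χ g) (γ • χ g) := by
              have := dist_triangle (φ g) o (χ g)
              linarith [H (χ g)]
            have e3 := sq_sum_le_card_mul_sum_sq (s := S) (f := fun γ => dist (χ g) (γ • χ g))
            have e4 := pow_le_pow_left₀ dist_nonneg e2 2
            have e5 := mul_le_mul_of_nonneg_left e3 (sq_nonneg C)
            nlinarith [sq_nonneg (max M 0 + C - C * ∑ γ ∈ S, dist (χ g) (γ • χ g))]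
        _ = R + 2 * (C ^ 2 * S.card) * ∑ γ ∈ S, ∫ g in F, dist (χ g) (γ • χ g) ^ 2 ∂μ := by
            rw [integral_add (hcF continuous_const) hsum,
              integral_const_mul (2 * (C ^ 2 * (S.card : ℝ))),
              integral_finsetSum _ fun γ _ => hcF (hc' γ), setIntegral_const, smul_eq_mul, hR]
            ring
        _ ≤ R + 2 * (C ^ 2 * S.card) * ∑ γ ∈ S, c γ * s ^ 2 := by
            gcongr with γ hγ
            exact hQc γ χ hχ hχΓ s fun v hv => hs v (mem_biUnion hγ hv)
        _ = R + R' * s ^ 2 := by rw [← Finset.sum_mul, hR']; ring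
    refine abs_le_of_sq_le_sq' (h1.trans ?_) (by positivity) |>.2
    have e1 := Real.sq_sqrt hR0
    have e2 := Real.sq_sqrt hR'0
    have e3 : 0 ≤ √R * (√R' * s) := by positivity
    nlinarith
  refine ⟨⋃ γ ∈ S, Q γ, √R + 2 * √R' + 1, √R', S.isCompact_biUnion fun γ _ => hQ γ,
    Real.sqrt_nonneg _, fun p s hs0 hs => ?_⟩
  -- replace a general map by a continuous one at distance at most `1`
  obtain ⟨χ, hχ, hχΓ, hpχ⟩ := p.exists_continuous_edist_le one_ne_zero
  have hpχ' : dist p (ofContinuous χ hχ hχΓ) ≤ 1 := by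
    rw [edist_dist, ← ENNReal.ofReal_one] at hpχ
    exact (ENNReal.ofReal_le_ofReal_iff zero_le_one).1 hpχ
  have h1 := key χ hχ hχΓ (s + 2) (by linarith) fun v hv => by
    have h2 := dist_triangle4 (ofContinuous χ hχ hχΓ) p (v • p) (v • ofContinuous χ hχ hχΓ)
    rw [dist_smul, dist_comm _ p] at h2
    linarith [hs v hv]
  have h2 := dist_triangle_right (ofContinuous φ hφ hφΓ) p (ofContinuous χ hχ hχΓ)
  linarith

end L2Equivariant

end Coercivity

/-! ### Minimal families of equivariant maps -/

section MinimalFamilies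

open MeasureTheory Measure
open scoped Pointwise ENNReal

namespace L2Equivariant

variable {G : Type*} [Group G] [TopologicalSpace G] [IsTopologicalGroup G] [T2Space G]
  [LocallyCompactSpace G] [MeasurableSpace G] [BorelSpace G] {Γ : Subgroup G} {F : Set G}
  {μ : Measure G} [IsHaarMeasure μ] [IsMulRightInvariant μ] {X : Type*} [MetricSpace X]
  [MeasurableSpace X] [BorelSpace X] [ProperSpace X] [MulAction Γ X] [IsIsometricSMul Γ X]
  [hF : Fact (IsLatticeDomain Γ F)] [Countable Γ]

/-- The parallelogram lemma for equivariant maps holds pointwise. -/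
theorem ae_dist_eq_of_parallel (hX : IsUCBusemann X) {φ φ' ψ ψ' : L2Equivariant Γ F μ X} {a : ℝ}
    (h0 : dist φ ψ = a) (h1 : dist φ' ψ' = a) (hm : dist (mid hX φ φ') (mid hX ψ ψ') = a) :
    ∀ᵐ g ∂μ, dist (φ g) (φ' g) = dist (ψ g) (ψ' g) := by
  refine hF.out.ae_of_ae_restrict (fun γ g => by simp only [map_mul, dist_smul]) ?_
  have i1 := integrable_sq_dist φ ψ
  have i2 := integrable_sq_dist φ' ψ'
  have i3 := integrable_sq_dist (mid hX φ φ') (mid hX ψ ψ')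
  have i12 : Integrable (fun g => dist (φ g) (ψ g) ^ 2 + dist (φ' g) (ψ' g) ^ 2)
    (μ.restrict F) := i1.add i2
  set w : G → ℝ := fun g => (dist (φ g) (ψ g) ^ 2 + dist (φ' g) (ψ' g) ^ 2) / 2 -
    dist (mid hX φ φ' g) (mid hX ψ ψ' g) ^ 2 with hw
  have hle : ∀ g, dist (mid hX φ φ' g) (mid hX ψ ψ' g) ≤
      (dist (φ g) (ψ g) + dist (φ' g) (ψ' g)) / 2 := fun g => hX.dist_mid_mid_le _ _ _ _
  have hwle : ∀ g, (dist (φ g) (ψ g) - dist (φ' g) (ψ' g)) ^ 2 / 4 ≤ w g := by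
    intro g
    have := pow_le_pow_left₀ dist_nonneg (hle g) 2
    simp only [hw]
    nlinarith
  have hw0 : 0 ≤ w := fun g => le_trans (by positivity) (hwle g)
  have hwi : ∫ g in F, w g ∂μ = 0 := by
    simp only [hw]
    rw [integral_sub (i12.div_const 2) i3, integral_div, integral_add i1 i2,
      ← sq_dist_eq_integral, ← sq_dist_eq_integral, ← sq_dist_eq_integral, h0, h1, hm]
    ring
  rw [integral_eq_zero_iff_of_nonneg hw0 ((i12.div_const 2).sub i3)] at hwi
  filter_upwards [hwi] with g hg
  have hg0 : w g = 0 := hg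
  have e1 : dist (φ' g) (ψ' g) = dist (φ g) (ψ g) := by
    have := hwle g
    rw [hg0] at this
    nlinarith [sq_nonneg (dist (φ g) (ψ g) - dist (φ' g) (ψ' g))]
  have e2 : dist (mid hX φ φ' g) (mid hX ψ ψ' g) = dist (φ g) (ψ g) := by
    simp only [hw, e1] at hg0
    exact (sq_eq_sq₀ dist_nonneg dist_nonneg).1 (by linarith)
  exact hX.dist_eq_dist_of_parallel rfl e1 e2

/-- The maps that are moved by the right translations in `A` at most as prescribed by `ω`. -/
def almostInvariant (Γ : Subgroup G) (F : Set G) (μ : Measure G) (X : Type*) [MetricSpace X]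
    [MeasurableSpace X] [MulAction Γ X] (A : Subgroup G) (ω : G → ℝ) :
    Set (L2Equivariant Γ F μ X) :=
  {ψ | ∀ k ∈ A, ∀ᵐ g ∂μ, dist (ψ g) (ψ (g * k)) ≤ ω k}

theorem ae_mul_right {p : G → Prop} (h : ∀ᵐ g ∂μ, p g) (k : G) : ∀ᵐ g ∂μ, p (g * k) :=
  (measurePreserving_mul_right μ k).quasiMeasurePreserving.ae h

theorem ae_mul_left {p : G → Prop} (h : ∀ᵐ g ∂μ, p g) (k : G) : ∀ᵐ g ∂μ, p (k * g) :=
  (measurePreserving_mul_left μ k).quasiMeasurePreserving.ae h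

theorem isInvariantConvex_almostInvariant (hX : IsUCBusemann X) {A B : Subgroup G}
    (hAB : ∀ a ∈ A, ∀ b ∈ B, a * b = b * a) {ω : G → ℝ} {φ : L2Equivariant Γ F μ X}
    (hφ : φ ∈ almostInvariant Γ F μ X A ω) :
    IsInvariantConvex (mid hX) B (almostInvariant Γ F μ X A ω) where
  nonempty := ⟨φ, hφ⟩
  isClosed := by
    refine IsSeqClosed.isClosed fun u ψ hu hψ k hk => ?_
    obtain ⟨ns, -, h⟩ := exists_seq_tendsto_ae hψ
    have h1 : ∀ᵐ g ∂μ, ∀ n, dist (u (ns n) g) (u (ns n) (g * k)) ≤ ω k :=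
      ae_all_iff.2 fun n => hu (ns n) k hk
    filter_upwards [h, ae_mul_right h k, h1] with g h2 h3 h4
    exact le_of_tendsto' (h2.dist h3) h4
  mid_mem x hx y hy k hk := by
    filter_upwards [hx k hk, hy k hk] with g h1 h2
    refine (hX.dist_mid_mid_le _ _ _ _).trans ?_
    linarith
  smul_mem b hb x hx k hk := by
    filter_upwards [ae_mul_right (hx k hk) b] with g h
    rw [smul_apply, smul_apply, mul_assoc, hAB k hk b hb, ← mul_assoc]
    exact h

theorem tendsto_dist_smul_self (φ : L2Equivariant Γ F μ X) (hΓ : IsUniformLattice Γ) :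
    Tendsto (fun u : G => dist φ (u • φ)) (𝓝 1) (𝓝 0) := by
  rw [Metric.tendsto_nhds]
  intro ε hε
  obtain ⟨χ, hχ, hχΓ, h⟩ := φ.exists_continuous_edist_le (ε := ENNReal.ofReal (ε / 3))
    (by simpa using by positivity)
  rw [edist_dist, ENNReal.ofReal_le_ofReal_iff (by positivity)] at h
  obtain ⟨ω, hω, hω0, hωle, hω1⟩ := hΓ.exists_modulus hχ hχΓ
  have h1 : Tendsto (fun u => ω u * √(μ.real F)) (𝓝 1) (𝓝 0) := by
    have := (hω.mul_const √(μ.real F)).tendsto 1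
    rwa [hω1 1 (by simp), zero_mul] at this
  filter_upwards [h1.eventually (gt_mem_nhds (show 0 < ε / 3 by positivity))] with u hu
  rw [Real.dist_eq, sub_zero, abs_of_nonneg dist_nonneg]
  have h2 : dist (ofContinuous χ hχ hχΓ : L2Equivariant Γ F μ X) (u • ofContinuous χ hχ hχΓ) ≤
      ω u * √(μ.real F) := dist_le_of_ae_le (hω0 u) (Eventually.of_forall fun g => hωle g u)
  have h3 := dist_triangle4 φ (ofContinuous χ hχ hχΓ) (u • ofContinuous χ hχ hχΓ) (u • φ)
  rw [dist_smul, dist_comm _ φ] at h3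
  linarith

/-- If `Γ` fixes no point at infinity, then for each direct factor of `G`, given as the range of an
idempotent endomorphism `β`, there is a minimal invariant convex set of equivariant maps that are
moved by the complementary factor as little as a given map. -/
theorem exists_minimal [Nonempty X] (hX : IsUCBusemann X)
    (hfix : ¬ ∃ ξ : VisualBoundary X, ∀ γ : Γ, γ • ξ = ξ) (β : G →* G) (hβ : Continuous β)
    (hββ : ∀ g, β (β g) = β g) (hcomm : ∀ a ∈ β.ker, ∀ b ∈ β.range, a * b = b * a) {φ : G → X}
    (hφ : Continuous φ) (hφΓ : ∀ (γ : Γ) (g : G), φ (γ * g) = γ • φ g) {ω : G → ℝ}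
    (hω : Continuous ω) (hωφ : ∀ g u, dist (φ g) (φ (g * u)) ≤ ω u) :
    ∃ Z ⊆ almostInvariant Γ F μ X β.ker ω, Minimal (IsInvariantConvex (mid hX) β.range) Z := by
  have hω0 : ∀ u, 0 ≤ ω u := fun u => dist_nonneg.trans (hωφ 1 u)
  obtain ⟨Q, C₁, C₂, hQ, hC₂, H⟩ := exists_coercive (μ := μ) F hX.npc hfix hφ hφΓ
  have hα : ∀ g, g * (β g)⁻¹ ∈ β.ker := fun g => by
    rw [MonoidHom.mem_ker, _root_.map_mul, map_inv, hββ, mul_inv_cancel]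
  obtain ⟨M, hM⟩ := hQ.bddAbove_image (f := fun v => ω (v * (β v)⁻¹))
    (by fun_prop : Continuous fun v => ω (v * (β v)⁻¹)).continuousOn
  obtain ⟨c, hc⟩ := (hQ.image hβ).bddAbove_image (f := ω) hω.continuousOn
  set p₀ : L2Equivariant Γ F μ X := ofContinuous φ hφ hφΓ
  have hp₀ : p₀ ∈ almostInvariant Γ F μ X β.ker ω := fun k _ =>
    Eventually.of_forall fun g => hωφ g k
  refine (isUniformlyConvexMid hX).exists_minimal_of_coercive
    (isInvariantConvex_almostInvariant hX hcomm hp₀) p₀ (Q := β '' Q)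
    (c := max c 0 * √(μ.real F)) (C₁ := C₁ + C₂ * (max M 0 * √(μ.real F))) (C₂ := C₂)
    ?_ (by positivity) ?_ hC₂ ?_
  · rintro _ ⟨v, -, rfl⟩
    exact ⟨v, rfl⟩
  · rintro b hb
    refine dist_le_of_ae_le (le_max_right _ _) (Eventually.of_forall fun g => ?_)
    exact (hωφ g b).trans ((hc (mem_image_of_mem _ hb)).trans (le_max_left _ _))
  -- write `v = (v * (β v)⁻¹) * β v`: the first factor lies in the kernel of `β` and moves `p` a bounded
  -- amount, the second lies in the range of `β`
  · intro p hp s hs hps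
    have h1 := H p (max M 0 * √(μ.real F) + s) (by positivity) fun v hv => by
      have e1 : dist p ((v * (β v)⁻¹) • p) ≤ max M 0 * √(μ.real F) := by
        refine dist_le_of_ae_le (le_max_right _ _) ?_
        filter_upwards [hp _ (hα v)] with g hg
        exact hg.trans ((hM (mem_image_of_mem _ hv)).trans (le_max_left _ _))
      have e2 := dist_triangle p ((v * (β v)⁻¹) • p) (v • p)
      have e3 : v • p = (v * (β v)⁻¹) • β v • p := by
        rw [← mul_smul, inv_mul_cancel_right]
      have e4 := hps _ (mem_image_of_mem β hv)
      rw [e3, dist_smul, ← e3] at e2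
      linarith
    linarith

variable [SigmaCompactSpace G] [Regular μ]

/-- The members of a minimal set have constant pairwise distances: their displacements under the
complementary factor agree, so that their distance function is invariant by the parallelogram lemma,
and ergodicity applies. -/
theorem exists_ae_dist_eq (hX : IsUCBusemann X) {A B : Subgroup G} [A.Normal]
    (hAB : ∀ a ∈ A, ∀ b ∈ B, a * b = b * a)
    (hdense : Dense {g : G | ∃ γ ∈ Γ, ∃ a ∈ A, g = γ * a}) {Z : Set (L2Equivariant Γ F μ X)}
    (hZ : Minimal (IsInvariantConvex (mid hX) B) Z) {φ ψ : L2Equivariant Γ F μ X} (hφ : φ ∈ Z)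
    (hψ : ψ ∈ Z) : ∃ c : ℝ, ∀ᵐ g ∂μ, dist (φ g) (ψ g) = c := by
  have hconst : ∀ k ∈ A, ∀ x ∈ Z, ∀ y ∈ Z, dist x (k • x) = dist y (k • y) := by
    intro k hk x hx y hy
    refine hZ.eq_of_invariant (f := fun x => dist x (k • x))
      (continuous_id.dist (isometry_smul _ k).continuous).continuousOn ?_ ?_ hx hy
    · intro x _ y _
      rw [smul_mid]
      exact dist_mid_mid_le_max hX _ _ _ _
    · intro b hb x _
      rw [← mul_smul, hAB k hk b hb, mul_smul, dist_smul]
  have hA : ∀ k ∈ A, ∀ᵐ g ∂μ, dist (φ (g * k)) (ψ (g * k)) = dist (φ g) (ψ g) := by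
    intro k hk
    have := ae_dist_eq_of_parallel hX (φ := φ) (φ' := ψ) (ψ := k • φ) (ψ' := k • ψ) rfl
      (hconst k hk ψ hψ φ hφ) (hconst k hk _ (hZ.1.mid_mem φ hφ ψ hψ) φ hφ)
    filter_upwards [this] with g hg
    exact hg.symm
  -- the distance need not be bounded, so ergodicity is applied to its truncations
  have hN : ∀ N : ℕ, ∃ c : ℝ, ∀ᵐ g ∂μ, min (dist (φ g) (ψ g)) N = c := fun N =>
    ae_eq_const_of_invariant (f := fun g => min (dist (φ g) (ψ g)) N) (M := N)
      ((φ.measurable.dist ψ.measurable).min measurable_const)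
      (fun g => le_min dist_nonneg N.cast_nonneg) (fun g => min_le_right _ _) Γ A hdense
      (fun γ hγ g => by
        have h1 := φ.map_mul ⟨γ, hγ⟩ g
        have h2 := ψ.map_mul ⟨γ, hγ⟩ g
        simp only at h1 h2
        rw [h1, h2, dist_smul])
      fun a ha => (hA a ha).mono fun g hg => by rw [hg]
  choose c hc using hN
  have hall := ae_all_iff.2 hc
  obtain ⟨g₀, hg₀⟩ := hall.exists
  refine ⟨dist (φ g₀) (ψ g₀), ?_⟩
  filter_upwards [hall] with g hg
  obtain ⟨N, hN⟩ := exists_nat_ge (max (dist (φ g) (ψ g)) (dist (φ g₀) (ψ g₀)))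
  have := (hg N).trans (hg₀ N).symm
  rwa [min_eq_left ((le_max_left _ _).trans hN), min_eq_left ((le_max_right _ _).trans hN)] at this

theorem dist_eq_of_ae_dist_eq {φ ψ : L2Equivariant Γ F μ X} {c : ℝ} (hc : 0 ≤ c)
    (h : ∀ᵐ g ∂μ, dist (φ g) (ψ g) = c) : dist φ ψ = c * √(μ.real F) := by
  refine (sq_eq_sq₀ dist_nonneg (by positivity)).1 ?_
  rw [sq_dist_eq_integral, mul_pow, Real.sq_sqrt measureReal_nonneg,
    integral_congr_ae (g := fun _ => c ^ 2)
    ((ae_restrict_of_ae h).mono fun g hg => by simp only [hg]), setIntegral_const, smul_eq_mul,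
    mul_comm]

/-- The members of a minimal set are continuous, up to null sets. -/
theorem exists_continuous_of_mem_minimal (hΓ : IsUniformLattice Γ) (hX : IsUCBusemann X)
    (β : G →* G) (hβ : Continuous β) (hββ : ∀ g, β (β g) = β g)
    (hcomm : ∀ a ∈ β.ker, ∀ b ∈ β.range, a * b = b * a)
    (hdense : Dense {g : G | ∃ γ ∈ Γ, ∃ a ∈ β.ker, g = γ * a}) {ω : G → ℝ} (hω : Continuous ω)
    (hω1 : ω 1 = 0) {Z : Set (L2Equivariant Γ F μ X)}
    (hZω : Z ⊆ almostInvariant Γ F μ X β.ker ω)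
    (hZ : Minimal (IsInvariantConvex (mid hX) β.range) Z) {z : L2Equivariant Γ F μ X}
    (hz : z ∈ Z) :
    ∃ (ψ : G → X) (hψ : Continuous ψ) (hψΓ : ∀ (γ : Γ) (g : G), ψ (γ * g) = γ • ψ g),
      dist z (ofContinuous ψ hψ hψΓ) = 0 := by
  have hα : ∀ g, g * (β g)⁻¹ ∈ β.ker := fun g => by
    rw [MonoidHom.mem_ker, _root_.map_mul, map_inv, hββ, mul_inv_cancel]
  have hF0 : 0 < √(μ.real F) := Real.sqrt_pos.2
    (ENNReal.toReal_pos (hF.out.measure_ne_zero μ) (hF.out.measure_lt_top μ).ne)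
  -- modulus of continuity: the part of `u` in the kernel of `β` moves values by at most `ω`, and the part
  -- in the range of `β` moves them by a constant distance, which is the normalized distance in `L²`
  obtain ⟨ψ, hψ, hzψ, -⟩ := exists_continuous_ae_eq (μ := μ) z.measurable
    (ω := fun u => ω (u * (β u)⁻¹) + dist z (β u • z) / √(μ.real F)) (by
      have t1 : Tendsto (fun u => ω (u * (β u)⁻¹)) (𝓝 1) (𝓝 0) := by
        have : Continuous fun u => ω (u * (β u)⁻¹) := by fun_prop
        simpa [hω1] using this.tendsto 1
      have t2 : Tendsto (fun u => dist z (β u • z)) (𝓝 1) (𝓝 0) :=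
        (z.tendsto_dist_smul_self hΓ).comp (by simpa using hβ.tendsto 1)
      simpa using t1.add (t2.div_const √(μ.real F))) (fun u => by
      obtain ⟨c, hc⟩ := exists_ae_dist_eq hX hcomm hdense hZ hz
        (hZ.1.smul_mem _ ⟨u, rfl⟩ z hz)
      have hc0 : 0 ≤ c := by
        obtain ⟨g, hg⟩ := hc.exists
        exact hg ▸ dist_nonneg
      rw [dist_eq_of_ae_dist_eq hc0 hc, mul_div_cancel_right₀ _ hF0.ne']
      filter_upwards [ae_mul_right hc (u * (β u)⁻¹), hZω hz _ (hα u)] with g h1 h2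
      rw [smul_apply, mul_assoc, inv_mul_cancel_right] at h1
      have := dist_triangle_left (z (g * u)) (z g) (z (g * (u * (β u)⁻¹)))
      rw [dist_comm (z (g * (u * (β u)⁻¹))) (z g)] at this
      linarith)
  have hψΓ : ∀ (γ : Γ) (g : G), ψ (γ * g) = γ • ψ g := by
    intro γ g
    have : (fun g => ψ (γ * g)) = fun g => γ • ψ g := by
      refine (Continuous.ae_eq_iff_eq μ (hψ.comp (continuous_const_mul _))
        (hψ.const_smul γ)).1 ?_
      filter_upwards [hzψ, ae_mul_left hzψ (γ : G)] with g h1 h2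
      change ψ (γ * g) = γ • ψ g
      rw [← h1, ← h2, map_mul]
    exact congrFun this g
  refine ⟨ψ, hψ, hψΓ, le_antisymm ?_ dist_nonneg⟩
  have := dist_le_of_ae_le (φ := z) (ψ := ofContinuous ψ hψ hψΓ) le_rfl
    (hzψ.mono fun g hg => (dist_eq_zero.2 hg).le)
  rwa [zero_mul] at this

end L2Equivariant

end MinimalFamilies

/-! ### The action on the boundary -/

section BoundaryAction

theorem dist_eq_of_dist_eq_zero {Y : Type*} [PseudoMetricSpace Y] {x y z : Y} (h : dist x y = 0) :
    dist x z = dist y z :=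
  sub_eq_zero.1 (abs_nonpos_iff.1 ((abs_dist_sub_le x y z).trans_eq h))

variable {G : Type*} [Group G] [TopologicalSpace G] {Γ : Subgroup G} {X : Type*} [MetricSpace X]
  [MulAction Γ X]

/-- A convex family of continuous equivariant maps with constant pairwise distances, invariant under
the right translations in the direct factor `β.range` of `G`, whose members are moved by the
translations in the complementary factor `β.ker` at most as prescribed by `ω`. -/
structure IsParallelFamily (hX : IsUCBusemann X) (Γ : Subgroup G) [MulAction Γ X] (β : G →* G)
    (ω : G → ℝ) (E : Set (G → X)) : Prop where
  nonempty : E.Nonempty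
  continuous : ∀ ψ ∈ E, Continuous ψ
  map_mul : ∀ ψ ∈ E, ∀ (γ : Γ) (g : G), ψ (γ * g) = γ • ψ g
  mid_mem : ∀ ψ ∈ E, ∀ ψ' ∈ E, (fun g => hX.mid (ψ g) (ψ' g)) ∈ E
  translate_mem : ∀ ψ ∈ E, ∀ b ∈ β.range, (fun g => ψ (g * b)) ∈ E
  dist_eq : ∀ ψ ∈ E, ∀ ψ' ∈ E, ∀ g, dist (ψ g) (ψ' g) = dist (ψ 1) (ψ' 1)
  dist_le : ∀ ψ ∈ E, ∀ k ∈ β.ker, ∀ g, dist (ψ g) (ψ (g * k)) ≤ ω k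
  isClosed : IsClosed ((fun ψ : G → X => ψ 1) '' E)

section Existence

open MeasureTheory Measure L2Equivariant

variable [IsTopologicalGroup G] [T2Space G] [LocallyCompactSpace G] [SigmaCompactSpace G]
  [IsIsometricSMul Γ X] [ProperSpace X] [Nonempty X]

/-- A minimal invariant convex set of equivariant maps gives a parallel family; the family is reduced
to one map if it is bounded. -/
theorem IsUniformLattice.exists_isParallelFamily (hΓ : IsUniformLattice Γ) (hX : IsUCBusemann X)
    (hfix : ¬ ∃ ξ : VisualBoundary X, ∀ γ : Γ, γ • ξ = ξ) (β : G →* G) (hβ : Continuous β)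
    (hββ : ∀ g, β (β g) = β g) (hcomm : ∀ a ∈ β.ker, ∀ b ∈ β.range, a * b = b * a)
    (hdense : Dense {g : G | ∃ γ ∈ Γ, ∃ a ∈ β.ker, g = γ * a}) {φ : G → X} (hφ : Continuous φ)
    (hφΓ : ∀ (γ : Γ) (g : G), φ (γ * g) = γ • φ g) {ω : G → ℝ} (hω : Continuous ω)
    (hωφ : ∀ g u, dist (φ g) (φ (g * u)) ≤ ω u) (hω1 : ω 1 = 0) :
    ∃ E : Set (G → X), IsParallelFamily hX Γ β ω E ∧
      (Bornology.IsBounded ((fun ψ : G → X => ψ 1) '' E) → E.Subsingleton) := by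
  borelize G X
  obtain ⟨F, hF'⟩ := hΓ.exists_isLatticeDomain
  have hF : Fact (IsLatticeDomain Γ F) := ⟨hF'⟩
  have hcount := hΓ.countable
  set μ : Measure G := haar with hμ
  have hunim : IsMulRightInvariant μ := hF'.isMulRightInvariant μ
  have hF0 : 0 < √(μ.real F) := Real.sqrt_pos.2
    (ENNReal.toReal_pos (hF'.measure_ne_zero μ) (hF'.measure_lt_top μ).ne)
  obtain ⟨Z, hZω, hZ⟩ := exists_minimal (F := F) (μ := μ) hX hfix β hβ hββ hcomm hφ hφΓ hω hωφ
  set E : Set (G → X) := {ψ | ∃ (hψ : Continuous ψ)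
    (hψΓ : ∀ (γ : Γ) (g : G), ψ (γ * g) = γ • ψ g),
    (ofContinuous ψ hψ hψΓ : L2Equivariant Γ F μ X) ∈ Z} with hE
  have hrep : ∀ z ∈ Z, ∃ (ψ : G → X) (hψ : Continuous ψ)
      (hψΓ : ∀ (γ : Γ) (g : G), ψ (γ * g) = γ • ψ g),
      (ofContinuous ψ hψ hψΓ : L2Equivariant Γ F μ X) ∈ Z ∧
        dist z (ofContinuous ψ hψ hψΓ) = 0 := by
    intro z hz
    obtain ⟨ψ, hψ, hψΓ, h⟩ := exists_continuous_of_mem_minimal hΓ hX β hβ hββ hcomm hdense hω hω1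
      hZω hZ hz
    exact ⟨ψ, hψ, hψΓ, ((Metric.inseparable_iff.2 h).mem_closed_iff hZ.1.isClosed).1 hz, h⟩
  have hdist : ∀ ψ ∈ E, ∀ ψ' ∈ E, ∀ g, dist (ψ g) (ψ' g) = dist (ψ 1) (ψ' 1) := by
    rintro ψ ⟨hψ, hψΓ, hψZ⟩ ψ' ⟨hψ', hψΓ', hψZ'⟩ g
    obtain ⟨c, hc⟩ := exists_ae_dist_eq hX hcomm hdense hZ hψZ hψZ'
    have : (fun g => dist (ψ g) (ψ' g)) = fun _ => c :=
      (Continuous.ae_eq_iff_eq μ (hψ.dist hψ') continuous_const).1 hc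
    exact (congrFun this g).trans (congrFun this 1).symm
  -- on continuous members of `Z` the `L²` distance is a multiple of the distance of the values at `1`
  have hscale : ∀ (ψ : G → X) (hψ : Continuous ψ) (hψΓ : ∀ (γ : Γ) (g : G), ψ (γ * g) = γ • ψ g)
      (hψZ : (ofContinuous ψ hψ hψΓ : L2Equivariant Γ F μ X) ∈ Z) (ψ' : G → X)
      (hψ' : Continuous ψ') (hψΓ' : ∀ (γ : Γ) (g : G), ψ' (γ * g) = γ • ψ' g)
      (hψZ' : (ofContinuous ψ' hψ' hψΓ' : L2Equivariant Γ F μ X) ∈ Z),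
      dist (ofContinuous ψ hψ hψΓ : L2Equivariant Γ F μ X) (ofContinuous ψ' hψ' hψΓ') =
        dist (ψ 1) (ψ' 1) * √(μ.real F) := fun ψ hψ hψΓ hψZ ψ' hψ' hψΓ' hψZ' =>
    dist_eq_of_ae_dist_eq dist_nonneg
      (Eventually.of_forall (hdist ψ ⟨hψ, hψΓ, hψZ⟩ ψ' ⟨hψ', hψΓ', hψZ'⟩))
  refine ⟨E, ⟨?_, ?_, ?_, ?_, ?_, hdist, ?_, ?_⟩, ?_⟩
  · obtain ⟨z, hz⟩ := hZ.1.nonempty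
    obtain ⟨ψ, hψ, hψΓ, hψZ, -⟩ := hrep z hz
    exact ⟨ψ, hψ, hψΓ, hψZ⟩
  · exact fun ψ h => h.1
  · exact fun ψ h => h.2.1
  · rintro ψ ⟨hψ, hψΓ, hψZ⟩ ψ' ⟨hψ', hψΓ', hψZ'⟩
    exact ⟨hX.continuous_mid.comp (hψ.prodMk hψ'),
      fun γ g => by simp only [hψΓ, hψΓ', hX.smul_mid], hZ.1.mid_mem _ hψZ _ hψZ'⟩
  · rintro ψ ⟨hψ, hψΓ, hψZ⟩ b hb
    exact ⟨hψ.comp (continuous_mul_const b), fun γ g => by simp only [mul_assoc, hψΓ],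
      hZ.1.smul_mem b hb _ hψZ⟩
  · rintro ψ ⟨hψ, hψΓ, hψZ⟩ k hk g
    have hcl : IsClosed {g | dist (ψ g) (ψ (g * k)) ≤ ω k} :=
      isClosed_le (hψ.dist (hψ.comp (continuous_mul_const k))) continuous_const
    exact hcl.closure_subset (Measure.dense_of_ae (hZω hψZ k hk) g)
  · refine IsSeqClosed.isClosed fun x a hx ha => ?_
    choose ψ hψE hψx using hx
    choose hψ hψΓ hψZ using hψE
    have hcau : CauchySeq fun n => (ofContinuous (ψ n) (hψ n) (hψΓ n) : L2Equivariant Γ F μ X) := by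
      rw [Metric.cauchySeq_iff]
      intro ε hε
      obtain ⟨N, hN⟩ := Metric.cauchySeq_iff.1 ha.cauchySeq (ε / √(μ.real F)) (by positivity)
      refine ⟨N, fun m hm n hn => ?_⟩
      rw [hscale _ _ _ (hψZ m) _ _ _ (hψZ n), ← lt_div_iff₀ hF0]
      simpa only [← hψx] using hN m hm n hn
    obtain ⟨z, hz⟩ := cauchySeq_tendsto_of_complete hcau
    have hzZ : z ∈ Z := hZ.1.isClosed.mem_of_tendsto hz (Eventually.of_forall hψZ)
    obtain ⟨χ, hχ, hχΓ, hχZ, hzχ⟩ := hrep z hzZ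
    refine ⟨χ, ⟨hχ, hχΓ, hχZ⟩, tendsto_nhds_unique (f := x) (l := atTop) ?_ ha⟩
    have h1 : Tendsto (fun n => dist (ψ n 1) (χ 1) * √(μ.real F)) atTop (𝓝 0) := by
      have := tendsto_iff_dist_tendsto_zero.1 hz
      refine this.congr fun n => ?_
      rw [← hscale _ _ _ (hψZ n) _ _ _ hχZ]
      rw [dist_comm, dist_eq_of_dist_eq_zero hzχ, dist_comm]
    rw [tendsto_iff_dist_tendsto_zero]
    have h2 := h1.div_const √(μ.real F)
    simp only [mul_div_cancel_right₀ _ hF0.ne', zero_div] at h2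
    simpa only [← hψx] using h2
  · rintro hb ψ ⟨hψ, hψΓ, hψZ⟩ ψ' ⟨hψ', hψΓ', hψZ'⟩
    obtain ⟨M, hM⟩ := Metric.isBounded_iff.1 hb
    have hZb : Bornology.IsBounded Z := by
      refine Metric.isBounded_iff.2 ⟨M * √(μ.real F), fun z hz z' hz' => ?_⟩
      obtain ⟨χ, hχ, hχΓ, hχZ, hzχ⟩ := hrep z hz
      obtain ⟨χ', hχ', hχΓ', hχZ', hzχ'⟩ := hrep z' hz'
      rw [dist_eq_of_dist_eq_zero hzχ, dist_comm, dist_eq_of_dist_eq_zero hzχ', dist_comm,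
        hscale _ _ _ hχZ _ _ _ hχZ']
      exact mul_le_mul_of_nonneg_right (hM ⟨χ, ⟨hχ, hχΓ, hχZ⟩, rfl⟩ ⟨χ', ⟨hχ', hχΓ', hχZ'⟩, rfl⟩)
        hF0.le
    have h0 := (isUniformlyConvexMid hX).dist_eq_zero_of_minimal hZ hZb hψZ hψZ'
    rw [hscale _ _ _ hψZ _ _ _ hψZ', mul_eq_zero, or_iff_left hF0.ne'] at h0
    funext g
    rw [← dist_eq_zero, hdist ψ ⟨hψ, hψΓ, hψZ⟩ ψ' ⟨hψ', hψΓ', hψZ'⟩, h0]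

end Existence

/-- An unbounded parallel family: the values at the identity form a closed convex set on which the
factor `β.range` acts by translation of the family. On this set, an element `γ ∈ Γ` is at bounded
distance from `β γ`. -/
theorem IsParallelFamily.exists_boundary_action [IsTopologicalGroup G] [IsIsometricSMul Γ X]
    [ProperSpace X] {hX : IsUCBusemann X} {β : G →* G} (hβ : Continuous β)
    (hββ : ∀ g, β (β g) = β g) {ω : G → ℝ} {E : Set (G → X)} (hE : IsParallelFamily hX Γ β ω E)
    (hunb : ¬ Bornology.IsBounded ((fun ψ : G → X => ψ 1) '' E)) :
    ∃ L : Set (VisualBoundary X), L.Nonempty ∧ IsClosed L ∧ (∀ γ : Γ, ∀ ξ ∈ L, γ • ξ ∈ L) ∧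
      ∃ ρ : G →* Equiv.Perm L, Continuous (fun p : G × L => ρ p.1 p.2) ∧
        (∀ (γ : Γ) (ξ : L), ((ρ (γ : G) ξ : L) : VisualBoundary X) =
          γ • (ξ : VisualBoundary X)) ∧ ∀ g, β g = 1 → ρ g = 1 := by
  set K := (fun ψ : G → X => ψ 1) '' E with hK
  have hex : ∀ x : K, ∃ ψ ∈ E, ψ 1 = x := fun x => x.2
  choose Ψ hΨE hΨ1 using hex
  have huniq : ∀ ψ ∈ E, ∀ x : K, ψ 1 = x → ψ = Ψ x := by
    intro ψ hψ x hx
    funext g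
    rw [← dist_eq_zero, hE.dist_eq ψ hψ _ (hΨE x), hx, hΨ1, dist_self]
  have htr : ∀ (b : β.range) (x : K), (fun g => Ψ x (g * b)) ∈ E := fun b x =>
    hE.translate_mem _ (hΨE x) b b.2
  -- `b` sends the value at `1` of a member of the family to its value at `b`
  let act : MulAction β.range K :=
    { smul := fun b x => ⟨Ψ x b, _, htr b x, by simp⟩
      one_smul := fun x => Subtype.ext (hΨ1 x)
      mul_smul := fun b c x => by
        refine Subtype.ext ?_
        have := huniq _ (htr c x) ⟨Ψ x c, _, htr c x, by simp⟩ (by simp)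
        exact congrFun this b }
  have hsmul : ∀ (b : β.range) (x : K), ((b • x : K) : X) = Ψ x b := fun _ _ => rfl
  have hdist : ∀ (x y : K) (g : G), dist (Ψ x g) (Ψ y g) = dist x y := fun x y g => by
    rw [hE.dist_eq _ (hΨE x) _ (hΨE y), hΨ1, hΨ1, Subtype.dist_eq]
  have hiso : IsIsometricSMul β.range K := ⟨fun b => Isometry.of_dist_eq fun x y => by
    rw [Subtype.dist_eq, hsmul, hsmul, hdist]⟩
  have hcont : ContinuousSMul β.range K := by
    refine ⟨continuous_induced_rng.2 (continuous_iff_continuousAt.2 ?_)⟩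
    rintro ⟨b, x⟩
    rw [ContinuousAt, tendsto_iff_dist_tendsto_zero]
    have h1 : Tendsto (fun p : β.range × K => dist p.2 x + dist (Ψ x p.1) (Ψ x b)) (𝓝 (b, x))
        (𝓝 0) := by
      have hc := (hE.continuous _ (hΨE x)).comp
        (continuous_subtype_val.comp (continuous_fst (X := β.range) (Y := K)))
      have : Continuous fun p : β.range × K => dist p.2 x + dist (Ψ x p.1) (Ψ x b) :=
        (continuous_snd.dist continuous_const).add (hc.dist continuous_const)
      simpa using this.tendsto (b, x)
    refine squeeze_zero (fun _ => dist_nonneg) (fun p => ?_) h1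
    have := dist_triangle (Ψ p.2 p.1) (Ψ x p.1) (Ψ x b)
    rw [hdist] at this
    exact this
  obtain ⟨L, hLne, hLcl, hLΓ, ρ, hρ, hρΓ⟩ := hX.exists_boundary_action (K := K) hE.isClosed (by
      rintro _ ⟨ψ, hψ, rfl⟩ _ ⟨ψ', hψ', rfl⟩
      exact ⟨_, hE.mid_mem ψ hψ ψ' hψ', rfl⟩) hunb (β.rangeRestrict.comp Γ.subtype) (fun γ => by
    refine ⟨ω ((β γ)⁻¹ * γ), fun x => ?_⟩
    have h1 := hE.dist_le _ (hΨE x) ((β γ)⁻¹ * γ)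
      (by rw [MonoidHom.mem_ker, _root_.map_mul, map_inv, hββ, inv_mul_cancel]) (β γ)
    rw [mul_inv_cancel_left, dist_comm] at h1
    have h2 := hE.map_mul _ (hΨE x) γ 1
    rw [mul_one, hΨ1] at h2
    rw [← h2]
    exact h1)
  refine ⟨L, hLne, hLcl, hLΓ, ρ.comp β.rangeRestrict, ?_, fun γ ξ => hρΓ γ ξ, fun g hg => ?_⟩
  · have hc : Continuous fun p : G × L => (β.rangeRestrict p.1, p.2) :=
      ((hβ.subtype_mk _).comp continuous_fst).prodMk continuous_snd
    exact hρ.comp hc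
  · have : β.rangeRestrict g = 1 := Subtype.ext hg
    rw [MonoidHom.comp_apply, this, map_one]

end BoundaryAction

theorem theorem2 {n : ℕ} (hn : 1 < n) {G : Fin n → Type*} [∀ i, Group (G i)]
    [∀ i, TopologicalSpace (G i)] [∀ i, IsTopologicalGroup (G i)] [∀ i, T2Space (G i)]
    [∀ i, LocallyCompactSpace (G i)] (hG : IsCompactlyGeneratedGroup (∀ i, G i))
    (Γ : Subgroup (∀ i, G i)) (hΓ : IsUniformLattice Γ) (hirr : IsIrreducibleInProduct Γ)
    {X : Type*} [MetricSpace X] [Nonempty X] [CompleteSpace X] [ProperSpace X]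
    (hX : IsBusemannNPC X) (hUC : IsUniformlyConvexMetric X)
    [MulAction Γ X] [IsIsometricSMul Γ X] (hfix : ¬ ∃ x : X, ∀ γ : Γ, γ • x = x) :
    ∃ L : Set (VisualBoundary X), L.Nonempty ∧ IsClosed L ∧
      (∀ γ : Γ, ∀ ξ ∈ L, γ • ξ ∈ L) ∧
      ∃ ρ : (∀ i, G i) →* Equiv.Perm L,
        Continuous (fun p : (∀ i, G i) × L => ρ p.1 p.2) ∧
        (∀ (γ : Γ) (ξ : L), ((ρ (γ : ∀ i, G i) ξ : L) : VisualBoundary X) =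
          γ • (ξ : VisualBoundary X)) ∧
        ∃ i : Fin n, ∀ g : ∀ j, G j, g i = 1 → ρ g = 1 := by
  by_cases hξ : ∃ ξ : VisualBoundary X, ∀ γ : Γ, γ • ξ = ξ
  · obtain ⟨ξ, hξ⟩ := hξ
    have := VisualBoundary.t2Space hX
    refine ⟨{ξ}, singleton_nonempty ξ, isClosed_singleton, ?_, 1, continuous_snd, ?_,
      ⟨0, by omega⟩, fun _ _ => rfl⟩
    · rintro γ _ rfl
      exact hξ γ
    · rintro γ ⟨_, rfl⟩
      exact (hξ γ).symm
  by_contra hcon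
  have hX' : IsUCBusemann X := ⟨hX, hUC⟩
  have hσ := hG.sigmaCompactSpace
  -- equivariant maps invariant under more and more factors
  have key : ∀ S : Finset (Fin n), ∃ φ : (∀ i, G i) → X, Continuous φ ∧
      (∀ (γ : Γ) (g : ∀ i, G i), φ (γ * g) = γ • φ g) ∧
      ∀ j ∈ S, ∀ (x : G j) (g : ∀ i, G i), φ (g * Pi.mulSingle j x) = φ g := by
    intro S
    induction S using Finset.induction_on with
    | empty =>
      obtain ⟨φ, hφ, hφΓ⟩ := hΓ.exists_continuous_equivariant hX'
      exact ⟨φ, hφ, hφΓ, by simp⟩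
    | insert i S hi ih =>
      obtain ⟨φ, hφ, hφΓ, hφS⟩ := ih
      obtain ⟨ω, hω, hω0, hωφ, hω1⟩ := hΓ.exists_modulus hφ hφΓ
      set β : (∀ i, G i) →* (∀ i, G i) :=
        (MonoidHom.mulSingle G i).comp (Pi.evalMonoidHom G i) with hβdef
      have hβ : ∀ g, β g = Pi.mulSingle i (g i) := fun g => rfl
      have hβc : Continuous β := (continuous_mulSingle i).comp (continuous_apply i)
      have hββ : ∀ g, β (β g) = β g := fun g => by simp [hβ]
      have hker : ∀ g, g ∈ β.ker ↔ g i = 1 := fun g => by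
        rw [MonoidHom.mem_ker, hβ, Pi.mulSingle_eq_one_iff]
      have hcomm : ∀ a ∈ β.ker, ∀ b ∈ β.range, a * b = b * a := by
        rintro a ha _ ⟨b, rfl⟩
        rw [hker] at ha
        funext j
        rcases eq_or_ne j i with rfl | hj
        · simp [hβ, ha]
        · simp [hβ, Pi.mulSingle_eq_of_ne hj]
      have hdense : Dense {g : ∀ i, G i | ∃ γ ∈ Γ, ∃ a ∈ β.ker, g = γ * a} := by
        simpa only [hker] using hirr i
      obtain ⟨E, hE, hEb⟩ := hΓ.exists_isParallelFamily hX' hξ β hβc hββ hcomm hdense hφ hφΓ hω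
        hωφ (hω1 1 (by simp))
      by_cases hb : Bornology.IsBounded ((fun ψ : (∀ i, G i) → X => ψ 1) '' E)
      · obtain ⟨ψ, hψ⟩ := hE.nonempty
        refine ⟨ψ, hE.continuous ψ hψ, hE.map_mul ψ hψ, fun j hj x g => ?_⟩
        rcases Finset.mem_insert.1 hj with rfl | hjS
        · exact congrFun (hEb hb (hE.translate_mem ψ hψ (Pi.mulSingle j x)
            ⟨Pi.mulSingle j x, by simp [hβ]⟩) hψ) g
        · have hji : j ≠ i := fun h => hi (h ▸ hjS)
          have h1 := hE.dist_le ψ hψ (Pi.mulSingle j x)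
            ((hker _).2 (Pi.mulSingle_eq_of_ne hji.symm x)) g
          rw [hω1 _ (hφS j hjS x)] at h1
          exact (dist_le_zero.1 h1).symm
      · obtain ⟨L, h1, h2, h3, ρ, h4, h5, h6⟩ := hE.exists_boundary_action hβc hββ hb
        exact absurd ⟨L, h1, h2, h3, ρ, h4, h5, i, fun g hg => h6 g ((hker g).2 hg)⟩ hcon
  obtain ⟨φ, -, hφΓ, hφ⟩ := key Finset.univ
  set H : Subgroup (∀ i, G i) :=
    { carrier := {u | ∀ g, φ (g * u) = φ g}
      one_mem' := fun g => by rw [mul_one]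
      mul_mem' := fun {a b} ha hb g => by rw [← mul_assoc, hb, ha]
      inv_mem' := fun {a} ha g => by rw [← ha (g * a⁻¹), inv_mul_cancel_right] } with hH
  refine hfix ⟨φ 1, fun γ => ?_⟩
  have hγ : (γ : ∀ i, G i) ∈ H := Subgroup.pi_mem_of_mulSingle_mem _ fun i =>
    hφ i (Finset.mem_univ i) _
  rw [← hφΓ, mul_one, ← hγ 1, one_mul]
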